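/- Let $x\in\mathbb{R}^n$, let $z_0=0$ and let $z_1,\dots,z_J\in\mathbb{R}^n$ be side information signals; write $z_{ji}$ for the $i$-th entry of $z_j$. Fix $\lambda,\epsilon>0$ and put $$w_{ji}=\frac{1}{1+(|x_i-z_{ji}|+\epsilon)\sum_{l\ne j}(|x_i-z_{li}|+\epsilon)^{-1}},\qquad g(v)=\lambda\sum_{j=0}^{J}\sum_{i=1}^{n}|w_{ji}(v_i-z_{ji})| .$$ Assume the following. 1. There are $0<p\le q<n$ such that $x_i-z_{ji}\neq 0$ for all $j$ when $i\le p$, and $x_i-z_{ji}=0$ for all $j$ when $i>q$. 2. At each position $i$ let $z_{(0)i}\le\dots\le z_{(J)i}$ be the sorted values of $z_{0i},\dots,z_{Ji}$, with weights $w_{(0)i},\dots,w_{(J)i}$ permuted accordingly. For $p<i\le q$, exactly $d_i\in\{1,\dots,J\}$ of the differences $x_i-z_{(j)i}$ are zero, and these are consecutive in $j$. 3. With $z_{(-1)i}=-\infty$ and $z_{(J+1)i}=+\infty$, $x_i\in(z_{(l_i)i},z_{(l_i+1)i}]$, where $l_i\in\{-1,\dots,J\}$. Let $$a_i=\sum_{j=0}^{J}w_{(j)i}\,\sigma_{ij},\quad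 \sigma_{ij}=\begin{cases}-1,& l_i<j\\ 1,&\text{otherwise}\end{cases},\qquad c_i=d_i\Big(\sum_{j=0}^{J}\frac{\epsilon}{|x_i-z_{ji}|+\epsilon}\Big)^{-1},$$ and assume that $\epsilon$ is so small that $c_i>1/2$ for all $p<i\le q$. Set $\bar a=\sum_{i=1}^{p}a_i^2$, $\bar s=p+\sum_{i=p+1}^{q}(1-c_i)$, $\delta=(\kappa-1)(\bar s-p)$ and $$\kappa=\frac{\sqrt4\,\min_{p<i\le q}c_i}{\sqrt{\pi\log(n/\bar s)}\,(2\min_{p<i\le q}c_i-1)},\qquad M=2\bar a\log\frac{n}{\bar s}+\frac75\bar s+\delta+1$$ (with $\delta=0$ if $p=q$). Let $D=\bigcup_{\tau>0}\{y: g(x+\tau y)\le g(x)\}$ be the descent cone of $g$ at $x$ and $D^\circ$ its polar cone. For a standard normal vector $h$ in $\mathbb{R}^n$ let $\omega(D)=\mathbb{E}\sup_{u\in D,\|u\|_2=1}h^{T}u$ be the Gaussian width, $\delta(D)=\mathbb{E}\,\mathrm{dist}^2(h,D^\circ)$ the statistical dimension, and $U_g=\inf_{\tau\ge0}\mathbb{E}\,\mathrm{dist}^2(h,\tau\,\partial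 g(x))$. Then $$\omega(D)^2\le\delta(D)\le U_g\le M-1 ,$$ and for every integer $m\ge M$ and every random matrix $\Phi\in\mathbb{R}^{m\times n}$ with i.i.d. centered Gaussian entries of positive variance, $x$ is the unique solution of the weighted $n$-$\ell_1$ minimization problem $$\min_{v}\ g(v)\quad\text{subject to}\quad \Phi v=y,\qquad y=\Phi x,$$ with probability at least $1-\exp\!\big(-\tfrac12(\sqrt m-\omega(D))^2\big)$. -/

import Mathlib

open MeasureTheory ProbabilityTheory

open scoped NNReal

noncomputable section

namespace CSSideInfo

/-! ### Convex cones, Gaussian width and statistical dimension in `ℝⁿ` -/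

section Convex

variable {n : ℕ}

/-- The descent cone of `g` at `x`: the union over `τ > 0` of `{y | g (x + τ y) ≤ g x}`. -/
def descentCone (g : EuclideanSpace ℝ (Fin n) → ℝ) (x : EuclideanSpace ℝ (Fin n)) :
    Set (EuclideanSpace ℝ (Fin n)) :=
  {y | ∃ τ : ℝ, 0 < τ ∧ g (x + τ • y) ≤ g x}

/-- The polar cone `{u | uᵀ y ≤ 0 for all y ∈ C}`. -/
def polarCone (C : Set (EuclideanSpace ℝ (Fin n))) : Set (EuclideanSpace ℝ (Fin n)) :=
  {u | ∀ y ∈ C, inner ℝ u y ≤ 0}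

/-- The subdifferential of `g` at `x`. -/
def subdifferential (g : EuclideanSpace ℝ (Fin n) → ℝ) (x : EuclideanSpace ℝ (Fin n)) :
    Set (EuclideanSpace ℝ (Fin n)) :=
  {u | ∀ y, g x + inner ℝ u (y - x) ≤ g y}

/-- The Gaussian width `𝔼 sup {hᵀ u | u ∈ C, ‖u‖₂ = 1}` for a standard normal vector `h`. -/
def gaussianWidth (C : Set (EuclideanSpace ℝ (Fin n))) : ℝ :=
  ∫ h, sSup ((fun u => inner ℝ h u) '' (C ∩ Metric.sphere 0 1))
    ∂(stdGaussian (EuclideanSpace ℝ (Fin n)))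

/-- The statistical dimension `𝔼 dist² (h, C°)` for a standard normal vector `h`. -/
def statDim (C : Set (EuclideanSpace ℝ (Fin n))) : ℝ :=
  ∫ h, Metric.infDist h (polarCone C) ^ 2 ∂(stdGaussian (EuclideanSpace ℝ (Fin n)))

/-- `inf_{τ ≥ 0} 𝔼 dist² (h, τ · ∂g(x))` for a standard normal vector `h`. -/
def subdiffBound (g : EuclideanSpace ℝ (Fin n) → ℝ) (x : EuclideanSpace ℝ (Fin n)) : ℝ :=
  ⨅ τ : Set.Ici (0 : ℝ),
    ∫ h, Metric.infDist h ((fun u => (τ : ℝ) • u) '' subdifferential g x) ^ 2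
      ∂(stdGaussian (EuclideanSpace ℝ (Fin n)))

/-- `x` is the unique solution of `min g(v)` subject to `Φ v = y`. -/
def IsUniqueSolution {m : ℕ} (g : EuclideanSpace ℝ (Fin n) → ℝ)
    (Φ : Matrix (Fin m) (Fin n) ℝ) (y : Fin m → ℝ) (x : EuclideanSpace ℝ (Fin n)) : Prop :=
  Φ.mulVec (fun i => x i) = y ∧
    ∀ v : EuclideanSpace ℝ (Fin n), Φ.mulVec (fun i => v i) = y → v ≠ x → g x < g v

/-- The entries of the random matrix `Φ` are independent with law `N(0, v)`. -/
structure IsGaussianMatrix {m : ℕ} {Ω : Type*} [MeasurableSpace Ω] (P : Measure Ω)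
    (v : ℝ≥0) (Φ : Ω → Matrix (Fin m) (Fin n) ℝ) : Prop where
  indep : iIndepFun (fun (k : Fin m × Fin n) (ω : Ω) => Φ ω k.1 k.2) P
  law : ∀ r i, HasLaw (fun ω => Φ ω r i) (gaussianReal 0 v) P

end Convex

/-! ### Weighted `n`-`ℓ₁` minimization with side information `z 1, …, z J` and `z 0 = 0` -/

section Signals

variable {n J : ℕ}

/-- The adaptive weights `w_{ji}`. -/
def weight (ε : ℝ) (x : EuclideanSpace ℝ (Fin n)) (z : Fin (J + 1) → EuclideanSpace ℝ (Fin n))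
    (j : Fin (J + 1)) (i : Fin n) : ℝ :=
  1 / (1 + (|x i - z j i| + ε) * ∑ l ∈ Finset.univ.erase j, (|x i - z l i| + ε)⁻¹)

/-- The objective `v ↦ lam * ∑ j, ‖W_j (v - z_j)‖₁` with `W_j = diag (w_{j1}, …, w_{jn})`. -/
def nL1 (lam : ℝ) (w : Fin (J + 1) → Fin n → ℝ) (z : Fin (J + 1) → EuclideanSpace ℝ (Fin n))
    (v : EuclideanSpace ℝ (Fin n)) : ℝ :=
  lam * ∑ j, ∑ i, |w j i * (v i - z j i)|

/-- The first `p > 0` entries of all `x - z_j` are nonzero, and the entries after the first `q`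
are zero in all `x - z_j`, where `q < n`. (Position `i` of `{1, …, n}` is `i - 1 : Fin n`.) -/
structure SupportPattern (x : EuclideanSpace ℝ (Fin n))
    (z : Fin (J + 1) → EuclideanSpace ℝ (Fin n)) (p q : ℕ) : Prop where
  p_pos : 0 < p
  p_le_q : p ≤ q
  q_lt_n : q < n
  nonzero : ∀ i : Fin n, (i : ℕ) < p → ∀ j, x i - z j i ≠ 0
  zero : ∀ i : Fin n, q ≤ (i : ℕ) → ∀ j, x i - z j i = 0

/-- At every position `i` the permutation `σ i` lists the values `z_{0i}, …, z_{Ji}` in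
increasing order. -/
def SortedBy (z : Fin (J + 1) → EuclideanSpace ℝ (Fin n))
    (σ : Fin n → Equiv.Perm (Fin (J + 1))) : Prop :=
  ∀ i, Monotone (fun j => z (σ i j) i)

/-- At each position `i ∈ {p+1, …, q}`, after sorting, exactly `d i ∈ {1, …, J}` consecutive
elements among the `J + 1` elements `x_i - z_{ji}` are zero (starting at some index `k`). -/
def ConsecutiveZeros (x : EuclideanSpace ℝ (Fin n)) (z : Fin (J + 1) → EuclideanSpace ℝ (Fin n))
    (p q : ℕ) (σ : Fin n → Equiv.Perm (Fin (J + 1))) (d : Fin n → ℕ) : Prop :=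
  ∀ i : Fin n, p ≤ (i : ℕ) → (i : ℕ) < q →
    1 ≤ d i ∧ d i ≤ J ∧ ∃ k : ℕ, k + d i ≤ J + 1 ∧
      ∀ j : Fin (J + 1), x i - z (σ i j) i = 0 ↔ k ≤ (j : ℕ) ∧ (j : ℕ) < k + d i

/-- With `z_{(-1)i} = -∞` and `z_{(J+1)i} = ∞`, after sorting, the source satisfies
`x_i ∈ (z_{l_i i}, z_{(l_i+1) i}]` with `l_i ∈ {-1, …, J}`. -/
def Located (x : EuclideanSpace ℝ (Fin n)) (z : Fin (J + 1) → EuclideanSpace ℝ (Fin n))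
    (σ : Fin n → Equiv.Perm (Fin (J + 1))) (l : Fin n → ℤ) : Prop :=
  ∀ i, -1 ≤ l i ∧ l i ≤ J ∧
    (∀ j : Fin (J + 1), ((j : ℕ) : ℤ) = l i → z (σ i j) i < x i) ∧
    (∀ j : Fin (J + 1), ((j : ℕ) : ℤ) = l i + 1 → x i ≤ z (σ i j) i)

/-- The boolean function `𝔟(l < j)`. -/
def bInd (l j : ℤ) : ℕ := if l < j then 1 else 0

/-- `a_i = ∑ j, w_{ji} (-1)^{𝔟(l_i < j)}`, the sum being taken in sorted order. -/
def aCoef (ε : ℝ) (x : EuclideanSpace ℝ (Fin n)) (z : Fin (J + 1) → EuclideanSpace ℝ (Fin n))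
    (σ : Fin n → Equiv.Perm (Fin (J + 1))) (l : Fin n → ℤ) (i : Fin n) : ℝ :=
  ∑ j : Fin (J + 1), weight ε x z (σ i j) i * (-1 : ℝ) ^ bInd (l i) ((j : ℕ) : ℤ)

/-- `c_i = d_i (∑ j, ε / (|x_i - z_{ji}| + ε))⁻¹`. -/
def cCoef (ε : ℝ) (x : EuclideanSpace ℝ (Fin n)) (z : Fin (J + 1) → EuclideanSpace ℝ (Fin n))
    (d : Fin n → ℕ) (i : Fin n) : ℝ :=
  (d i : ℝ) * (∑ j : Fin (J + 1), ε / (|x i - z j i| + ε))⁻¹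

/-- `ā = ∑_{i ≤ p} a_i²`. -/
def aBar (ε : ℝ) (x : EuclideanSpace ℝ (Fin n)) (z : Fin (J + 1) → EuclideanSpace ℝ (Fin n))
    (p : ℕ) (σ : Fin n → Equiv.Perm (Fin (J + 1))) (l : Fin n → ℤ) : ℝ :=
  ∑ i ∈ Finset.univ.filter (fun i : Fin n => (i : ℕ) < p), aCoef ε x z σ l i ^ 2

/-- `s̄ = p + ∑_{p < i ≤ q} (1 - c_i)`. -/
def sBar (ε : ℝ) (x : EuclideanSpace ℝ (Fin n)) (z : Fin (J + 1) → EuclideanSpace ℝ (Fin n))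
    (p q : ℕ) (d : Fin n → ℕ) : ℝ :=
  (p : ℝ) + ∑ i ∈ Finset.univ.filter (fun i : Fin n => p ≤ (i : ℕ) ∧ (i : ℕ) < q), (1 - cCoef ε x z d i)

/-- `min {c_i | p < i ≤ q}`. (For `p = q` the value is irrelevant: it enters only through `κ`,
which is then multiplied by `s̄ - p = 0`.) -/
def cMin (ε : ℝ) (x : EuclideanSpace ℝ (Fin n)) (z : Fin (J + 1) → EuclideanSpace ℝ (Fin n))
    (p q : ℕ) (d : Fin n → ℕ) : ℝ :=
  ⨅ i : {i : Fin n // p ≤ (i : ℕ) ∧ (i : ℕ) < q}, cCoef ε x z d i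

/-- `κ = √4 min c_i / (√(π log (n / s̄)) (2 min c_i - 1))`. -/
def kappa (ε : ℝ) (x : EuclideanSpace ℝ (Fin n)) (z : Fin (J + 1) → EuclideanSpace ℝ (Fin n))
    (p q : ℕ) (d : Fin n → ℕ) : ℝ :=
  Real.sqrt 4 * cMin ε x z p q d /
    (Real.sqrt (Real.pi * Real.log ((n : ℝ) / sBar ε x z p q d)) * (2 * cMin ε x z p q d - 1))

/-- `δ = (κ - 1) (s̄ - p)`. -/
def deltaTerm (ε : ℝ) (x : EuclideanSpace ℝ (Fin n))
    (z : Fin (J + 1) → EuclideanSpace ℝ (Fin n)) (p q : ℕ) (d : Fin n → ℕ) : ℝ :=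
  (kappa ε x z p q d - 1) * (sBar ε x z p q d - p)

/-- The measurement bound `2 ā log (n / s̄) + (7/5) s̄ + δ + 1`. -/
def measurementBound (ε : ℝ) (x : EuclideanSpace ℝ (Fin n))
    (z : Fin (J + 1) → EuclideanSpace ℝ (Fin n)) (p q : ℕ)
    (σ : Fin n → Equiv.Perm (Fin (J + 1))) (l : Fin n → ℤ) (d : Fin n → ℕ) : ℝ :=
  2 * aBar ε x z p σ l * Real.log ((n : ℝ) / sBar ε x z p q d) + 7 / 5 * sBar ε x z p q d
    + deltaTerm ε x z p q d + 1

end Signals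

end CSSideInfo

end

/-!
The four assertions are of different nature.

*Width, statistical dimension and subdifferential.* Every `u` in the descent cone `D` with `‖u‖ = 1`
satisfies `⟨h, u⟩ ≤ dist (h, D°)`, so `ω(D)² ≤ δ(D)` by Jensen's inequality
(`gaussianWidth_sq_le_statDim`). Multiples of subgradients lie in `D°`, whence `δ(D) ≤ U_g`
(`statDim_le_subdiffBound`).

*The bound on `U_g`.* At each position the weights sum to one, and the subdifferential of the weighted
sum of absolute values is an interval: its half length is the weight `c_i` of the signals that agree
with `x` there, and its midpoint is the signed sum of the remaining weights. So the expected squared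
distance to `τ ∂g(x)` is a sum of second-order Gaussian tails `𝔼 (u - t)₊²`
(`subdiffBound_nL1_le`). These are convex in `t`, which reduces every position to its extreme case
(`gaussTail_add_gaussTail_le`), and at most `exp (-t² / 2) / (√(2π) t)`. The choice
`t = √(2 log (n / s̄))` turns the sum into the measurement bound (`subdiffBound_add_one_le`).

*The probability of failure.* If `x` is not the unique solution, the Gaussian matrix kills a unit
vector of `D`. The classical escape theorem would give an exponent with the mean norm `λ_m` of a
Gaussian vector in `ℝᵐ` in place of `√m`, which is weaker than what is claimed. The proof goes through
Gordon's comparison in the form `P (inf ‖A u‖ + ξ < r) ≤ P (‖g‖ - sup ⟨h, u⟩ ≤ r)` with an independent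
standard normal `ξ` (`gordon_countable`), tested against decreasing functions `ψ`:
`P (fail) 𝔼 ψ(ξ) ≤ 𝔼 ψ (‖g‖ - sup ⟨h, u⟩)` (`measure_iInf_eq_zero_mul_le`).
With `ψ(t) = exp (-s t)`, the factor `𝔼 ψ(ξ) = exp (s² / 2)` exactly cancels the one from the sharp
concentration of the supremum (`lintegral_exp_iSup_le`), and
`𝔼 exp (-s ‖g‖) ≤ exp (-s √(m - 1/2) + s² / 4)` (`normMoment_zero_neg_le`) has only half of the
sub-Gaussian variance to spend, which leaves room to replace `√(m - 1/2)` by `√m`. That room closes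
when `√m - ω` is of order `1 / √m`; there `ψ(t) = (√m - t)₊²` and `δ(D) ≤ m - 1` give
`P (fail) ≤ m / (m + 3/4)`, which is enough (`measure_exists_matVec_eq_zero_le`).

Gordon's comparison and the concentration inequality both follow from one interpolation
between two independent families of Gaussian coordinates (`HasPartials.integral_comparison`), applied
to a smooth indicator in the first case and to `exp (s (f(x + y₁) + f(x + y₂)) / 2)` in the second.
-/

namespace CSSideInfo

/-! ### Gaussian integration by parts -/

/-- The law of a family of independent standard normal variables indexed by `ι`. -/
noncomputable abbrev gaussPi (ι : Type*) [Fintype ι] : Measure (ι → ℝ) :=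
  Measure.pi fun _ => gaussianReal 0 1

lemma integrable_exp_abs_gaussianReal (c : ℝ) :
    Integrable (fun x : ℝ => Real.exp (c * |x|)) (gaussianReal 0 1) := by
  refine ((integrable_exp_mul_gaussianReal (μ := 0) (v := 1) c).add
    (integrable_exp_mul_gaussianReal (μ := 0) (v := 1) (-c))).mono' (by fun_prop) ?_
  refine Filter.Eventually.of_forall fun x => ?_
  rw [Real.norm_eq_abs, abs_of_pos (Real.exp_pos _)]
  rcases abs_cases x with ⟨h, _⟩ | ⟨h, _⟩ <;> rw [h] <;> simp only [Pi.add_apply]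
  · linarith [Real.exp_pos (-c * x)]
  · have : c * -x = -c * x := by ring
    rw [this]; linarith [Real.exp_pos (c * x)]

lemma integrable_exp_sum_abs {ι : Type*} [Fintype ι] (c : ℝ) :
    Integrable (fun x : ι → ℝ => Real.exp (c * ∑ i, |x i|)) (gaussPi ι) := by
  simp_rw [Finset.mul_sum, Real.exp_sum]
  exact Integrable.fintype_prod (f := fun _ x => Real.exp (c * |x|))
    fun _ => integrable_exp_abs_gaussianReal c

lemma le_exp_self (x : ℝ) : x ≤ Real.exp x := by linarith [Real.add_one_le_exp x]

lemma hasDerivAt_gaussianPDFReal (x : ℝ) :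
    HasDerivAt (gaussianPDFReal 0 1) (-x * gaussianPDFReal 0 1 x) x := by
  have h : HasDerivAt (fun x : ℝ => -(x - 0) ^ 2 / (2 * ((1 : ℝ≥0) : ℝ))) (-x) x :=
    ((((hasDerivAt_id x).sub_const 0).pow 2).neg.div_const (2 * ((1 : ℝ≥0) : ℝ))).congr_deriv
      (by norm_num; ring)
  exact ((h.exp).const_mul (Real.sqrt (2 * Real.pi * ((1 : ℝ≥0) : ℝ)))⁻¹).congr_deriv
    (by rw [gaussianPDFReal_def]; ring)

lemma integrable_gaussianReal_iff {f : ℝ → ℝ} :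
    Integrable f (gaussianReal 0 1) ↔ Integrable (fun x => gaussianPDFReal 0 1 x * f x) := by
  rw [gaussianReal_of_var_ne_zero 0 one_ne_zero,
    integrable_withDensity_iff_integrable_smul' (measurable_gaussianPDF 0 1)
      (Filter.Eventually.of_forall fun _ => gaussianPDF_lt_top)]
  simp [toReal_gaussianPDF]

/-- Stein's identity on the line. -/
lemma integral_mul_gaussianReal {f f' : ℝ → ℝ} (hf : ∀ x, HasDerivAt f (f' x) x)
    (h0 : Integrable f (gaussianReal 0 1)) (h1 : Integrable (fun x => x * f x) (gaussianReal 0 1))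
    (h2 : Integrable f' (gaussianReal 0 1)) :
    ∫ x, x * f x ∂(gaussianReal 0 1) = ∫ x, f' x ∂(gaussianReal 0 1) := by
  rw [integrable_gaussianReal_iff] at h0 h1 h2
  have := integral_mul_deriv_eq_deriv_mul_of_integrable (u := f) (u' := f')
    (v := gaussianPDFReal 0 1) (v' := fun x => -x * gaussianPDFReal 0 1 x)
    (fun x _ => hf x) (fun x _ => hasDerivAt_gaussianPDFReal x)
    (by convert h1.neg using 1; ext x; simp; ring)
    (by convert h2 using 1; ext x; simp; ring)
    (by convert h0 using 1; ext x; simp; ring)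
  rw [integral_gaussianReal_eq_integral_smul one_ne_zero,
    integral_gaussianReal_eq_integral_smul one_ne_zero]
  simp only [smul_eq_mul]
  rw [show (fun x => gaussianPDFReal 0 1 x * (x * f x))
    = fun x => -(f x * (-x * gaussianPDFReal 0 1 x)) by ext x; ring, integral_neg, this, neg_neg]
  congr 1; ext x; ring

section Pi

variable {ι : Type*} [Fintype ι] [DecidableEq ι]

/-- Replacing one coordinate by an independent copy does not change the law. -/
lemma measurePreserving_update (i : ι) :
    MeasurePreserving (fun p : (ι → ℝ) × ℝ => Function.update p.1 i p.2)
      ((gaussPi ι).prod (gaussianReal 0 1)) (gaussPi ι) := by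
  have hm : Measurable (fun p : (ι → ℝ) × ℝ => Function.update p.1 i p.2) := by
    refine measurable_pi_lambda _ fun j => ?_
    by_cases h : j = i
    · subst h; simpa using measurable_snd
    · simp only [Function.update_of_ne h]; fun_prop
  refine ⟨hm, ?_⟩
  symm
  refine Measure.pi_eq fun s hs => ?_
  rw [Measure.map_apply hm (MeasurableSet.univ_pi hs)]
  have : (fun p : (ι → ℝ) × ℝ => Function.update p.1 i p.2) ⁻¹' (Set.univ.pi s)
      = (Set.univ.pi (Function.update s i Set.univ)) ×ˢ s i := by
    ext ⟨x, t⟩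
    simp only [Set.mem_preimage, Set.mem_pi, Set.mem_univ, true_imp_iff, Set.mem_prod]
    constructor
    · intro h
      refine ⟨fun j => ?_, by simpa using h i⟩
      by_cases hj : j = i
      · subst hj; simp
      · have := h j
        rwa [Function.update_of_ne hj] at this ⊢
    · rintro ⟨h, h'⟩ j
      by_cases hj : j = i
      · subst hj; simpa using h'
      · have := h j
        rwa [Function.update_of_ne hj] at this ⊢
  rw [this, Measure.prod_prod, Measure.pi_pi]
  rw [← Finset.mul_prod_erase Finset.univ _ (Finset.mem_univ i),
    ← Finset.mul_prod_erase Finset.univ (fun j => gaussianReal 0 1 (s j)) (Finset.mem_univ i)]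
  simp only [Function.update_self, measure_univ, one_mul]
  rw [mul_comm]
  congr 1
  refine Finset.prod_congr rfl fun j hj => ?_
  rw [Function.update_of_ne (Finset.ne_of_mem_erase hj)]

/-- Stein's identity for independent standard normal variables. -/
lemma integral_mul_gaussPi (i : ι) {f f' : (ι → ℝ) → ℝ}
    (hf : ∀ x, HasDerivAt (fun r => f (Function.update x i r)) (f' x) (x i))
    (h0 : Integrable f (gaussPi ι)) (h1 : Integrable (fun x => x i * f x) (gaussPi ι))
    (h2 : Integrable f' (gaussPi ι)) :
    ∫ x, x i * f x ∂(gaussPi ι) = ∫ x, f' x ∂(gaussPi ι) := by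
  have mp := measurePreserving_update i
  have key : ∀ {g : (ι → ℝ) → ℝ}, Integrable g (gaussPi ι) →
      Integrable (fun p : (ι → ℝ) × ℝ => g (Function.update p.1 i p.2))
        ((gaussPi ι).prod (gaussianReal 0 1)) ∧
      ∫ x, g x ∂(gaussPi ι)
        = ∫ x, ∫ t, g (Function.update x i t) ∂(gaussianReal 0 1) ∂(gaussPi ι) := by
    intro g hg
    have hi : Integrable (fun p : (ι → ℝ) × ℝ => g (Function.update p.1 i p.2))
        ((gaussPi ι).prod (gaussianReal 0 1)) :=
      (mp.integrable_comp hg.aestronglyMeasurable).2 hg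
    refine ⟨hi, ?_⟩
    have := integral_map (f := g) mp.measurable.aemeasurable
      (by rw [mp.map_eq]; exact hg.aestronglyMeasurable)
    rw [mp.map_eq] at this
    rw [← integral_prod _ hi, this]
  obtain ⟨i0, -⟩ := key h0
  obtain ⟨i1, e1⟩ := key h1
  obtain ⟨i2, e2⟩ := key h2
  rw [e1, e2]
  refine integral_congr_ae ?_
  filter_upwards [i0.prod_right_ae, i1.prod_right_ae, i2.prod_right_ae] with x k0 k1 k2
  simp only [Function.update_self] at k1 ⊢
  refine integral_mul_gaussianReal (fun t => ?_) k0 k1 k2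
  simpa using hf (Function.update x i t)

end Pi

/-! ### Gaussian interpolation -/

section Interpolation

variable {ι : Type*} [Fintype ι]

/-- `G` is differentiable with first and second partial derivatives `D i`, `D2 i` along the
coordinate directions, and everything grows at most like `K * exp (c * ∑ |x i|)`. -/
structure HasPartials [DecidableEq ι] (G : (ι → ℝ) → ℝ) (D D2 : ι → (ι → ℝ) → ℝ) : Prop where
  diff : Differentiable ℝ G
  deriv : ∀ i x, HasDerivAt (fun r => G (Function.update x i r)) (D i x) (x i)
  deriv2 : ∀ i x, HasDerivAt (fun r => D i (Function.update x i r)) (D2 i x) (x i)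
  cont : ∀ i, Continuous (D i)
  cont2 : ∀ i, Continuous (D2 i)
  growth : ∃ K c : ℝ, 0 ≤ K ∧ 0 ≤ c ∧ ∀ x, |G x| ≤ K * Real.exp (c * ∑ i, |x i|) ∧
    ∀ i, |D i x| ≤ K * Real.exp (c * ∑ i, |x i|) ∧ |D2 i x| ≤ K * Real.exp (c * ∑ i, |x i|)

lemma integrable_of_growth {f : (ι → ℝ) → ℝ} (hf : Continuous f) {K c : ℝ}
    (h : ∀ x, |f x| ≤ K * Real.exp (c * ∑ i, |x i|)) : Integrable f (gaussPi ι) :=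
  ((integrable_exp_sum_abs c).const_mul K).mono' hf.aestronglyMeasurable
    (Filter.Eventually.of_forall h)

lemma sum_abs_mul_le {b x : ι → ℝ} (hb : ∀ i, |b i| ≤ 1) :
    ∑ i, |b i * x i| ≤ ∑ i, |x i| :=
  Finset.sum_le_sum fun i _ => by
    rw [abs_mul]; exact mul_le_of_le_one_left (abs_nonneg _) (hb i)

lemma growth_scale {f : (ι → ℝ) → ℝ} {K c : ℝ} (hK : 0 ≤ K) (hc : 0 ≤ c)
    (h : ∀ x, |f x| ≤ K * Real.exp (c * ∑ i, |x i|)) {b : ι → ℝ} (hb : ∀ i, |b i| ≤ 1)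
    (x : ι → ℝ) : |f (fun i => b i * x i)| ≤ K * Real.exp (c * ∑ i, |x i|) := by
  refine (h _).trans ?_
  gcongr K * Real.exp (c * ?_)
  exact sum_abs_mul_le hb

lemma growth_mul_coord {K c y : ℝ} (hK : 0 ≤ K) (x : ι → ℝ)
    (h : |y| ≤ K * Real.exp (c * ∑ i, |x i|)) {t : ℝ} (ht : |t| ≤ ∑ i, |x i|) :
    |t * y| ≤ K * Real.exp ((c + 1) * ∑ i, |x i|) := by
  rw [abs_mul, add_mul, one_mul, Real.exp_add, mul_comm, ← mul_assoc]
  have := ht.trans (le_exp_self _)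
  gcongr

lemma HasPartials.fderiv_eq [DecidableEq ι] {G : (ι → ℝ) → ℝ} {D D2 : ι → (ι → ℝ) → ℝ}
    (h : HasPartials G D D2) (x v : ι → ℝ) : fderiv ℝ G x v = ∑ i, v i * D i x := by
  have h1 : ∀ i, fderiv ℝ G x (Pi.single i 1) = D i x := by
    intro i
    have hx : HasFDerivAt G (fderiv ℝ G x) (Function.update x i (x i)) := by
      rw [Function.update_eq_self]; exact (h.diff x).hasFDerivAt
    have := hx.comp_hasDerivAt (x i) (hasDerivAt_update x i (x i))
    exact this.unique (h.deriv i x)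
  conv_lhs => rw [← Finset.univ_sum_single v]
  rw [map_sum]
  refine Finset.sum_congr rfl fun i _ => ?_
  rw [← h1 i, ← smul_eq_mul, ← map_smul, ← Pi.single_smul', smul_eq_mul, mul_one]

/-- The expectation of `G` at independent Gaussians with standard deviations `a i θ`: only the
second derivatives of `G` enter its derivative in `θ`. -/
theorem HasPartials.hasDerivAt_integral [DecidableEq ι] {G : (ι → ℝ) → ℝ} {D D2 : ι → (ι → ℝ) → ℝ}
    (h : HasPartials G D D2) {a a' : ι → ℝ → ℝ} (ha : ∀ i θ, HasDerivAt (a i) (a' i θ) θ)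
    (ha1 : ∀ i θ, |a i θ| ≤ 1) (ha1' : ∀ i θ, |a' i θ| ≤ 1) (θ : ℝ) :
    HasDerivAt (fun θ => ∫ x, G (fun i => a i θ * x i) ∂(gaussPi ι))
      (∫ x, ∑ i, a i θ * a' i θ * D2 i (fun j => a j θ * x j) ∂(gaussPi ι)) θ := by
  obtain ⟨K, c, hK, hc, hgr⟩ := h.growth
  have cs : ∀ θ, Continuous fun x : ι → ℝ => (fun i => a i θ * x i) := fun θ => by fun_prop
  have hder : ∀ (x : ι → ℝ) θ, HasDerivAt (fun θ => G (fun i => a i θ * x i))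
      (∑ i, (a' i θ * x i) * D i (fun i => a i θ * x i)) θ := by
    intro x θ
    have h1 : HasDerivAt (fun θ => (fun i => a i θ * x i)) (fun i => a' i θ * x i) θ :=
      hasDerivAt_pi.2 fun i => (ha i θ).mul_const (x i)
    exact ((h.diff _).hasFDerivAt.comp_hasDerivAt θ h1).congr_deriv (h.fderiv_eq _ _)
  have main := (hasDerivAt_integral_of_dominated_loc_of_deriv_le (μ := gaussPi ι) (x₀ := θ)
    (s := Set.univ) (F := fun θ x => G (fun i => a i θ * x i))
    (F' := fun θ x => ∑ i, (a' i θ * x i) * D i (fun i => a i θ * x i))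
    (bound := fun x => ∑ _i : ι, K * Real.exp ((c + 1) * ∑ i, |x i|))
    Filter.univ_mem
    (Filter.Eventually.of_forall fun θ => (h.diff.continuous.comp (cs θ)).aestronglyMeasurable)
    (integrable_of_growth (h.diff.continuous.comp (cs θ))
      (growth_scale hK hc (fun x => (hgr x).1) fun i => ha1 i θ))
    (continuous_finsetSum _ fun i _ => (continuous_const.mul (continuous_apply i)).mul
      ((h.cont i).comp (cs θ))).aestronglyMeasurable
    (Filter.Eventually.of_forall fun x θ _ => ?_)
    (integrable_finsetSum _ fun i _ => (integrable_exp_sum_abs (c + 1)).const_mul K)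
    (Filter.Eventually.of_forall fun x θ _ => hder x θ)).2
  · refine main.congr_deriv ?_
    rw [integral_finsetSum, integral_finsetSum]
    · refine Finset.sum_congr rfl fun i _ => ?_
      have e := integral_mul_gaussPi i (f := fun x => D i (fun j => a j θ * x j))
        (f' := fun x => a i θ * D2 i (fun j => a j θ * x j)) ?_ ?_ ?_ ?_
      · simp_rw [mul_assoc]
        rw [integral_const_mul, e]; simp only [integral_const_mul]; ring
      · intro x
        have h2 := h.deriv2 i (fun j => a j θ * x j)
        have h3 : HasDerivAt (fun r : ℝ => a i θ * r) (a i θ) (x i) := by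
          simpa using (hasDerivAt_id (x i)).const_mul (a i θ)
        have h4 := HasDerivAt.comp (x i) h2 h3
        rw [mul_comm]
        refine h4.congr_of_eventuallyEq (Filter.Eventually.of_forall fun r => ?_)
        simp only [Function.comp]
        congr 1
        ext j
        by_cases hj : j = i
        · subst hj; simp
        · simp [Function.update_of_ne hj]
      · exact integrable_of_growth ((h.cont i).comp (cs θ))
          (growth_scale hK hc (fun x => ((hgr x).2 i).1) fun i => ha1 i θ)
      · refine integrable_of_growth ((continuous_apply i).mul ((h.cont i).comp (cs θ)))
          (fun x => growth_mul_coord hK x (growth_scale hK hc (fun x => ((hgr x).2 i).1)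
            (fun i => ha1 i θ) x) ?_)
        exact Finset.single_le_sum (f := fun i => |x i|) (fun i _ => abs_nonneg _)
          (Finset.mem_univ i)
      · exact (integrable_of_growth ((h.cont2 i).comp (cs θ))
          (growth_scale hK hc (fun x => ((hgr x).2 i).2) fun i => ha1 i θ)).const_mul _
    · intro i _
      exact (integrable_of_growth ((h.cont2 i).comp (cs θ))
          (growth_scale hK hc (fun x => ((hgr x).2 i).2) fun i => ha1 i θ)).const_mul _
    · intro i _
      refine integrable_of_growth ((continuous_const.mul (continuous_apply i)).mul
        ((h.cont i).comp (cs θ))) (fun x => growth_mul_coord hK x (growth_scale hK hc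
          (fun x => ((hgr x).2 i).1) (fun i => ha1 i θ) x) ?_)
      rw [abs_mul]
      exact (mul_le_of_le_one_left (abs_nonneg _) (ha1' i θ)).trans
        (Finset.single_le_sum (f := fun i => |x i|) (fun i _ => abs_nonneg _) (Finset.mem_univ i))
  · refine (norm_sum_le _ _).trans (Finset.sum_le_sum fun i _ => ?_)
    refine growth_mul_coord hK x (growth_scale hK hc
          (fun x => ((hgr x).2 i).1) (fun i => ha1 i θ) x) ?_
    rw [abs_mul]
    exact (mul_le_of_le_one_left (abs_nonneg _) (ha1' i θ)).trans
        (Finset.single_le_sum (f := fun i => |x i|) (fun i _ => abs_nonneg _) (Finset.mem_univ i))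

/-- Rotating the coordinates outside `S` into those in `S`: if the Laplacian over `S` exceeds the
Laplacian over the complement by at most `κ G`, then passing from the Gaussian vector supported
outside `S` to the one supported in `S` costs at most a factor `exp (κ / 2)`. -/
theorem HasPartials.integral_comparison [DecidableEq ι] {G : (ι → ℝ) → ℝ} {D D2 : ι → (ι → ℝ) → ℝ}
    (h : HasPartials G D D2) (S : ι → Prop) [DecidablePred S] (κ : ℝ)
    (hκ : ∀ x, ∑ i, (if S i then D2 i x else -D2 i x) ≤ κ * G x) :
    ∫ x, G (fun i => if S i then x i else 0) ∂(gaussPi ι)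
      ≤ Real.exp (κ / 2) * ∫ x, G (fun i => if S i then 0 else x i) ∂(gaussPi ι) := by
  set a : ι → ℝ → ℝ := fun i θ => if S i then Real.sin θ else Real.cos θ with ha
  set a' : ι → ℝ → ℝ := fun i θ => if S i then Real.cos θ else -Real.sin θ with ha'
  have hd := h.hasDerivAt_integral (a := a) (a' := a')
    (fun i θ => by
      by_cases hi : S i
      · simpa [ha, ha', hi] using Real.hasDerivAt_sin θ
      · simpa [ha, ha', hi] using Real.hasDerivAt_cos θ)
    (fun i θ => by
      by_cases hi : S i
      · simpa [ha, hi] using Real.abs_sin_le_one θ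
      · simpa [ha, hi] using Real.abs_cos_le_one θ)
    (fun i θ => by
      by_cases hi : S i
      · simpa [ha', hi] using Real.abs_cos_le_one θ
      · simpa [ha', hi] using Real.abs_sin_le_one θ)
  set Φ : ℝ → ℝ := fun θ => ∫ x, G (fun i => a i θ * x i) ∂(gaussPi ι) with hΦ
  set Φ' : ℝ → ℝ := fun θ => ∫ x, ∑ i, a i θ * a' i θ * D2 i (fun j => a j θ * x j) ∂(gaussPi ι)
    with hΦ'
  obtain ⟨K, c, hK, hc, hgr⟩ := h.growth
  have ha1 : ∀ θ i, |a i θ| ≤ 1 := fun θ i => by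
    by_cases hi : S i
    · simpa [ha, hi] using Real.abs_sin_le_one θ
    · simpa [ha, hi] using Real.abs_cos_le_one θ
  have cs : ∀ θ, Continuous fun x : ι → ℝ => (fun i => a i θ * x i) := fun θ => by fun_prop
  have hle : ∀ θ ∈ Set.Icc (0 : ℝ) (Real.pi / 2),
      Φ' θ ≤ Real.sin θ * Real.cos θ * (κ * Φ θ) := by
    intro θ hθ
    have hs : 0 ≤ Real.sin θ := Real.sin_nonneg_of_nonneg_of_le_pi hθ.1
      (by linarith [hθ.2, Real.pi_pos])
    have hco : 0 ≤ Real.cos θ := Real.cos_nonneg_of_neg_pi_div_two_le_of_le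
      (by linarith [hθ.1, Real.pi_pos]) hθ.2
    rw [hΦ', hΦ, ← integral_const_mul, ← integral_const_mul]
    refine integral_mono (integrable_finsetSum _ fun i _ => ?_) ?_ fun x => ?_
    · exact (integrable_of_growth ((h.cont2 i).comp (cs θ))
          (growth_scale hK hc (fun x => ((hgr x).2 i).2) (ha1 θ))).const_mul _
    · exact ((integrable_of_growth (h.diff.continuous.comp (cs θ))
          (growth_scale hK hc (fun x => (hgr x).1) (ha1 θ))).const_mul _).const_mul _
    · have := mul_le_mul_of_nonneg_left (hκ (fun j => a j θ * x j)) (mul_nonneg hs hco)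
      refine le_trans (le_of_eq ?_) this
      rw [Finset.mul_sum]
      refine Finset.sum_congr rfl fun i _ => ?_
      by_cases hi : S i <;> simp only [ha, ha', hi, ↓reduceIte] <;> ring
  have hE : ∀ θ, HasDerivAt (fun θ => Real.exp (-(κ / 2) * Real.sin θ ^ 2))
      (Real.exp (-(κ / 2) * Real.sin θ ^ 2) * (-(κ * (Real.sin θ * Real.cos θ)))) θ := fun θ =>
    ((((Real.hasDerivAt_sin θ).pow 2).const_mul (-(κ / 2))).exp).congr_deriv (by
      simp; ring)
  have anti : AntitoneOn (fun θ => Real.exp (-(κ / 2) * Real.sin θ ^ 2) * Φ θ)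
      (Set.Icc 0 (Real.pi / 2)) := by
    refine antitoneOn_of_hasDerivWithinAt_nonpos (convex_Icc _ _)
      (fun θ _ => ((hE θ).mul (hd θ)).continuousAt.continuousWithinAt)
      (fun θ _ => ((hE θ).mul (hd θ)).hasDerivWithinAt) fun θ hθ => ?_
    have h1 := hle θ (interior_subset hθ)
    have h2 := Real.exp_pos (-(κ / 2) * Real.sin θ ^ 2)
    have : Real.exp (-(κ / 2) * Real.sin θ ^ 2) * (Φ' θ - Real.sin θ * Real.cos θ * (κ * Φ θ)) ≤ 0 :=
      mul_nonpos_of_nonneg_of_nonpos h2.le (by linarith)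
    refine le_trans (le_of_eq ?_) this
    simp only [hΦ, hΦ']
    ring
  have := anti (Set.left_mem_Icc.2 (by positivity)) (Set.right_mem_Icc.2 (by positivity))
    (by positivity : (0 : ℝ) ≤ Real.pi / 2)
  simp only [Real.sin_pi_div_two, Real.sin_zero, hΦ, ha, Real.cos_zero, Real.cos_pi_div_two] at this
  have e1 : ∀ x : ι → ℝ, (fun i => (if S i then (1 : ℝ) else 0) * x i)
      = fun i => if S i then x i else 0 := fun x => by ext i; split_ifs <;> simp
  have e2 : ∀ x : ι → ℝ, (fun i => (if S i then (0 : ℝ) else 1) * x i)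
      = fun i => if S i then 0 else x i := fun x => by ext i; split_ifs <;> simp
  simp only [e1, e2, ne_eq, OfNat.ofNat_ne_zero, not_false_eq_true, zero_pow, one_pow, mul_zero,
    mul_one, Real.exp_zero, one_mul] at this
  calc _ = Real.exp (κ / 2) * (Real.exp (-(κ / 2)) *
        ∫ x, G (fun i => if S i then x i else 0) ∂(gaussPi ι)) := by
        rw [← mul_assoc, ← Real.exp_add]; simp
    _ ≤ _ := by gcongr

end Interpolation

/-! ### A smooth indicator of a minimum of norms -/

section SoftIndicator

variable {ι U E : Type*} [Fintype ι] [Fintype U]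
  [NormedAddCommGroup E] [InnerProductSpace ℝ E]

/-- The vector `∑ i, x i • p i`, linear in the Gaussian coordinates `x`. -/
noncomputable def linComb (p : ι → E) (x : ι → ℝ) : E := ∑ i, x i • p i

/-- The regularized norm `√(η² + ‖∑ i, x i • p i‖²)`. -/
noncomputable def regNorm (η : ℝ) (p : ι → E) (x : ι → ℝ) : ℝ :=
  Real.sqrt (η ^ 2 + ‖linComb p x‖ ^ 2)

/-- `exp (-β (N(x) + ⟨c, x⟩ - r))`, where `N` is the regularized norm of `∑ i, x i • p i`. -/
noncomputable def expWeight (β η r : ℝ) (p : ι → E) (c : ι → ℝ) (x : ι → ℝ) : ℝ :=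
  Real.exp (-β * (regNorm η p x + ∑ i, x i * c i - r))

/-- The partial derivative of `N(x) + ⟨c, x⟩` in the `i`-th coordinate. -/
noncomputable def slope (η : ℝ) (p : ι → E) (c : ι → ℝ) (i : ι) (x : ι → ℝ) : ℝ :=
  inner ℝ (linComb p x) (p i) / regNorm η p x + c i

/-- The second partial derivative of `N` in the `i`-th coordinate. -/
noncomputable def slope2 (η : ℝ) (p : ι → E) (i : ι) (x : ι → ℝ) : ℝ :=
  ‖p i‖ ^ 2 / regNorm η p x - inner ℝ (linComb p x) (p i) ^ 2 / regNorm η p x ^ 3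

/-- A smooth version of the indicator of `min_u (‖∑ i, x i • p u i‖ + ⟨c u, x⟩) > r`. -/
noncomputable def softIndicator (β η r : ℝ) (p : U → ι → E) (c : U → ι → ℝ) (x : ι → ℝ) : ℝ :=
  Real.exp (-∑ u, expWeight β η r (p u) (c u) x)

variable {β η r : ℝ}

lemma regNorm_pos (hη : 0 < η) (p : ι → E) (x : ι → ℝ) : 0 < regNorm η p x :=
  Real.sqrt_pos.2 (by positivity)

lemma le_regNorm (p : ι → E) (x : ι → ℝ) : η ≤ regNorm η p x :=
  Real.le_sqrt_of_sq_le (by nlinarith [sq_nonneg ‖linComb p x‖])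

lemma norm_le_regNorm (p : ι → E) (x : ι → ℝ) : ‖linComb p x‖ ≤ regNorm η p x :=
  Real.le_sqrt_of_sq_le (by nlinarith [sq_nonneg η])

lemma continuous_linComb (p : ι → E) : Continuous (linComb p) := by
  unfold linComb; fun_prop

lemma continuous_regNorm (p : ι → E) : Continuous (regNorm η p) := by
  have := continuous_linComb p
  unfold regNorm; fun_prop

lemma continuous_expWeight (p : ι → E) (c : ι → ℝ) : Continuous (expWeight β η r p c) := by
  have := continuous_regNorm (η := η) p
  unfold expWeight; fun_prop

lemma continuous_slope (hη : 0 < η) (p : ι → E) (c : ι → ℝ) (i : ι) :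
    Continuous (slope η p c i) := by
  have := continuous_regNorm (η := η) p
  have := continuous_linComb p
  unfold slope
  refine Continuous.add (Continuous.div (by fun_prop) (by fun_prop) fun x => ?_) (by fun_prop)
  exact (regNorm_pos hη p x).ne'

lemma continuous_slope2 (hη : 0 < η) (p : ι → E) (i : ι) : Continuous (slope2 η p i) := by
  have := continuous_regNorm (η := η) p
  have := continuous_linComb p
  unfold slope2
  refine Continuous.sub (Continuous.div (by fun_prop) (by fun_prop) fun x => ?_)
    (Continuous.div (by fun_prop) (by fun_prop) fun x => ?_)
  · exact (regNorm_pos hη p x).ne'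
  · exact pow_ne_zero _ (regNorm_pos hη p x).ne'

lemma differentiable_softIndicator (hη : 0 < η) (p : U → ι → E) (c : U → ι → ℝ) :
    Differentiable ℝ (softIndicator β η r p c) := by
  have hl : ∀ p : ι → E, Differentiable ℝ (linComb p) := fun p => by unfold linComb; fun_prop
  have hn : ∀ p : ι → E, Differentiable ℝ (regNorm η p) := fun p => by
    unfold regNorm
    refine Differentiable.sqrt ((differentiable_const _).add ((hl p).norm_sq ℝ)) fun x => ?_
    positivity
  unfold softIndicator expWeight
  fun_prop

lemma abs_slope_le (hη : 0 < η) (p : ι → E) (c : ι → ℝ) (i : ι) (x : ι → ℝ) :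
    |slope η p c i x| ≤ ‖p i‖ + |c i| := by
  refine (abs_add_le _ _).trans ?_
  gcongr
  rw [abs_div, abs_of_pos (regNorm_pos hη p x), div_le_iff₀ (regNorm_pos hη p x), mul_comm]
  exact (abs_real_inner_le_norm _ _).trans
    (mul_le_mul_of_nonneg_right (norm_le_regNorm p x) (norm_nonneg _))

lemma abs_slope2_le (hη : 0 < η) (p : ι → E) (i : ι) (x : ι → ℝ) :
    |slope2 η p i x| ≤ ‖p i‖ ^ 2 / η := by
  have hN := regNorm_pos hη p x
  have h1 : inner ℝ (linComb p x) (p i) ^ 2 / regNorm η p x ^ 3 ≤ ‖p i‖ ^ 2 / regNorm η p x := by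
    rw [div_le_div_iff₀ (by positivity) hN]
    have : inner ℝ (linComb p x) (p i) ^ 2 ≤ (regNorm η p x * ‖p i‖) ^ 2 := by
      rw [sq_le_sq, abs_of_nonneg (by positivity : 0 ≤ regNorm η p x * ‖p i‖)]
      exact (abs_real_inner_le_norm _ _).trans
        (mul_le_mul_of_nonneg_right (norm_le_regNorm p x) (norm_nonneg _))
    nlinarith [mul_le_mul_of_nonneg_right this hN.le]
  have h2 : ‖p i‖ ^ 2 / regNorm η p x ≤ ‖p i‖ ^ 2 / η := by
    gcongr; exact le_regNorm p x
  have h3 : 0 ≤ inner ℝ (linComb p x) (p i) ^ 2 / regNorm η p x ^ 3 := by positivity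
  unfold slope2
  rw [abs_of_nonneg (by linarith)]
  linarith

/-- The first partial derivatives of `softIndicator`. -/
noncomputable def softD (β η r : ℝ) (p : U → ι → E) (c : U → ι → ℝ) (i : ι) (x : ι → ℝ) : ℝ :=
  softIndicator β η r p c x *
    ∑ u, β * (expWeight β η r (p u) (c u) x * slope η (p u) (c u) i x)

/-- The second partial derivatives of `softIndicator`. -/
noncomputable def softD2 (β η r : ℝ) (p : U → ι → E) (c : U → ι → ℝ) (i : ι) (x : ι → ℝ) : ℝ :=
  softIndicator β η r p c x *
    ((∑ u, β * (expWeight β η r (p u) (c u) x * slope η (p u) (c u) i x)) ^ 2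
      + ∑ u, β * (expWeight β η r (p u) (c u) x *
        (slope2 η (p u) i x - β * slope η (p u) (c u) i x ^ 2)))

/-- The sign condition on the covariances that makes `softIndicator` increase in expectation. -/
lemma sum_softD2_nonpos (hβ : 0 ≤ β) (p : U → ι → E) (c : U → ι → ℝ) (sgn : ι → ℝ)
    (x : ι → ℝ)
    (h1 : ∀ u u', ∑ i, sgn i * (slope η (p u) (c u) i x * slope η (p u') (c u') i x) ≤ 0)
    (h2 : ∀ u, ∑ i, sgn i * slope η (p u) (c u) i x ^ 2 = 0)
    (h3 : ∀ u, ∑ i, sgn i * slope2 η (p u) i x = 0) :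
    ∑ i, sgn i * softD2 β η r p c i x ≤ 0 := by
  have hw : ∀ u, 0 < expWeight β η r (p u) (c u) x := fun u => Real.exp_pos _
  have e : ∑ i, sgn i * softD2 β η r p c i x = softIndicator β η r p c x *
      (∑ u, ∑ u', β * expWeight β η r (p u) (c u) x * (β * expWeight β η r (p u') (c u') x) *
        ∑ i, sgn i * (slope η (p u) (c u) i x * slope η (p u') (c u') i x)
      + ∑ u, β * expWeight β η r (p u) (c u) x * (∑ i, sgn i * slope2 η (p u) i x
        - β * ∑ i, sgn i * slope η (p u) (c u) i x ^ 2)) := by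
    have a1 : ∑ u, ∑ u', β * expWeight β η r (p u) (c u) x * (β * expWeight β η r (p u') (c u') x) *
        ∑ i, sgn i * (slope η (p u) (c u) i x * slope η (p u') (c u') i x)
        = ∑ i, sgn i * (∑ u, β * (expWeight β η r (p u) (c u) x * slope η (p u) (c u) i x)) ^ 2 := by
      simp_rw [sq, Finset.sum_mul_sum, Finset.mul_sum]
      rw [Finset.sum_comm]
      conv_lhs => enter [2, u']; rw [Finset.sum_comm]
      rw [Finset.sum_comm]
      refine Finset.sum_congr rfl fun i _ => ?_
      rw [Finset.sum_comm]
      exact Finset.sum_congr rfl fun u _ => Finset.sum_congr rfl fun u' _ => by ring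
    have a2 : ∑ u, β * expWeight β η r (p u) (c u) x * (∑ i, sgn i * slope2 η (p u) i x
        - β * ∑ i, sgn i * slope η (p u) (c u) i x ^ 2)
        = ∑ i, sgn i * ∑ u, β * (expWeight β η r (p u) (c u) x *
        (slope2 η (p u) i x - β * slope η (p u) (c u) i x ^ 2)) := by
      simp_rw [Finset.mul_sum, ← Finset.sum_sub_distrib, Finset.mul_sum]
      rw [Finset.sum_comm]
      exact Finset.sum_congr rfl fun u _ => Finset.sum_congr rfl fun u' _ => by ring
    rw [a1, a2, ← Finset.sum_add_distrib, Finset.mul_sum]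
    refine Finset.sum_congr rfl fun i _ => ?_
    unfold softD2; ring
  rw [e]
  refine mul_nonpos_of_nonneg_of_nonpos (Real.exp_pos _).le ?_
  simp only [h2, h3, mul_zero, sub_zero, Finset.sum_const_zero, add_zero]
  refine Finset.sum_nonpos fun u _ => Finset.sum_nonpos fun u' _ => ?_
  have := hw u
  have := hw u'
  exact mul_nonpos_of_nonneg_of_nonpos (by positivity) (h1 u u')

variable [DecidableEq ι]

lemma hasDerivAt_linComb (p : ι → E) (i : ι) (x : ι → ℝ) :
    HasDerivAt (fun t => linComb p (Function.update x i t)) (p i) (x i) := by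
  have : (fun t => linComb p (Function.update x i t))
      = fun t => t • p i + ∑ j ∈ Finset.univ.erase i, x j • p j := by
    ext t
    unfold linComb
    rw [← Finset.add_sum_erase _ _ (Finset.mem_univ i)]
    simp only [Function.update_self]
    congr 1
    refine Finset.sum_congr rfl fun j hj => ?_
    rw [Function.update_of_ne (Finset.ne_of_mem_erase hj)]
  rw [this]
  exact (((hasDerivAt_id (x i)).smul_const (p i)).add_const _).congr_deriv (one_smul _ _)

lemma hasDerivAt_regNorm (hη : 0 < η) (p : ι → E) (i : ι) (x : ι → ℝ) :
    HasDerivAt (fun t => regNorm η p (Function.update x i t))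
      (inner ℝ (linComb p x) (p i) / regNorm η p x) (x i) := by
  have h1 := (hasDerivAt_linComb p i x).norm_sq.const_add (η ^ 2)
  simp only [Function.update_eq_self] at h1
  have h2 := h1.sqrt (by simp only [Function.update_eq_self]; positivity)
  simp only [Function.update_eq_self] at h2
  refine h2.congr_deriv ?_
  unfold regNorm
  rw [mul_div_mul_left _ _ two_ne_zero]

lemma hasDerivAt_expWeight (hη : 0 < η) (p : ι → E) (c : ι → ℝ) (i : ι) (x : ι → ℝ) :
    HasDerivAt (fun t => expWeight β η r p c (Function.update x i t))
      (-β * (expWeight β η r p c x * slope η p c i x)) (x i) := by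
  have h1 := hasDerivAt_linComb c i x
  simp only [linComb, smul_eq_mul] at h1
  have h2 := ((((hasDerivAt_regNorm hη p i x).add h1).sub_const r).const_mul (-β)).exp
  simp only [Pi.add_apply, Function.update_eq_self] at h2
  refine h2.congr_deriv ?_
  unfold slope expWeight; ring

lemma hasDerivAt_slope (hη : 0 < η) (p : ι → E) (c : ι → ℝ) (i : ι) (x : ι → ℝ) :
    HasDerivAt (fun t => slope η p c i (Function.update x i t)) (slope2 η p i x) (x i) := by
  have hN := regNorm_pos hη p x
  have h1 := (hasDerivAt_linComb p i x).inner ℝ (hasDerivAt_const (x i) (p i))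
  have h2 := (h1.div (hasDerivAt_regNorm hη p i x)
    (by simpa only [Function.update_eq_self] using hN.ne')).add_const (c i)
  simp only [Function.update_eq_self, inner_zero_right, zero_add, real_inner_self_eq_norm_sq] at h2
  refine h2.congr_deriv ?_
  unfold slope2
  field_simp

lemma hasDerivAt_softIndicator (hη : 0 < η) (p : U → ι → E) (c : U → ι → ℝ) (i : ι) (x : ι → ℝ) :
    HasDerivAt (fun t => softIndicator β η r p c (Function.update x i t))
      (softD β η r p c i x) (x i) := by
  have h := (HasDerivAt.fun_sum (u := Finset.univ) fun u _ =>
    hasDerivAt_expWeight (β := β) (r := r) hη (p u) (c u) i x).neg.exp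
  simp only [Pi.neg_apply, Function.update_eq_self] at h
  refine h.congr_deriv ?_
  unfold softD softIndicator
  congr 1
  rw [← Finset.sum_neg_distrib]
  exact Finset.sum_congr rfl fun u _ => by ring

lemma hasDerivAt_softD (hη : 0 < η) (p : U → ι → E) (c : U → ι → ℝ) (i : ι) (x : ι → ℝ) :
    HasDerivAt (fun t => softD β η r p c i (Function.update x i t))
      (softD2 β η r p c i x) (x i) := by
  have h := (hasDerivAt_softIndicator (β := β) (r := r) hη p c i x).mul
    (HasDerivAt.fun_sum (u := Finset.univ) fun u _ =>
    ((hasDerivAt_expWeight (β := β) (r := r) hη (p u) (c u) i x).mul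
      (hasDerivAt_slope hη (p u) (c u) i x)).const_mul β)
  simp only [Pi.mul_apply, Function.update_eq_self] at h
  refine h.congr_deriv ?_
  unfold softD2 softD
  rw [mul_add, sq, mul_assoc]
  congr 2
  exact Finset.sum_congr rfl fun u _ => by ring

lemma mul_exp_neg_le (s : ℝ) : s * Real.exp (-s) ≤ 1 := by
  rw [Real.exp_neg, ← div_eq_mul_inv, div_le_one (Real.exp_pos _)]
  exact le_exp_self s

lemma sq_mul_exp_neg_le {s : ℝ} (hs : 0 ≤ s) : s ^ 2 * Real.exp (-s) ≤ 2 := by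
  rw [Real.exp_neg, ← div_eq_mul_inv, div_le_iff₀ (Real.exp_pos _)]
  linarith [Real.quadratic_le_exp_of_nonneg hs]

lemma hasPartials_softIndicator (hβ : 0 ≤ β) (hη : 0 < η) (p : U → ι → E) (c : U → ι → ℝ) :
    HasPartials (softIndicator β η r p c) (softD β η r p c) (softD2 β η r p c) where
  diff := differentiable_softIndicator hη p c
  deriv i x := hasDerivAt_softIndicator hη p c i x
  deriv2 i x := hasDerivAt_softD hη p c i x
  cont i := by
    have h1 := (differentiable_softIndicator (β := β) (r := r) hη p c).continuous
    unfold softD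
    exact h1.mul (continuous_finsetSum _ fun u _ => continuous_const.mul
      ((continuous_expWeight _ _).mul (continuous_slope hη _ _ _)))
  cont2 i := by
    have h1 := (differentiable_softIndicator (β := β) (r := r) hη p c).continuous
    unfold softD2
    exact h1.mul (((continuous_finsetSum _ fun u _ => continuous_const.mul
      ((continuous_expWeight _ _).mul (continuous_slope hη _ _ _))).pow 2).add
      (continuous_finsetSum _ fun u _ => continuous_const.mul
      ((continuous_expWeight _ _).mul ((continuous_slope2 hη _ _).sub
        (continuous_const.mul ((continuous_slope hη _ _ _).pow 2))))))
  growth := by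
    obtain ⟨B, hB⟩ := Finite.exists_le fun ui : U × ι => ‖p ui.1 ui.2‖ + |c ui.1 ui.2|
    obtain ⟨B', hB'⟩ := Finite.exists_le fun ui : U × ι => ‖p ui.1 ui.2‖ ^ 2 / η
    set b := max B 0
    set b' := max B' 0
    have hb0 : 0 ≤ b := le_max_right _ _
    have hb0' : 0 ≤ b' := le_max_right _ _
    have hs : ∀ u i x, |slope η (p u) (c u) i x| ≤ b := fun u i x =>
      (abs_slope_le hη _ _ _ _).trans ((hB (u, i)).trans (le_max_left _ _))
    have hs2 : ∀ u i x, |slope2 η (p u) i x| ≤ b' := fun u i x =>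
      (abs_slope2_le hη _ _ _).trans ((hB' (u, i)).trans (le_max_left _ _))
    have hw : ∀ u x, 0 < expWeight β η r (p u) (c u) x := fun u x => Real.exp_pos _
    set K := 1 + β * b + 2 * (β * b) ^ 2 + β * (b' + β * b ^ 2)
    refine ⟨K, 0, by positivity, le_rfl, fun x => ?_⟩
    simp only [zero_mul, Real.exp_zero, mul_one]
    set S := ∑ u, expWeight β η r (p u) (c u) x with hS
    have hS0 : 0 ≤ S := Finset.sum_nonneg fun u _ => (hw u x).le
    have hG : softIndicator β η r p c x = Real.exp (-S) := rfl
    have hG0 := Real.exp_pos (-S)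
    have e1 : ∀ i, |∑ u, β * (expWeight β η r (p u) (c u) x * slope η (p u) (c u) i x)|
        ≤ β * b * S := fun i => by
      rw [hS, Finset.mul_sum]
      refine (Finset.abs_sum_le_sum_abs _ _).trans (Finset.sum_le_sum fun u _ => ?_)
      rw [abs_mul, abs_mul, abs_of_nonneg hβ, abs_of_pos (hw u x)]
      have := mul_le_mul_of_nonneg_left (hs u i x) (mul_nonneg hβ (hw u x).le)
      linarith
    have e2 : ∀ i, |∑ u, β * (expWeight β η r (p u) (c u) x *
        (slope2 η (p u) i x - β * slope η (p u) (c u) i x ^ 2))|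
        ≤ β * (b' + β * b ^ 2) * S := fun i => by
      rw [hS, Finset.mul_sum]
      refine (Finset.abs_sum_le_sum_abs _ _).trans (Finset.sum_le_sum fun u _ => ?_)
      rw [abs_mul, abs_mul, abs_of_nonneg hβ, abs_of_pos (hw u x)]
      have h3 : |slope2 η (p u) i x - β * slope η (p u) (c u) i x ^ 2| ≤ b' + β * b ^ 2 := by
        refine (abs_sub _ _).trans (add_le_add (hs2 u i x) ?_)
        rw [abs_mul, abs_of_nonneg hβ, abs_pow]
        gcongr
        exact hs u i x
      have := mul_le_mul_of_nonneg_left h3 (mul_nonneg hβ (hw u x).le)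
      linarith
    have t1 := mul_exp_neg_le S
    have t2 := sq_mul_exp_neg_le hS0
    have k1 : 0 ≤ β * b := by positivity
    have k2 : 0 ≤ 2 * (β * b) ^ 2 := by positivity
    have k3 : 0 ≤ β * (b' + β * b ^ 2) := by positivity
    refine ⟨?_, fun i => ⟨?_, ?_⟩⟩
    · rw [hG, abs_of_pos hG0]
      have : Real.exp (-S) ≤ 1 := Real.exp_le_one_iff.2 (by linarith)
      linarith
    · unfold softD
      rw [hG, abs_mul, abs_of_pos hG0]
      have := mul_le_mul_of_nonneg_left (e1 i) hG0.le
      have := mul_le_mul_of_nonneg_left t1 k1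
      linarith
    · unfold softD2
      rw [hG, abs_mul, abs_of_pos hG0]
      refine (mul_le_mul_of_nonneg_left (abs_add_le _ _) hG0.le).trans ?_
      rw [abs_pow]
      have h1 := mul_le_mul_of_nonneg_left (pow_le_pow_left₀ (abs_nonneg _) (e1 i) 2) hG0.le
      have h2 := mul_le_mul_of_nonneg_left (e2 i) hG0.le
      have h3 := mul_le_mul_of_nonneg_left t1 k3
      have h4 := mul_le_mul_of_nonneg_left t2 (sq_nonneg (β * b))
      linarith

end SoftIndicator

/-! ### Gordon's comparison inequality -/

section Gordon

variable {m n : ℕ} {U : Type*} [Fintype U]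

/-- The Gaussian coordinates of Gordon's comparison: the entries of an `m × n` matrix, one extra
scalar, and two vectors in `ℝᵐ` and `ℝⁿ`. -/
abbrev GordonIndex (m n : ℕ) : Type := (Fin m × Fin n ⊕ Unit) ⊕ (Fin m ⊕ Fin n)

/-- The `ℝᵐ`-valued linear part `A u + g` in the coordinates `(A, ξ, g, h)`. -/
noncomputable def gordonVec (u : EuclideanSpace ℝ (Fin n)) :
    GordonIndex m n → EuclideanSpace ℝ (Fin m)
  | Sum.inl (Sum.inl k) => u k.2 • EuclideanSpace.single k.1 1
  | Sum.inl (Sum.inr _) => 0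
  | Sum.inr (Sum.inl k) => EuclideanSpace.single k 1
  | Sum.inr (Sum.inr _) => 0

/-- The scalar linear part `ξ - ⟨h, u⟩` in the coordinates `(A, ξ, g, h)`. -/
noncomputable def gordonScal (u : EuclideanSpace ℝ (Fin n)) : GordonIndex m n → ℝ
  | Sum.inl (Sum.inl _) => 0
  | Sum.inl (Sum.inr _) => 1
  | Sum.inr (Sum.inl _) => 0
  | Sum.inr (Sum.inr i) => -u i

/-- Gordon's comparison for the smoothed indicator. The covariances of the two processes differ by
`(1 - ⟨∇, ∇'⟩) (1 - ⟨u, u'⟩) ≥ 0`, where `∇, ∇'` are gradients of the regularized norm; this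
vanishes for `u = u'` because the `u`'s are unit vectors. -/
lemma integral_softIndicator_gordon (u : U → EuclideanSpace ℝ (Fin n)) (hu : ∀ k, ‖u k‖ = 1)
    {β η r : ℝ} (hβ : 0 ≤ β) (hη : 0 < η) :
    ∫ x, softIndicator β η r (fun k => gordonVec (m := m) (u k)) (fun k => gordonScal (u k))
        (fun i => if i.isRight then x i else 0) ∂(gaussPi (GordonIndex m n))
      ≤ ∫ x, softIndicator β η r (fun k => gordonVec (m := m) (u k)) (fun k => gordonScal (u k))
        (fun i => if i.isRight then 0 else x i) ∂(gaussPi (GordonIndex m n)) := by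
  have hP := hasPartials_softIndicator (β := β) (η := η) (r := r) hβ hη
    (fun k => gordonVec (m := m) (u k)) (fun k => gordonScal (u k))
  have := hP.integral_comparison (fun i => i.isRight = true) 0 fun x => ?_
  · simpa using this
  rw [zero_mul]
  set y : U → EuclideanSpace ℝ (Fin m) := fun k => linComb (gordonVec (u k)) x with hy
  set N : U → ℝ := fun k => regNorm η (gordonVec (m := m) (u k)) x with hN
  have hNpos : ∀ k, 0 < N k := fun k => regNorm_pos hη _ _
  have hsq : ∀ k, ∑ i, u k i ^ 2 = 1 := fun k => by
    rw [← EuclideanSpace.real_norm_sq_eq, hu, one_pow]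
  have hinner : ∀ k k', ∑ j, (y k j / N k) * (y k' j / N k') ≤ 1 := fun k k' => by
    have h1 : ∑ j, (y k j / N k) * (y k' j / N k') = inner ℝ (y k) (y k') / (N k * N k') := by
      rw [EuclideanSpace.inner_eq_star_dotProduct]
      simp only [dotProduct, Finset.sum_div]
      refine Finset.sum_congr rfl fun j _ => ?_
      have := (hNpos k).ne'; have := (hNpos k').ne'
      simp
      field_simp
    rw [h1, div_le_one (mul_pos (hNpos k) (hNpos k'))]
    exact (real_inner_le_norm _ _).trans (mul_le_mul (norm_le_regNorm _ _) (norm_le_regNorm _ _)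
      (norm_nonneg _) (hNpos k).le)
  have huu : ∀ k k', ∑ i, u k i * u k' i ≤ 1 := fun k k' => by
    have h1 : ∑ i, u k i * u k' i = inner ℝ (u k) (u k') := by
      rw [EuclideanSpace.inner_eq_star_dotProduct]
      simp only [dotProduct]
      exact Finset.sum_congr rfl fun j _ => by simp [mul_comm]
    rw [h1]
    have := real_inner_le_norm (u k) (u k')
    rwa [hu, hu, one_mul] at this
  have hs1 : ∀ k a, slope η (gordonVec (m := m) (u k)) (gordonScal (u k)) (Sum.inl (Sum.inl a)) x
      = u k a.2 * (y k a.1 / N k) := fun k a => by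
    simp only [slope, gordonVec, gordonScal, inner_smul_right, EuclideanSpace.inner_single_right]
    simp [hy, hN]; ring
  have hs2 : ∀ k a, slope η (gordonVec (m := m) (u k)) (gordonScal (u k)) (Sum.inl (Sum.inr a)) x
      = 1 := fun k a => by
    simp [slope, gordonVec, gordonScal]
  have hs3 : ∀ k a, slope η (gordonVec (m := m) (u k)) (gordonScal (u k)) (Sum.inr (Sum.inl a)) x
      = y k a / N k := fun k a => by
    simp [slope, gordonVec, gordonScal, EuclideanSpace.inner_single_right, hy, hN]
  have hs4 : ∀ k a, slope η (gordonVec (m := m) (u k)) (gordonScal (u k)) (Sum.inr (Sum.inr a)) x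
      = -u k a := fun k a => by
    simp [slope, gordonVec, gordonScal]
  have ht1 : ∀ k a, slope2 η (gordonVec (m := m) (u k)) (Sum.inl (Sum.inl a)) x
      = u k a.2 ^ 2 * (1 / N k - y k a.1 ^ 2 / N k ^ 3) := fun k a => by
    simp only [slope2, gordonVec, inner_smul_right, EuclideanSpace.inner_single_right]
    simp [norm_smul, hy, hN]; ring
  have ht2 : ∀ k a, slope2 η (gordonVec (m := m) (u k)) (Sum.inl (Sum.inr a)) x = 0 :=
    fun k a => by simp [slope2, gordonVec]
  have ht3 : ∀ k a, slope2 η (gordonVec (m := m) (u k)) (Sum.inr (Sum.inl a)) x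
      = 1 / N k - y k a ^ 2 / N k ^ 3 := fun k a => by
    simp [slope2, gordonVec, EuclideanSpace.inner_single_right, hy, hN]
  have ht4 : ∀ k a, slope2 η (gordonVec (m := m) (u k)) (Sum.inr (Sum.inr a)) x = 0 :=
    fun k a => by simp [slope2, gordonVec]
  have hprod : ∀ k k', ∑ i : GordonIndex m n, (if i.isRight then (1 : ℝ) else -1) *
      (slope η (gordonVec (m := m) (u k)) (gordonScal (u k)) i x *
        slope η (gordonVec (m := m) (u k')) (gordonScal (u k')) i x)
      = -((1 - ∑ j, (y k j / N k) * (y k' j / N k')) * (1 - ∑ i, u k i * u k' i)) := by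
    intro k k'
    simp only [Fintype.sum_sum_type, Sum.isRight_inl, Sum.isRight_inr, hs1, hs2, hs3, hs4,
      Fintype.sum_prod_type]
    simp only [Bool.false_eq_true, ↓reduceIte, Finset.univ_unique, Finset.sum_singleton]
    have e : ∑ j, ∑ i, (-1 : ℝ) * (u k i * (y k j / N k) * (u k' i * (y k' j / N k')))
        = -((∑ j, (y k j / N k) * (y k' j / N k')) * ∑ i, u k i * u k' i) := by
      rw [Finset.sum_mul_sum, ← Finset.sum_neg_distrib]
      refine Finset.sum_congr rfl fun j _ => ?_
      rw [← Finset.sum_neg_distrib]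
      exact Finset.sum_congr rfl fun i _ => by ring
    rw [e]
    simp only [one_mul, neg_mul_neg]
    ring
  have key := sum_softD2_nonpos (β := β) (η := η) (r := r) hβ
    (fun k => gordonVec (m := m) (u k)) (fun k => gordonScal (u k))
    (fun i => if i.isRight then (1 : ℝ) else -1) x ?_ ?_ ?_
  · refine le_trans (le_of_eq (Finset.sum_congr rfl fun i _ => ?_)) key
    split_ifs <;> ring
  · intro k k'
    rw [hprod]
    have := mul_nonneg (sub_nonneg.2 (hinner k k')) (sub_nonneg.2 (huu k k'))
    linarith
  · intro k
    simp_rw [sq]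
    rw [hprod]
    have : ∑ i, u k i * u k i = 1 := by rw [← hsq k]; exact Finset.sum_congr rfl fun i _ => by ring
    rw [this]; ring
  · intro k
    simp only [Fintype.sum_sum_type, Sum.isRight_inl, Sum.isRight_inr, ht1, ht2, ht3, ht4,
      Fintype.sum_prod_type]
    simp only [Bool.false_eq_true, ↓reduceIte, Finset.univ_unique, one_mul,
      mul_zero, Finset.sum_const_zero, add_zero]
    rw [← Finset.sum_add_distrib]
    refine Finset.sum_eq_zero fun j _ => ?_
    rw [← Finset.mul_sum, ← Finset.sum_mul, hsq]
    ring

/-- If `∫ g j ≤ ∫ f j` for `[0, 1]`-valued functions, where `f j → 0` on `A` and `g j → 1` off `B`,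
then the probability of `A` is at most that of `B`. -/
lemma measure_le_of_tendsto {α : Type*} [MeasurableSpace α] {μ : Measure α}
    [IsProbabilityMeasure μ] {f g : ℕ → α → ℝ} (hf : ∀ j, Measurable (f j))
    (hg : ∀ j, Measurable (g j)) (hf01 : ∀ j x, f j x ∈ Set.Icc (0 : ℝ) 1)
    (hg01 : ∀ j x, g j x ∈ Set.Icc (0 : ℝ) 1) (hle : ∀ j, ∫ x, g j x ∂μ ≤ ∫ x, f j x ∂μ)
    {A B : Set α} (hA : MeasurableSet A) (hB : MeasurableSet B)
    (hfA : ∀ x ∈ A, Filter.Tendsto (fun j => f j x) Filter.atTop (nhds 0))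
    (hgB : ∀ x, x ∉ B → Filter.Tendsto (fun j => g j x) Filter.atTop (nhds 1)) :
    μ A ≤ μ B := by
  have hint : ∀ {k : α → ℝ}, Measurable k → (∀ x, k x ∈ Set.Icc (0 : ℝ) 1) → Integrable k μ :=
    fun hk h => Integrable.of_mem_Icc 0 1 hk.aemeasurable (Filter.Eventually.of_forall h)
  have l1 : Filter.Tendsto (fun j => ∫ x in A, f j x ∂μ) Filter.atTop
      (nhds (∫ _x in A, (0 : ℝ) ∂μ)) := by
    refine tendsto_integral_of_dominated_convergence (fun _ => 1)
      (fun j => (hf j).aestronglyMeasurable) (integrable_const _)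
      (fun j => Filter.Eventually.of_forall fun x => ?_)
      ((ae_restrict_iff' hA).2 (Filter.Eventually.of_forall hfA))
    rw [Real.norm_eq_abs, abs_of_nonneg (hf01 j x).1]; exact (hf01 j x).2
  have l2 : Filter.Tendsto (fun j => ∫ x in Bᶜ, g j x ∂μ) Filter.atTop
      (nhds (∫ _x in Bᶜ, (1 : ℝ) ∂μ)) := by
    refine tendsto_integral_of_dominated_convergence (fun _ => 1)
      (fun j => (hg j).aestronglyMeasurable) (integrable_const _)
      (fun j => Filter.Eventually.of_forall fun x => ?_)
      ((ae_restrict_iff' hB.compl).2 (Filter.Eventually.of_forall hgB))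
    rw [Real.norm_eq_abs, abs_of_nonneg (hg01 j x).1]; exact (hg01 j x).2
  have hj : ∀ j, ∫ x in Bᶜ, g j x ∂μ ≤ ∫ x in A, f j x ∂μ + μ.real Aᶜ := by
    intro j
    have h1 : ∫ x in Bᶜ, g j x ∂μ ≤ ∫ x, g j x ∂μ :=
      setIntegral_le_integral (hint (hg j) (hg01 j))
        (Filter.Eventually.of_forall fun x => (hg01 j x).1)
    have h2 := integral_add_compl hA (hint (hf j) (hf01 j))
    have h3 : ∫ x in Aᶜ, f j x ∂μ ≤ ∫ _x in Aᶜ, (1 : ℝ) ∂μ :=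
      integral_mono (hint (hf j) (hf01 j)).integrableOn (integrable_const _)
        fun x => (hf01 j x).2
    simp only [integral_const, smul_eq_mul, mul_one, measureReal_restrict_apply_univ] at h3
    linarith [hle j]
  have := le_of_tendsto_of_tendsto' l2 (l1.add_const _) hj
  simp only [integral_const, smul_eq_mul, mul_one, measureReal_restrict_apply_univ, mul_zero,
    zero_add] at this
  rw [probReal_compl_eq_one_sub hA, probReal_compl_eq_one_sub hB] at this
  have h : μ.real A ≤ μ.real B := by linarith
  exact (ENNReal.toReal_le_toReal (measure_ne_top _ _) (measure_ne_top _ _)).1 h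

lemma softIndicator_mem_Icc {ι E : Type*} [Fintype ι] [NormedAddCommGroup E]
    [InnerProductSpace ℝ E] (β η r : ℝ) (p : U → ι → E) (c : U → ι → ℝ) (x : ι → ℝ) :
    softIndicator β η r p c x ∈ Set.Icc (0 : ℝ) 1 :=
  ⟨(Real.exp_pos _).le, Real.exp_le_one_iff.2 (neg_nonpos.2
    (Finset.sum_nonneg fun _ _ => (Real.exp_pos _).le))⟩

lemma tendsto_softIndicator_zero {ι E : Type*} [Fintype ι] [NormedAddCommGroup E]
    [InnerProductSpace ℝ E] (r : ℝ) (p : U → ι → E) (c : U → ι → ℝ) (x : ι → ℝ)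
    (h : ∃ u, ‖linComb (p u) x‖ + ∑ i, x i * c u i < r) :
    Filter.Tendsto (fun j : ℕ => softIndicator (j + 1 : ℝ) (1 / (j + 1 : ℝ)) r p c x)
      Filter.atTop (nhds 0) := by
  obtain ⟨u, hu⟩ := h
  set d := r - (‖linComb (p u) x‖ + ∑ i, x i * c u i) with hd
  have hd0 : 0 < d := by linarith
  have h1 : Filter.Tendsto (fun j : ℕ => Real.exp (-Real.exp ((j + 1 : ℝ) * d - 1)))
      Filter.atTop (nhds 0) := by
    refine Real.tendsto_exp_neg_atTop_nhds_zero.comp (Real.tendsto_exp_atTop.comp ?_)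
    refine Filter.tendsto_atTop_add_const_right _ _ (Filter.Tendsto.atTop_mul_const hd0 ?_)
    exact Filter.tendsto_atTop_add_const_right _ _ tendsto_natCast_atTop_atTop
  refine squeeze_zero (fun j => (softIndicator_mem_Icc _ _ _ _ _ _).1) (fun j => ?_) h1
  refine Real.exp_le_exp.2 (neg_le_neg ?_)
  refine le_trans ?_ (Finset.single_le_sum (f := fun u => expWeight (j + 1 : ℝ) (1 / (j + 1 : ℝ)) r
    (p u) (c u) x) (fun _ _ => (Real.exp_pos _).le) (Finset.mem_univ u))
  refine Real.exp_le_exp.2 ?_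
  have hj : (0 : ℝ) < j + 1 := by positivity
  have hN : regNorm (1 / (j + 1 : ℝ)) (p u) x ≤ 1 / (j + 1 : ℝ) + ‖linComb (p u) x‖ := by
    refine Real.sqrt_le_iff.2 ⟨by positivity, ?_⟩
    have : 0 ≤ 1 / (j + 1 : ℝ) * ‖linComb (p u) x‖ := by positivity
    nlinarith
  have := mul_le_mul_of_nonneg_left hN hj.le
  rw [mul_add, mul_one_div_cancel hj.ne'] at this
  rw [hd]
  linarith

lemma tendsto_softIndicator_one {ι E : Type*} [Fintype ι] [NormedAddCommGroup E]
    [InnerProductSpace ℝ E] (r : ℝ) (p : U → ι → E) (c : U → ι → ℝ) (x : ι → ℝ)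
    (h : ∀ u, r < ‖linComb (p u) x‖ + ∑ i, x i * c u i) :
    Filter.Tendsto (fun j : ℕ => softIndicator (j + 1 : ℝ) (1 / (j + 1 : ℝ)) r p c x)
      Filter.atTop (nhds 1) := by
  have h1 : Filter.Tendsto (fun j : ℕ => -∑ u, expWeight (j + 1 : ℝ) (1 / (j + 1 : ℝ)) r
      (p u) (c u) x) Filter.atTop (nhds (-∑ _u : U, 0)) := by
    refine (tendsto_finsetSum _ fun u _ => ?_).neg
    set d := ‖linComb (p u) x‖ + ∑ i, x i * c u i - r with hd
    have hd0 : 0 < d := by linarith [h u]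
    have h2 : Filter.Tendsto (fun j : ℕ => Real.exp (-((j + 1 : ℝ) * d))) Filter.atTop (nhds 0) := by
      refine Real.tendsto_exp_neg_atTop_nhds_zero.comp (Filter.Tendsto.atTop_mul_const hd0 ?_)
      exact Filter.tendsto_atTop_add_const_right _ _ tendsto_natCast_atTop_atTop
    refine squeeze_zero (fun j => (Real.exp_pos _).le) (fun j => ?_) h2
    refine Real.exp_le_exp.2 ?_
    have hj : (0 : ℝ) < j + 1 := by positivity
    have := mul_le_mul_of_nonneg_left (norm_le_regNorm (η := 1 / (j + 1 : ℝ)) (p u) x) hj.le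
    rw [hd]
    linarith
  have := (Real.continuous_exp.tendsto _).comp h1
  simp only [Finset.sum_const_zero, neg_zero, Real.exp_zero] at this
  exact this

end Gordon

/-! ### Gordon's inequality for sequences of unit vectors -/

lemma measurePreserving_gaussPi_sum {κ κ' : Type*} [Fintype κ] [Fintype κ'] :
    MeasurePreserving (fun x : κ ⊕ κ' → ℝ => ((fun i => x (Sum.inl i)), fun i => x (Sum.inr i)))
      (gaussPi (κ ⊕ κ')) ((gaussPi κ).prod (gaussPi κ')) :=
  measurePreserving_sumPiEquivProdPi fun _ => gaussianReal 0 1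

lemma measurePreserving_toLp_gaussPi (n : ℕ) :
    MeasurePreserving (fun x : Fin n → ℝ => (WithLp.toLp 2 x : EuclideanSpace ℝ (Fin n)))
      (gaussPi (Fin n)) (stdGaussian (EuclideanSpace ℝ (Fin n))) :=
  ⟨by fun_prop, map_pi_eq_stdGaussian⟩

/-- The product of the matrix with entries `A (j, i)` and the vector `u`. -/
noncomputable def matVec {m n : ℕ} (A : Fin m × Fin n → ℝ) (u : EuclideanSpace ℝ (Fin n)) :
    EuclideanSpace ℝ (Fin m) :=
  WithLp.toLp 2 fun j => ∑ i, A (j, i) * u i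

lemma continuous_matVec {m n : ℕ} (u : EuclideanSpace ℝ (Fin n)) :
    Continuous fun A : Fin m × Fin n → ℝ => matVec A u := by
  unfold matVec; fun_prop

lemma linComb_gordonVec_left {m n : ℕ} (u : EuclideanSpace ℝ (Fin n)) (x : GordonIndex m n → ℝ) :
    linComb (gordonVec (m := m) u) (fun i => if i.isRight then 0 else x i)
      = matVec (fun a => x (Sum.inl (Sum.inl a))) u := by
  ext j
  simp only [linComb, Fintype.sum_sum_type, Sum.isRight_inl, Sum.isRight_inr,
    Fintype.sum_prod_type, gordonVec, matVec]
  simp [Finset.sum_apply, Pi.single_apply]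

lemma linComb_gordonVec_right {m n : ℕ} (u : EuclideanSpace ℝ (Fin n)) (x : GordonIndex m n → ℝ) :
    linComb (gordonVec (m := m) u) (fun i => if i.isRight then x i else 0)
      = WithLp.toLp 2 fun j => x (Sum.inr (Sum.inl j)) := by
  ext j
  simp only [linComb, Fintype.sum_sum_type, Sum.isRight_inl, Sum.isRight_inr,
    Fintype.sum_prod_type, gordonVec]
  simp [Finset.sum_apply, Pi.single_apply]

lemma sum_gordonScal_left {m n : ℕ} (u : EuclideanSpace ℝ (Fin n)) (x : GordonIndex m n → ℝ) :
    ∑ i, (if i.isRight then 0 else x i) * gordonScal (m := m) u i = x (Sum.inl (Sum.inr ())) := by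
  simp [Fintype.sum_sum_type, gordonScal]

lemma sum_gordonScal_right {m n : ℕ} (u : EuclideanSpace ℝ (Fin n)) (x : GordonIndex m n → ℝ) :
    ∑ i, (if i.isRight then x i else 0) * gordonScal (m := m) u i
      = -inner ℝ (WithLp.toLp 2 fun i => x (Sum.inr (Sum.inr i)) : EuclideanSpace ℝ (Fin n)) u := by
  simp [Fintype.sum_sum_type, gordonScal, PiLp.inner_apply, mul_comm]

lemma measurePreserving_matrix_scalar (m n : ℕ) :
    MeasurePreserving (fun x : GordonIndex m n → ℝ =>
      ((fun a => x (Sum.inl (Sum.inl a))), x (Sum.inl (Sum.inr ()))))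
      (gaussPi (GordonIndex m n)) ((gaussPi (Fin m × Fin n)).prod (gaussianReal 0 1)) := by
  have h1 := (measurePreserving_fst (μ := gaussPi (Fin m × Fin n ⊕ Unit))
    (ν := gaussPi (Fin m ⊕ Fin n))).comp measurePreserving_gaussPi_sum
  have h2 := (measurePreserving_gaussPi_sum (κ := Fin m × Fin n) (κ' := Unit)).comp h1
  have h3 := (MeasurePreserving.id (gaussPi (Fin m × Fin n))).prod
    (measurePreserving_eval (fun _ : Unit => gaussianReal 0 1) ())
  exact h3.comp h2

lemma measurePreserving_vectors (m n : ℕ) :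
    MeasurePreserving (fun x : GordonIndex m n → ℝ =>
      ((WithLp.toLp 2 fun j => x (Sum.inr (Sum.inl j)) : EuclideanSpace ℝ (Fin m)),
        (WithLp.toLp 2 fun i => x (Sum.inr (Sum.inr i)) : EuclideanSpace ℝ (Fin n))))
      (gaussPi (GordonIndex m n))
      ((stdGaussian (EuclideanSpace ℝ (Fin m))).prod (stdGaussian (EuclideanSpace ℝ (Fin n)))) := by
  have h1 := (measurePreserving_snd (μ := gaussPi (Fin m × Fin n ⊕ Unit))
    (ν := gaussPi (Fin m ⊕ Fin n))).comp measurePreserving_gaussPi_sum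
  have h2 := (measurePreserving_gaussPi_sum (κ := Fin m) (κ' := Fin n)).comp h1
  exact ((measurePreserving_toLp_gaussPi m).prod (measurePreserving_toLp_gaussPi n)).comp h2

/-- Gordon's comparison inequality for finitely many unit vectors. -/
theorem gordon_finite {m n : ℕ} {U : Type*} [Fintype U] (u : U → EuclideanSpace ℝ (Fin n))
    (hu : ∀ k, ‖u k‖ = 1) (r : ℝ) :
    ((gaussPi (Fin m × Fin n)).prod (gaussianReal 0 1))
        {p | ∃ k, ‖matVec p.1 (u k)‖ + p.2 < r}
      ≤ ((stdGaussian (EuclideanSpace ℝ (Fin m))).prod (stdGaussian (EuclideanSpace ℝ (Fin n))))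
        {q | ∃ k, ‖q.1‖ - inner ℝ q.2 (u k) ≤ r} := by
  have hA : MeasurableSet {p : (Fin m × Fin n → ℝ) × ℝ | ∃ k, ‖matVec p.1 (u k)‖ + p.2 < r} := by
    rw [Set.ofPred_exists]
    refine MeasurableSet.iUnion fun k => measurableSet_lt ?_ measurable_const
    have := continuous_matVec (m := m) (u k)
    exact Continuous.measurable (by fun_prop)
  have hB : MeasurableSet {q : EuclideanSpace ℝ (Fin m) × EuclideanSpace ℝ (Fin n) |
      ∃ k, ‖q.1‖ - inner ℝ q.2 (u k) ≤ r} := by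
    rw [Set.ofPred_exists]
    refine MeasurableSet.iUnion fun k => measurableSet_le ?_ measurable_const
    exact Continuous.measurable (by fun_prop)
  have hX := measurePreserving_matrix_scalar m n
  have hY := measurePreserving_vectors m n
  rw [← hX.measure_preimage hA.nullMeasurableSet, ← hY.measure_preimage hB.nullMeasurableSet]
  have hm : ∀ j : ℕ, Measurable (softIndicator (j + 1 : ℝ) (1 / (j + 1 : ℝ)) r
      (fun k => gordonVec (m := m) (u k)) (fun k => gordonScal (u k))) := fun j =>
    (differentiable_softIndicator (by positivity) _ _).continuous.measurable
  have hl : Measurable fun (x : GordonIndex m n → ℝ) i => if i.isRight then 0 else x i := by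
    refine measurable_pi_lambda _ fun i => ?_
    cases i <;> simp only [Sum.isRight_inl, Sum.isRight_inr, Bool.false_eq_true, ↓reduceIte] <;> fun_prop
  have hr : Measurable fun (x : GordonIndex m n → ℝ) i => if i.isRight then x i else 0 := by
    refine measurable_pi_lambda _ fun i => ?_
    cases i <;> simp only [Sum.isRight_inl, Sum.isRight_inr, Bool.false_eq_true, ↓reduceIte] <;> fun_prop
  refine measure_le_of_tendsto (fun j => (hm j).comp hl) (fun j => (hm j).comp hr)
    (fun j x => softIndicator_mem_Icc _ _ _ _ _ _) (fun j x => softIndicator_mem_Icc _ _ _ _ _ _)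
    (fun j => integral_softIndicator_gordon u hu (by positivity) (by positivity))
    (hX.measurable hA) (hY.measurable hB) (fun x hx => ?_) (fun x hx => ?_)
  · obtain ⟨k, hk⟩ := hx
    refine tendsto_softIndicator_zero _ _ _ _ ⟨k, ?_⟩
    rw [linComb_gordonVec_left, sum_gordonScal_left]
    exact hk
  · refine tendsto_softIndicator_one _ _ _ _ fun k => ?_
    rw [linComb_gordonVec_right, sum_gordonScal_right, ← sub_eq_add_neg]
    by_contra hk
    exact hx ⟨k, not_lt.1 hk⟩

/-- Gordon's comparison inequality for a sequence of unit vectors. -/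
theorem gordon_countable {m n : ℕ} (u : ℕ → EuclideanSpace ℝ (Fin n)) (hu : ∀ k, ‖u k‖ = 1)
    {W : EuclideanSpace ℝ (Fin n) → ℝ} (hW : ∀ h k, inner ℝ h (u k) ≤ W h) (r : ℝ) :
    ((gaussPi (Fin m × Fin n)).prod (gaussianReal 0 1))
        {p | (⨅ k, ‖matVec p.1 (u k)‖) + p.2 < r}
      ≤ ((stdGaussian (EuclideanSpace ℝ (Fin m))).prod (stdGaussian (EuclideanSpace ℝ (Fin n))))
        {q | ‖q.1‖ - W q.2 ≤ r} := by
  have hsub : {p : (Fin m × Fin n → ℝ) × ℝ | (⨅ k, ‖matVec p.1 (u k)‖) + p.2 < r}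
      ⊆ ⋃ K : ℕ, {p | ∃ k : Fin K, ‖matVec p.1 (u k)‖ + p.2 < r} := by
    intro p hp
    have hp' : (⨅ k, ‖matVec p.1 (u k)‖) + p.2 < r := hp
    obtain ⟨k, hk⟩ := exists_lt_of_ciInf_lt (lt_sub_iff_add_lt.2 hp')
    exact Set.mem_iUnion.2 ⟨k + 1, ⟨k, Nat.lt_succ_self k⟩, lt_sub_iff_add_lt.1 hk⟩
  refine (measure_mono hsub).trans ?_
  rw [Monotone.measure_iUnion]
  · refine iSup_le fun K => (gordon_finite (fun k : Fin K => u k) (fun k => hu k) r).trans ?_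
    refine measure_mono ?_
    rintro q ⟨k, hk⟩
    simp only [Set.mem_ofPred_eq]
    linarith [hW q.2 k]
  · rintro K K' hK p ⟨k, hk⟩
    exact ⟨Fin.castLE hK k, hk⟩

/-- Stochastic domination, tested on decreasing functions. -/
lemma lintegral_antitone_le {α α' : Type*} [MeasurableSpace α] [MeasurableSpace α']
    {μ : Measure α} {ν : Measure α'} [IsProbabilityMeasure μ] [IsProbabilityMeasure ν]
    {X : α → ℝ} {Y : α' → ℝ} (hX : Measurable X) (hY : Measurable Y)
    (h : ∀ r, μ {a | X a < r} ≤ ν {b | Y b ≤ r}) {ψ : ℝ → ℝ} (hψ : Antitone ψ)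
    (hc : Continuous ψ) (h0 : ∀ t, 0 ≤ ψ t) :
    ∫⁻ a, ENNReal.ofReal (ψ (X a)) ∂μ ≤ ∫⁻ b, ENNReal.ofReal (ψ (Y b)) ∂ν := by
  rw [lintegral_eq_lintegral_meas_lt μ (f := fun a => ψ (X a))
      (Filter.Eventually.of_forall fun a => h0 _) (hc.measurable.comp hX).aemeasurable,
    lintegral_eq_lintegral_meas_le ν (f := fun b => ψ (Y b))
      (Filter.Eventually.of_forall fun a => h0 _) (hc.measurable.comp hY).aemeasurable]
  refine lintegral_mono fun t => ?_
  by_cases hall : ∀ s, t < ψ s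
  · have : {b | t ≤ ψ (Y b)} = Set.univ := Set.eq_univ_of_forall fun b => (hall _).le
    rw [this, measure_univ]
    exact prob_le_one
  push Not at hall
  obtain ⟨s₀, hs₀⟩ := hall
  by_cases hne : ∃ s, t < ψ s
  · have hbdd : BddAbove {s | t < ψ s} := ⟨s₀, fun s hs => by
      by_contra hlt
      exact absurd (hψ (not_le.1 hlt).le) (by simp only [Set.mem_ofPred_eq] at hs; linarith)⟩
    have hopen : IsOpen {s | t < ψ s} := isOpen_lt continuous_const hc
    set r := sSup {s | t < ψ s} with hr
    have h1 : {a | t < ψ (X a)} ⊆ {a | X a < r} := fun a ha => by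
      refine lt_of_le_of_ne (le_csSup hbdd ha) fun he => ?_
      obtain ⟨ε, hε, hball⟩ := Metric.isOpen_iff.1 hopen _ ha
      have : X a + ε / 2 ∈ {s | t < ψ s} := hball (by
        rw [Metric.mem_ball, Real.dist_eq, add_sub_cancel_left, abs_of_pos (half_pos hε)]
        exact half_lt_self hε)
      have := le_csSup hbdd this
      simp only [he] at this
      linarith
    have h2 : {b | Y b ≤ r} ⊆ {b | t ≤ ψ (Y b)} := fun b hb => by
      refine le_trans ?_ (hψ hb)
      have hmem : r ∈ closure {s | t < ψ s} := csSup_mem_closure hne hbdd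
      exact closure_minimal (fun s hs => (le_of_lt hs : t ≤ ψ s))
        (isClosed_le continuous_const hc) hmem
    exact (measure_mono h1).trans ((h r).trans (measure_mono h2))
  · push Not at hne
    have : {a | t < ψ (X a)} = ∅ := Set.eq_empty_of_forall_notMem fun a ha =>
      absurd (hne (X a)) (not_le.2 ha)
    rw [this, measure_empty]
    exact zero_le

/-- The probability that a Gaussian matrix comes arbitrarily close to killing one of the unit
vectors `u k`, bounded through any decreasing test function `ψ`. -/
theorem measure_iInf_eq_zero_mul_le {m n : ℕ} (u : ℕ → EuclideanSpace ℝ (Fin n))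
    (hu : ∀ k, ‖u k‖ = 1) {W : EuclideanSpace ℝ (Fin n) → ℝ} (hWm : Measurable W)
    (hW : ∀ h k, inner ℝ h (u k) ≤ W h) {ψ : ℝ → ℝ} (hψ : Antitone ψ)
    (hc : Continuous ψ) (h0 : ∀ t, 0 ≤ ψ t) :
    gaussPi (Fin m × Fin n) {A | ⨅ k, ‖matVec A (u k)‖ = 0} *
        ∫⁻ t, ENNReal.ofReal (ψ t) ∂(gaussianReal 0 1)
      ≤ ∫⁻ q, ENNReal.ofReal (ψ (‖q.1‖ - W q.2))
        ∂((stdGaussian (EuclideanSpace ℝ (Fin m))).prod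
          (stdGaussian (EuclideanSpace ℝ (Fin n)))) := by
  have hF : Measurable fun A : Fin m × Fin n → ℝ => ⨅ k, ‖matVec A (u k)‖ :=
    Measurable.iInf fun k => ((continuous_matVec (u k)).norm).measurable
  have hset : MeasurableSet {A : Fin m × Fin n → ℝ | ⨅ k, ‖matVec A (u k)‖ = 0} :=
    hF (measurableSet_singleton 0)
  have hψm : Measurable fun t => ENNReal.ofReal (ψ t) := hc.measurable.ennreal_ofReal
  refine le_trans ?_ (lintegral_antitone_le
    (X := fun p : (Fin m × Fin n → ℝ) × ℝ => (⨅ k, ‖matVec p.1 (u k)‖) + p.2)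
    (Y := fun q : EuclideanSpace ℝ (Fin m) × EuclideanSpace ℝ (Fin n) => ‖q.1‖ - W q.2)
    ((hF.comp measurable_fst).add measurable_snd) (by fun_prop) (gordon_countable u hu hW) hψ hc h0)
  rw [← lintegral_indicator_one hset, ← lintegral_prod_mul (by fun_prop) (by fun_prop)]
  refine lintegral_mono fun p => ?_
  by_cases hp : p.1 ∈ {A : Fin m × Fin n → ℝ | ⨅ k, ‖matVec A (u k)‖ = 0}
  · have : (⨅ k, ‖matVec p.1 (u k)‖) = 0 := hp
    simp [this]
  · simp [Set.indicator_of_notMem hp]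

/-! ### Gaussian concentration -/

section Concentration

variable {κ : Type*}

/-- The index of the coordinate that `j` perturbs. -/
def tripleIndex : κ ⊕ (κ ⊕ κ) → κ
  | Sum.inl i => i
  | Sum.inr (Sum.inl i) => i
  | Sum.inr (Sum.inr i) => i

/-- Whether the coordinate `j` enters `x + y₁`. -/
def coeffFst : κ ⊕ (κ ⊕ κ) → ℝ
  | Sum.inl _ => 1
  | Sum.inr (Sum.inl _) => 1
  | Sum.inr (Sum.inr _) => 0

/-- Whether the coordinate `j` enters `x + y₂`. -/
def coeffSnd : κ ⊕ (κ ⊕ κ) → ℝ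
  | Sum.inl _ => 1
  | Sum.inr (Sum.inl _) => 0
  | Sum.inr (Sum.inr _) => 1

/-- The vector `x + y₁` in the coordinates `(x, y₁, y₂)`. -/
def sumFst (x : κ ⊕ (κ ⊕ κ) → ℝ) : κ → ℝ := fun i => x (Sum.inl i) + x (Sum.inr (Sum.inl i))

/-- The vector `x + y₂` in the coordinates `(x, y₁, y₂)`. -/
def sumSnd (x : κ ⊕ (κ ⊕ κ) → ℝ) : κ → ℝ := fun i => x (Sum.inl i) + x (Sum.inr (Sum.inr i))

lemma coeffFst_sq (j : κ ⊕ (κ ⊕ κ)) : coeffFst j * coeffFst j = coeffFst j := by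
  rcases j with j | j | j <;> simp [coeffFst]

lemma coeffSnd_sq (j : κ ⊕ (κ ⊕ κ)) : coeffSnd j * coeffSnd j = coeffSnd j := by
  rcases j with j | j | j <;> simp [coeffSnd]

lemma abs_coeffFst_le (j : κ ⊕ (κ ⊕ κ)) : |coeffFst j| ≤ 1 := by
  rcases j with j | j | j <;> simp [coeffFst]

lemma abs_coeffSnd_le (j : κ ⊕ (κ ⊕ κ)) : |coeffSnd j| ≤ 1 := by
  rcases j with j | j | j <;> simp [coeffSnd]

lemma abs_pair_le {s B a b : ℝ} (hs : 0 ≤ s) (ha : |a| ≤ B) (hb : |b| ≤ B)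
    (j : κ ⊕ (κ ⊕ κ)) : |s / 2 * (coeffFst j * a + coeffSnd j * b)| ≤ s * B := by
  have hB : 0 ≤ B := (abs_nonneg a).trans ha
  have h1 : |coeffFst j * a| ≤ B := by
    rw [abs_mul]; exact (mul_le_of_le_one_left (abs_nonneg _) (abs_coeffFst_le j)).trans ha
  have h2 : |coeffSnd j * b| ≤ B := by
    rw [abs_mul]; exact (mul_le_of_le_one_left (abs_nonneg _) (abs_coeffSnd_le j)).trans hb
  rw [abs_mul, abs_of_nonneg (by positivity : 0 ≤ s / 2)]
  have := mul_le_mul_of_nonneg_left ((abs_add_le _ _).trans (add_le_add h1 h2))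
    (by positivity : 0 ≤ s / 2)
  linarith

/-- The function `exp (s / 2 * (f (x + y₁) + f (x + y₂)))`. -/
noncomputable def pairExp (s : ℝ) (f : (κ → ℝ) → ℝ) (x : κ ⊕ (κ ⊕ κ) → ℝ) : ℝ :=
  Real.exp (s / 2 * (f (sumFst x) + f (sumSnd x)))

/-- The logarithmic first partial derivatives of `pairExp`. -/
noncomputable def pairSlope (s : ℝ) (d : κ → (κ → ℝ) → ℝ) (j : κ ⊕ (κ ⊕ κ))
    (x : κ ⊕ (κ ⊕ κ) → ℝ) : ℝ :=
  s / 2 * (coeffFst j * d (tripleIndex j) (sumFst x) + coeffSnd j * d (tripleIndex j) (sumSnd x))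

variable [DecidableEq κ]

lemma sumFst_update (x : κ ⊕ (κ ⊕ κ) → ℝ) (j : κ ⊕ (κ ⊕ κ)) (r : ℝ) :
    sumFst (Function.update x j r) = Function.update (sumFst x) (tripleIndex j)
      (sumFst x (tripleIndex j) + coeffFst j * (r - x j)) := by
  ext i
  rcases j with j | j | j <;> by_cases h : i = j <;>
    simp [sumFst, tripleIndex, coeffFst, h, Function.update_apply] ; ring

lemma sumSnd_update (x : κ ⊕ (κ ⊕ κ) → ℝ) (j : κ ⊕ (κ ⊕ κ)) (r : ℝ) :
    sumSnd (Function.update x j r) = Function.update (sumSnd x) (tripleIndex j)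
      (sumSnd x (tripleIndex j) + coeffSnd j * (r - x j)) := by
  ext i
  rcases j with j | j | j <;> by_cases h : i = j <;>
    simp [sumSnd, tripleIndex, coeffSnd, h, Function.update_apply] ; ring

lemma hasDerivAt_comp_affine {g : ℝ → ℝ} {g' y t α : ℝ} (hg : HasDerivAt g g' y) :
    HasDerivAt (fun r => g (y + α * (r - t))) (α * g') t := by
  have h1 : HasDerivAt (fun r => y + α * (r - t)) α t := by
    simpa using (((hasDerivAt_id t).sub_const t).const_mul α).const_add y
  have h2 : HasDerivAt g g' (y + α * (t - t)) := by simpa using hg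
  exact (h2.comp t h1).congr_deriv (mul_comm _ _)

lemma hasDerivAt_sumFst {g g' : (κ → ℝ) → ℝ} {i : κ}
    (hg : ∀ x, HasDerivAt (fun r => g (Function.update x i r)) (g' x) (x i))
    (x : κ ⊕ (κ ⊕ κ) → ℝ) {j : κ ⊕ (κ ⊕ κ)} (hj : tripleIndex j = i) :
    HasDerivAt (fun r => g (sumFst (Function.update x j r))) (coeffFst j * g' (sumFst x)) (x j) := by
  subst hj
  simp_rw [sumFst_update]
  exact hasDerivAt_comp_affine (hg (sumFst x))

lemma hasDerivAt_sumSnd {g g' : (κ → ℝ) → ℝ} {i : κ}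
    (hg : ∀ x, HasDerivAt (fun r => g (Function.update x i r)) (g' x) (x i))
    (x : κ ⊕ (κ ⊕ κ) → ℝ) {j : κ ⊕ (κ ⊕ κ)} (hj : tripleIndex j = i) :
    HasDerivAt (fun r => g (sumSnd (Function.update x j r))) (coeffSnd j * g' (sumSnd x)) (x j) := by
  subst hj
  simp_rw [sumSnd_update]
  exact hasDerivAt_comp_affine (hg (sumSnd x))

variable [Fintype κ]

/-- Smooth functions that are `1`-Lipschitz for the Euclidean norm, with bounded second partial
derivatives. The Lipschitz property is recorded as `⟨∇f x, ∇f y⟩ ≤ 1`, the form in which the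
interpolation uses it. -/
structure HasLipschitzPartials (f : (κ → ℝ) → ℝ) (d d2 : κ → (κ → ℝ) → ℝ) : Prop where
  diff : Differentiable ℝ f
  deriv : ∀ i x, HasDerivAt (fun r => f (Function.update x i r)) (d i x) (x i)
  deriv2 : ∀ i x, HasDerivAt (fun r => d i (Function.update x i r)) (d2 i x) (x i)
  cont : ∀ i, Continuous (d i)
  cont2 : ∀ i, Continuous (d2 i)
  inner_le : ∀ x y, ∑ i, d i x * d i y ≤ 1
  bound : ∃ B : ℝ, 0 ≤ B ∧ ∀ x, |f x| ≤ B + ∑ i, |x i| ∧ ∀ i, |d2 i x| ≤ B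

variable {f : (κ → ℝ) → ℝ} {d d2 : κ → (κ → ℝ) → ℝ}

lemma HasLipschitzPartials.abs_le_one (h : HasLipschitzPartials f d d2) (i : κ) (x : κ → ℝ) :
    |d i x| ≤ 1 := by
  rw [← sq_le_one_iff_abs_le_one, sq]
  exact (Finset.single_le_sum (f := fun i => d i x * d i x) (fun i _ => mul_self_nonneg _)
    (Finset.mem_univ i)).trans (h.inner_le x x)

lemma HasLipschitzPartials.hasPartials_pairExp (h : HasLipschitzPartials f d d2) {s : ℝ}
    (hs : 0 ≤ s) :
    HasPartials (pairExp s f) (fun j x => pairExp s f x * pairSlope s d j x)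
      (fun j x => pairExp s f x * (pairSlope s d j x ^ 2 + pairSlope s d2 j x)) := by
  have c1 : Continuous (sumFst : (κ ⊕ (κ ⊕ κ) → ℝ) → κ → ℝ) := by unfold sumFst; fun_prop
  have c2 : Continuous (sumSnd : (κ ⊕ (κ ⊕ κ) → ℝ) → κ → ℝ) := by unfold sumSnd; fun_prop
  have e1 : Differentiable ℝ (sumFst : (κ ⊕ (κ ⊕ κ) → ℝ) → κ → ℝ) := by unfold sumFst; fun_prop
  have e2 : Differentiable ℝ (sumSnd : (κ ⊕ (κ ⊕ κ) → ℝ) → κ → ℝ) := by unfold sumSnd; fun_prop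
  have hdiff : Differentiable ℝ (pairExp s f) := by
    unfold pairExp
    exact (((h.diff.comp e1).add (h.diff.comp e2)).const_mul _).exp
  have cs : ∀ {d : κ → (κ → ℝ) → ℝ}, (∀ i, Continuous (d i)) → ∀ j,
      Continuous (pairSlope s d j) := fun hd j => by
    unfold pairSlope
    exact continuous_const.mul ((continuous_const.mul ((hd _).comp c1)).add
      (continuous_const.mul ((hd _).comp c2)))
  have hG : ∀ j x, HasDerivAt (fun r => pairExp s f (Function.update x j r))
      (pairExp s f x * pairSlope s d j x) (x j) := fun j x => by
    have := (((hasDerivAt_sumFst (h.deriv (tripleIndex j)) x rfl).add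
      (hasDerivAt_sumSnd (h.deriv (tripleIndex j)) x rfl)).const_mul (s / 2)).exp
    simp only [Pi.add_apply, Function.update_eq_self] at this
    exact this
  have hD : ∀ j x, HasDerivAt (fun r => pairSlope s d j (Function.update x j r))
      (pairSlope s d2 j x) (x j) := fun j x => by
    have := (((hasDerivAt_sumFst (h.deriv2 (tripleIndex j)) x rfl).const_mul (coeffFst j)).add
      ((hasDerivAt_sumSnd (h.deriv2 (tripleIndex j)) x rfl).const_mul
        (coeffSnd j))).const_mul (s / 2)
    refine this.congr_deriv ?_
    rw [← mul_assoc, ← mul_assoc, coeffFst_sq, coeffSnd_sq]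
    rfl
  refine ⟨hdiff, hG, fun j x => ?_, fun j => hdiff.continuous.mul (cs h.cont j), fun j =>
    hdiff.continuous.mul (((cs h.cont j).pow 2).add (cs h.cont2 j)), ?_⟩
  · have := (hG j x).mul (hD j x)
    simp only [Function.update_eq_self] at this
    refine this.congr_deriv ?_
    ring
  · obtain ⟨B, hB, hb⟩ := h.bound
    have hg : ∀ x, pairExp s f x ≤ Real.exp (s * B) * Real.exp (s * ∑ j, |x j|) := fun x => by
      rw [← Real.exp_add]
      refine Real.exp_le_exp.2 ?_
      have t1 := (le_abs_self _).trans (hb (sumFst x)).1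
      have t2 := (le_abs_self _).trans (hb (sumSnd x)).1
      have t3 : ∑ i, |sumFst x i| + ∑ i, |sumSnd x i| ≤ 2 * ∑ j, |x j| := by
        have u1 : ∑ i, |sumFst x i| ≤ ∑ i, |x (Sum.inl i)| + ∑ i, |x (Sum.inr (Sum.inl i))| := by
          rw [← Finset.sum_add_distrib]
          exact Finset.sum_le_sum fun i _ => abs_add_le _ _
        have u2 : ∑ i, |sumSnd x i| ≤ ∑ i, |x (Sum.inl i)| + ∑ i, |x (Sum.inr (Sum.inr i))| := by
          rw [← Finset.sum_add_distrib]
          exact Finset.sum_le_sum fun i _ => abs_add_le _ _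
        have v1 : 0 ≤ ∑ i, |x (Sum.inr (Sum.inl i))| := Finset.sum_nonneg fun i _ => abs_nonneg _
        have v2 : 0 ≤ ∑ i, |x (Sum.inr (Sum.inr i))| := Finset.sum_nonneg fun i _ => abs_nonneg _
        simp only [Fintype.sum_sum_type]
        linarith
      have := mul_le_mul_of_nonneg_left (by linarith :
        f (sumFst x) + f (sumSnd x) ≤ 2 * B + 2 * ∑ j, |x j|) (by positivity : 0 ≤ s / 2)
      linarith
    refine ⟨Real.exp (s * B) * (1 + s + s ^ 2 + s * B), s, by positivity, hs, fun x => ?_⟩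
    have hpos : 0 < pairExp s f x := Real.exp_pos _
    have key : ∀ y, |y| ≤ 1 + s + s ^ 2 + s * B → |pairExp s f x * y|
        ≤ Real.exp (s * B) * (1 + s + s ^ 2 + s * B) * Real.exp (s * ∑ j, |x j|) := fun y hy => by
      rw [abs_mul, abs_of_pos hpos]
      have := mul_le_mul (hg x) hy (abs_nonneg _) (by positivity)
      linarith
    have hsB : 0 ≤ s * B := by positivity
    have k1 : ∀ j, |pairSlope s d j x| ≤ s := fun j =>
      (abs_pair_le hs (h.abs_le_one _ _) (h.abs_le_one _ _) j).trans_eq (mul_one s)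
    refine ⟨?_, fun j => ⟨key _ ?_, key _ ?_⟩⟩
    · have := key 1 (by rw [abs_one]; nlinarith)
      rwa [mul_one] at this
    · nlinarith [k1 j]
    · have k2 : |pairSlope s d2 j x| ≤ s * B := abs_pair_le hs ((hb _).2 _) ((hb _).2 _) j
      have k3 : |pairSlope s d j x ^ 2| ≤ s ^ 2 := by
        rw [abs_pow]; exact pow_le_pow_left₀ (abs_nonneg _) (k1 j) 2
      linarith [abs_add_le (pairSlope s d j x ^ 2) (pairSlope s d2 j x)]

/-- Replacing one Gaussian vector by two independent copies, with half of the exponent each, costs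
a factor `exp (s² / 4)`. -/
lemma HasLipschitzPartials.integral_exp_le_sq (h : HasLipschitzPartials f d d2) {s : ℝ}
    (hs : 0 ≤ s) :
    ∫ x, Real.exp (s * f x) ∂(gaussPi κ)
      ≤ Real.exp (s ^ 2 / 4) * (∫ x, Real.exp (s / 2 * f x) ∂(gaussPi κ)) ^ 2 := by
  have key := (h.hasPartials_pairExp hs).integral_comparison (fun j => j.isLeft = true)
    (s ^ 2 / 2) fun x => ?_
  · have mp := measurePreserving_gaussPi_sum (κ := κ) (κ' := κ ⊕ κ)
    have m1 := (measurePreserving_fst (μ := gaussPi κ) (ν := gaussPi (κ ⊕ κ))).comp mp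
    have m2 := (measurePreserving_gaussPi_sum (κ := κ) (κ' := κ)).comp
      ((measurePreserving_snd (μ := gaussPi κ) (ν := gaussPi (κ ⊕ κ))).comp mp)
    have hc : Continuous f := h.diff.continuous
    have e1 : ∫ x, pairExp s f (fun i => if i.isLeft then x i else 0) ∂(gaussPi (κ ⊕ (κ ⊕ κ)))
        = ∫ x, Real.exp (s * f x) ∂(gaussPi κ) := by
      rw [← m1.map_eq, integral_map m1.measurable.aemeasurable
        (Continuous.aestronglyMeasurable (by fun_prop))]
      refine integral_congr_ae (Filter.Eventually.of_forall fun x => ?_)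
      have f1 : sumFst (fun i => if i.isLeft then x i else 0) = fun i => x (Sum.inl i) := by
        ext i; simp [sumFst]
      have f2 : sumSnd (fun i => if i.isLeft then x i else 0) = fun i => x (Sum.inl i) := by
        ext i; simp [sumSnd]
      simp only [pairExp, f1, f2, Function.comp_apply]
      ring_nf
    have e2 : ∫ x, pairExp s f (fun i => if i.isLeft then 0 else x i) ∂(gaussPi (κ ⊕ (κ ⊕ κ)))
        = (∫ x, Real.exp (s / 2 * f x) ∂(gaussPi κ)) ^ 2 := by
      rw [sq, ← integral_prod_mul, ← m2.map_eq, integral_map m2.measurable.aemeasurable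
        (Continuous.aestronglyMeasurable (by fun_prop))]
      refine integral_congr_ae (Filter.Eventually.of_forall fun x => ?_)
      have f1 : sumFst (fun i => if i.isLeft then 0 else x i)
          = fun i => x (Sum.inr (Sum.inl i)) := by
        ext i; simp [sumFst]
      have f2 : sumSnd (fun i => if i.isLeft then 0 else x i)
          = fun i => x (Sum.inr (Sum.inr i)) := by
        ext i; simp [sumSnd]
      simp only [pairExp, f1, f2, Function.comp_apply, mul_add, Real.exp_add]
    rw [e1, e2] at key
    convert key using 3
    ring
  · have hpos : 0 < pairExp s f x := Real.exp_pos _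
    have e : ∑ j, (if j.isLeft = true then
          pairExp s f x * (pairSlope s d j x ^ 2 + pairSlope s d2 j x)
        else -(pairExp s f x * (pairSlope s d j x ^ 2 + pairSlope s d2 j x)))
        = pairExp s f x * (s ^ 2 / 2 * ∑ i, d i (sumFst x) * d i (sumSnd x)) := by
      simp only [Fintype.sum_sum_type, Sum.isLeft_inl, Sum.isLeft_inr, ↓reduceIte,
        Bool.false_eq_true, Finset.mul_sum, ← Finset.sum_add_distrib]
      refine Finset.sum_congr rfl fun i _ => ?_
      simp only [pairSlope, coeffFst, coeffSnd, tripleIndex]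
      ring
    rw [e]
    have := mul_le_mul_of_nonneg_left (h.inner_le (sumFst x) (sumSnd x))
      (by positivity : 0 ≤ pairExp s f x * (s ^ 2 / 2))
    linarith

lemma HasLipschitzPartials.integrable_exp (h : HasLipschitzPartials f d d2) (t : ℝ) :
    Integrable (fun x => Real.exp (t * f x)) (gaussPi κ) := by
  obtain ⟨B, hB, hb⟩ := h.bound
  have hc : Continuous f := h.diff.continuous
  refine integrable_of_growth (K := Real.exp (|t| * B)) (c := |t|) (by fun_prop) fun x => ?_
  rw [abs_of_pos (Real.exp_pos _), ← Real.exp_add]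
  refine Real.exp_le_exp.2 ((le_abs_self _).trans ?_)
  rw [abs_mul, ← mul_add]
  exact mul_le_mul_of_nonneg_left (hb x).1 (abs_nonneg _)

lemma HasLipschitzPartials.integral_exp_le_pow (h : HasLipschitzPartials f d d2) (k : ℕ) :
    ∀ {s : ℝ}, 0 ≤ s → ∫ x, Real.exp (s * f x) ∂(gaussPi κ)
      ≤ Real.exp (s ^ 2 / 2 * (1 - (1 / 2) ^ k)) *
        (∫ x, Real.exp (s / 2 ^ k * f x) ∂(gaussPi κ)) ^ (2 ^ k) := by
  induction k with
  | zero => intro s _; simp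
  | succ k ih =>
    intro s hs
    have h1 := h.integral_exp_le_sq hs
    have h2 := ih (s := s / 2) (by positivity)
    have h0 : 0 ≤ ∫ x, Real.exp (s / 2 * f x) ∂(gaussPi κ) :=
      integral_nonneg fun x => (Real.exp_pos _).le
    have h3 := mul_le_mul_of_nonneg_left (pow_le_pow_left₀ h0 h2 2) (Real.exp_pos (s ^ 2 / 4)).le
    refine (h1.trans h3).trans (le_of_eq ?_)
    rw [mul_pow, ← pow_mul, ← pow_succ, ← mul_assoc, ← Real.exp_nat_mul, ← Real.exp_add,
      div_div, ← pow_succ']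
    congr 2
    push_cast
    ring

/-- The sharp Gaussian concentration inequality for smooth `1`-Lipschitz functions. -/
theorem HasLipschitzPartials.integral_exp_le (h : HasLipschitzPartials f d d2) {s : ℝ}
    (hs : 0 ≤ s) :
    ∫ x, Real.exp (s * f x) ∂(gaussPi κ)
      ≤ Real.exp (s * ∫ x, f x ∂(gaussPi κ) + s ^ 2 / 2) := by
  -- halving `k` times leaves `(𝔼 exp (s f / 2ᵏ)) ^ 2ᵏ`, which tends to `exp (s 𝔼 f)` because the
  -- cumulant generating function has derivative `𝔼 f` at `0`
  rcases hs.eq_or_lt with rfl | hs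
  · simp
  have hset : interior (integrableExpSet f (gaussPi κ)) = Set.univ := by
    have : integrableExpSet f (gaussPi κ) = Set.univ :=
      Set.eq_univ_of_forall fun t => h.integrable_exp t
    rw [this, interior_univ]
  have hd0 : HasDerivAt (cgf f (gaussPi κ)) (∫ x, f x ∂(gaussPi κ)) 0 := by
    have h1 := hasDerivAt_mgf (X := f) (μ := gaussPi κ) (t := 0) (by rw [hset]; trivial)
    exact (h1.log (by simp)).congr_deriv (by simp)
  have hpos : ∀ t, 0 < mgf f (gaussPi κ) t := fun t => mgf_pos (h.integrable_exp t)
  have hlim := hd0.tendsto_slope_zero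
  simp only [zero_add, cgf_zero, sub_zero, smul_eq_mul] at hlim
  have hseq : Filter.Tendsto (fun k : ℕ => s / 2 ^ k) Filter.atTop (nhdsWithin 0 {0}ᶜ) := by
    refine tendsto_nhdsWithin_iff.2 ⟨?_, Filter.Eventually.of_forall fun k => ?_⟩
    · have := (tendsto_pow_atTop_nhds_zero_of_lt_one (r := (1 / 2 : ℝ)) (by norm_num)
        (by norm_num)).const_mul s
      simpa [div_eq_mul_inv] using this
    · have : s / 2 ^ k ≠ 0 := by positivity
      exact this
  have hl2 := ((hlim.comp hseq).const_mul s).const_add (s ^ 2 / 2)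
  have hle : ∀ k : ℕ, cgf f (gaussPi κ) s ≤ s ^ 2 / 2 +
      s * ((s / 2 ^ k)⁻¹ * cgf f (gaussPi κ) (s / 2 ^ k)) := fun k => by
    have h1 : Real.log (mgf f (gaussPi κ) s) ≤ Real.log (Real.exp (s ^ 2 / 2 * (1 - (1 / 2) ^ k)) *
        mgf f (gaussPi κ) (s / 2 ^ k) ^ (2 ^ k)) :=
      Real.log_le_log (hpos s) (h.integral_exp_le_pow k hs.le)
    rw [Real.log_mul (Real.exp_pos _).ne' (pow_ne_zero _ (hpos _).ne'), Real.log_exp,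
      Real.log_pow] at h1
    have h2 : s ^ 2 / 2 * (1 - (1 / 2) ^ k) ≤ s ^ 2 / 2 :=
      mul_le_of_le_one_right (by positivity) (by linarith [pow_nonneg (by norm_num : (0 : ℝ) ≤ 1 / 2) k])
    have h3 : s * ((s / 2 ^ k)⁻¹ * cgf f (gaussPi κ) (s / 2 ^ k))
        = 2 ^ k * cgf f (gaussPi κ) (s / 2 ^ k) := by field_simp
    rw [h3]
    push_cast at h1
    exact h1.trans (by gcongr; exact le_rfl)
  have := ge_of_tendsto' hl2 hle
  rw [cgf, Real.log_le_iff_le_exp (hpos s)] at this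
  rw [add_comm]
  exact this

end Concentration

/-! ### The exponential moments of a supremum of Gaussian linear forms -/

section SoftMax

variable {κ U : Type*} [Fintype κ] [Fintype U]

/-- `exp (β ⟨x, u⟩)`. -/
noncomputable def expForm (β : ℝ) (u : κ → ℝ) (x : κ → ℝ) : ℝ := Real.exp (β * linComb u x)

/-- `∑ k, exp (β ⟨x, u k⟩) * c k`. -/
noncomputable def expSum (β : ℝ) (u : U → κ → ℝ) (c : U → ℝ) (x : κ → ℝ) : ℝ :=
  ∑ k, expForm β (u k) x * c k

/-- The soft maximum `β⁻¹ log (∑ k, exp (β ⟨x, u k⟩))` of the linear forms `⟨x, u k⟩`. -/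
noncomputable def softMax (β : ℝ) (u : U → κ → ℝ) (x : κ → ℝ) : ℝ :=
  β⁻¹ * Real.log (expSum β u (fun _ => 1) x)

lemma expForm_pos (β : ℝ) (u : κ → ℝ) (x : κ → ℝ) : 0 < expForm β u x := Real.exp_pos _

lemma expSum_one_pos [Nonempty U] (β : ℝ) (u : U → κ → ℝ) (x : κ → ℝ) :
    0 < expSum β u (fun _ => 1) x :=
  Finset.sum_pos (fun k _ => by simpa using expForm_pos β (u k) x) Finset.univ_nonempty

lemma continuous_expSum (β : ℝ) (u : U → κ → ℝ) (c : U → ℝ) : Continuous (expSum β u c) := by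
  unfold expSum expForm linComb; fun_prop

lemma abs_expSum_le (β : ℝ) (u : U → κ → ℝ) {c : U → ℝ} (hc : ∀ k, |c k| ≤ 1) (x : κ → ℝ) :
    |expSum β u c x| ≤ expSum β u (fun _ => 1) x := by
  refine (Finset.abs_sum_le_sum_abs _ _).trans (Finset.sum_le_sum fun k _ => ?_)
  rw [abs_mul, abs_of_pos (expForm_pos _ _ _)]
  exact mul_le_mul_of_nonneg_left (hc k) (expForm_pos _ _ _).le

lemma linComb_le_softMax [Nonempty U] {β : ℝ} (hβ : 0 < β) (u : U → κ → ℝ) (x : κ → ℝ) (k : U) :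
    linComb (u k) x ≤ softMax β u x := by
  unfold softMax
  rw [le_inv_mul_iff₀ hβ, Real.le_log_iff_exp_le (expSum_one_pos β u x)]
  have := Finset.single_le_sum (f := fun k => expForm β (u k) x * 1)
    (fun k _ => by simpa using (expForm_pos β (u k) x).le) (Finset.mem_univ k)
  simpa [expForm, expSum] using this

lemma softMax_le [Nonempty U] {β : ℝ} (hβ : 0 < β) (u : U → κ → ℝ) (x : κ → ℝ) {w : ℝ}
    (hw : ∀ k, linComb (u k) x ≤ w) : softMax β u x ≤ w + Real.log (Fintype.card U) / β := by
  unfold softMax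
  rw [inv_mul_le_iff₀ hβ, mul_add, mul_div_cancel₀ _ hβ.ne',
    Real.log_le_iff_le_exp (expSum_one_pos β u x), Real.exp_add, Real.exp_log (by
      exact_mod_cast Fintype.card_pos), mul_comm]
  have : ∑ _k : U, Real.exp (β * w) = (Fintype.card U : ℝ) * Real.exp (β * w) := by simp
  rw [← this]
  refine Finset.sum_le_sum fun k _ => ?_
  rw [mul_one]
  exact Real.exp_le_exp.2 (mul_le_mul_of_nonneg_left (hw k) hβ.le)

lemma abs_linComb_le {u : κ → ℝ} (hu : ∀ i, |u i| ≤ 1) (x : κ → ℝ) :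
    |linComb u x| ≤ ∑ i, |x i| := by
  refine (Finset.abs_sum_le_sum_abs _ _).trans (Finset.sum_le_sum fun i _ => ?_)
  rw [smul_eq_mul, abs_mul]
  exact mul_le_of_le_one_right (abs_nonneg _) (hu i)

variable [DecidableEq κ]

lemma hasDerivAt_expSum (β : ℝ) (u : U → κ → ℝ) (c : U → ℝ) (i : κ) (x : κ → ℝ) :
    HasDerivAt (fun r => expSum β u c (Function.update x i r))
      (β * expSum β u (fun k => c k * u k i) x) (x i) := by
  have := HasDerivAt.fun_sum (u := Finset.univ) fun k _ =>
    ((hasDerivAt_linComb (u k) i x).const_mul β).exp.mul_const (c k)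
  simp only [Function.update_eq_self] at this
  refine this.congr_deriv ?_
  unfold expSum expForm
  rw [Finset.mul_sum]
  exact Finset.sum_congr rfl fun k _ => by ring

/-- The gradient of a soft maximum is a convex combination of the `u k`, so two gradients have inner
product at most `1` as soon as the `u k` do. -/
lemma hasLipschitzPartials_softMax [Nonempty U] {β : ℝ} (hβ : 0 < β) {u : U → κ → ℝ}
    (hu : ∀ k l, ∑ i, u k i * u l i ≤ 1) :
    HasLipschitzPartials (softMax β u)
      (fun i x => expSum β u (fun k => u k i) x / expSum β u (fun _ => 1) x)
      (fun i x => β * (expSum β u (fun k => u k i * u k i) x / expSum β u (fun _ => 1) x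
        - (expSum β u (fun k => u k i) x / expSum β u (fun _ => 1) x) ^ 2)) := by
  have hu1 : ∀ k i, |u k i| ≤ 1 := fun k i => by
    rw [← sq_le_one_iff_abs_le_one, sq]
    exact (Finset.single_le_sum (f := fun i => u k i * u k i) (fun i _ => mul_self_nonneg _)
      (Finset.mem_univ i)).trans (hu k k)
  have hS := fun x => expSum_one_pos β u x
  have hd : Differentiable ℝ (expSum β u fun _ => 1) := by
    unfold expSum expForm linComb; fun_prop
  have hq : ∀ {c : U → ℝ}, (∀ k, |c k| ≤ 1) → ∀ x,
      |expSum β u c x / expSum β u (fun _ => 1) x| ≤ 1 := fun hc x => by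
    rw [abs_div, abs_of_pos (hS x), div_le_one (hS x)]
    exact abs_expSum_le β u hc x
  refine ⟨?_, fun i x => ?_, fun i x => ?_, fun i => ?_, fun i => ?_, fun x y => ?_, ?_⟩
  · unfold softMax
    exact (hd.log fun x => (hS x).ne').const_mul _
  · have h1 := hasDerivAt_expSum β u (fun _ => 1) i x
    have h2 := (h1.log (by simpa using (hS x).ne')).const_mul β⁻¹
    simp only [Function.update_eq_self, one_mul] at h2
    refine h2.congr_deriv ?_
    field_simp
  · have h1 := hasDerivAt_expSum β u (fun _ => 1) i x
    have h2 := hasDerivAt_expSum β u (fun k => u k i) i x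
    have h3 := h2.div h1 (by simpa using (hS x).ne')
    simp only [Function.update_eq_self, one_mul] at h3
    refine h3.congr_deriv ?_
    have := (hS x).ne'
    field_simp
  · exact (continuous_expSum _ _ _).div (continuous_expSum _ _ _) fun x => (hS x).ne'
  · exact continuous_const.mul (((continuous_expSum _ _ _).div (continuous_expSum _ _ _)
      fun x => (hS x).ne').sub (((continuous_expSum _ _ _).div (continuous_expSum _ _ _)
      fun x => (hS x).ne').pow 2))
  · have e : ∑ i, expSum β u (fun k => u k i) x * expSum β u (fun k => u k i) y
        = ∑ k, ∑ l, expForm β (u k) x * expForm β (u l) y * ∑ i, u k i * u l i := by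
      simp_rw [expSum, Finset.sum_mul_sum, Finset.mul_sum]
      rw [Finset.sum_comm]
      refine Finset.sum_congr rfl fun k _ => ?_
      rw [Finset.sum_comm]
      exact Finset.sum_congr rfl fun l _ => Finset.sum_congr rfl fun i _ => by ring
    have e2 : ∑ i, expSum β u (fun k => u k i) x / expSum β u (fun _ => 1) x *
          (expSum β u (fun k => u k i) y / expSum β u (fun _ => 1) y)
        = (∑ i, expSum β u (fun k => u k i) x * expSum β u (fun k => u k i) y) /
          (expSum β u (fun _ => 1) x * expSum β u (fun _ => 1) y) := by
      rw [Finset.sum_div]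
      exact Finset.sum_congr rfl fun i _ => div_mul_div_comm _ _ _ _
    rw [e2, div_le_one (mul_pos (hS x) (hS y)), e]
    simp only [expSum, mul_one, Finset.sum_mul_sum]
    exact Finset.sum_le_sum fun k _ => Finset.sum_le_sum fun l _ =>
      mul_le_of_le_one_right (mul_pos (expForm_pos _ _ _) (expForm_pos _ _ _)).le (hu k l)
  · have hN : 0 ≤ Real.log (Fintype.card U) := Real.log_natCast_nonneg _
    refine ⟨Real.log (Fintype.card U) / β + 2 * β, by positivity, fun x => ⟨?_, fun i => ?_⟩⟩
    · have k0 := Classical.arbitrary U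
      have h1 := linComb_le_softMax hβ u x k0
      have h2 := softMax_le hβ u x (fun k => (le_abs_self _).trans (abs_linComb_le (hu1 k) x))
      have h3 := (neg_le_abs _).trans (abs_linComb_le (hu1 k0) x)
      have h4 : 0 ≤ Real.log (Fintype.card U) / β := by positivity
      rw [abs_le]
      constructor <;> linarith
    · rw [abs_mul, abs_of_pos hβ]
      have h1 := hq (c := fun k => u k i * u k i) (fun k => by
        rw [abs_mul]; exact mul_le_one₀ (hu1 k i) (abs_nonneg _) (hu1 k i)) x
      have h2 := pow_le_one₀ (n := 2) (abs_nonneg _) (hq (c := fun k => u k i) (fun k => hu1 k i) x)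
      rw [← abs_pow] at h2
      have h3 := mul_le_mul_of_nonneg_left ((abs_sub _ _).trans (add_le_add h1 h2)) hβ.le
      have h4 : 0 ≤ Real.log (Fintype.card U) / β := by positivity
      linarith

end SoftMax

lemma integrable_norm_stdGaussian (n : ℕ) :
    Integrable (fun h : EuclideanSpace ℝ (Fin n) => ‖h‖)
      (stdGaussian (EuclideanSpace ℝ (Fin n))) :=
  IsGaussian.integrable_id.norm

lemma linComb_eq_inner {n : ℕ} (u : EuclideanSpace ℝ (Fin n)) (x : Fin n → ℝ) :
    linComb (fun i => u i) x = inner ℝ (WithLp.toLp 2 x : EuclideanSpace ℝ (Fin n)) u := by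
  simp [linComb, PiLp.inner_apply, mul_comm]

/-- Exponential moments of the largest of finitely many linear forms `⟨h, u k⟩`, in terms of any
integrable upper bound `W` of these forms. -/
lemma lintegral_exp_inner_le {n : ℕ} {U : Type*} [Fintype U] [Nonempty U]
    (u : U → EuclideanSpace ℝ (Fin n)) (hu : ∀ k, ‖u k‖ = 1)
    {W : EuclideanSpace ℝ (Fin n) → ℝ} (hWi : Integrable W (stdGaussian (EuclideanSpace ℝ (Fin n))))
    (hW : ∀ h k, inner ℝ h (u k) ≤ W h) {s : ℝ} (hs : 0 ≤ s) :
    ∫⁻ h, ENNReal.ofReal (Real.exp (s * ⨆ k, inner ℝ h (u k)))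
        ∂(stdGaussian (EuclideanSpace ℝ (Fin n)))
      ≤ ENNReal.ofReal (Real.exp (s * ∫ h, W h ∂(stdGaussian (EuclideanSpace ℝ (Fin n)))
        + s ^ 2 / 2)) := by
  have mp := measurePreserving_toLp_gaussPi n
  have huu : ∀ k l, ∑ i, u k i * u l i ≤ 1 := fun k l => by
    have h1 : ∑ i, u k i * u l i = inner ℝ (u k) (u l) := by
      simp [PiLp.inner_apply, mul_comm]
    rw [h1]
    have := real_inner_le_norm (u k) (u l)
    rwa [hu, hu, one_mul] at this
  set N := Real.log (Fintype.card U) with hN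
  set I := ∫ h, W h ∂(stdGaussian (EuclideanSpace ℝ (Fin n))) with hI
  have step : ∀ j : ℕ, ∫⁻ h, ENNReal.ofReal (Real.exp (s * ⨆ k, inner ℝ h (u k)))
        ∂(stdGaussian (EuclideanSpace ℝ (Fin n)))
      ≤ ENNReal.ofReal (Real.exp (s * (I + N / (j + 1)) + s ^ 2 / 2)) := by
    intro j
    have hβ : (0 : ℝ) < j + 1 := by positivity
    have hL := hasLipschitzPartials_softMax hβ (u := fun k i => u k i) huu
    have hI1 : ∫ x, softMax (j + 1 : ℝ) (fun k i => u k i) x ∂(gaussPi (Fin n))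
        ≤ I + N / (j + 1) := by
      have e : I = ∫ x, W (WithLp.toLp 2 x) ∂(gaussPi (Fin n)) := by
        rw [hI, ← mp.map_eq, integral_map mp.measurable.aemeasurable]
        rw [mp.map_eq]; exact hWi.aestronglyMeasurable
      have hi : Integrable (fun x : Fin n → ℝ => W (WithLp.toLp 2 x)) (gaussPi (Fin n)) :=
        mp.integrable_comp_of_integrable hWi
      have e2 : I + N / (j + 1) = ∫ x, (W (WithLp.toLp 2 x) + N / (j + 1)) ∂(gaussPi (Fin n)) := by
        rw [integral_add hi (integrable_const _), e]; simp
      rw [e2]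
      refine integral_mono ?_ (hi.add (integrable_const _)) fun x => ?_
      · obtain ⟨B, hB, hb⟩ := hL.bound
        refine integrable_of_growth (K := B + 1) (c := 1) hL.diff.continuous fun x => ?_
        have h1 := (hb x).1
        have h2 := le_exp_self (∑ i, |x i|)
        have h3 : 1 ≤ Real.exp (∑ i, |x i|) :=
          Real.one_le_exp (Finset.sum_nonneg fun i _ => abs_nonneg _)
        rw [one_mul]
        nlinarith
      · exact softMax_le hβ _ _ fun k => (linComb_eq_inner (u k) x).le.trans (hW _ k)
    have hcont : Measurable fun h : EuclideanSpace ℝ (Fin n) =>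
        ENNReal.ofReal (Real.exp (s * ⨆ k, inner ℝ h (u k))) := by
      have : Measurable fun h : EuclideanSpace ℝ (Fin n) => ⨆ k, inner ℝ h (u k) :=
        Measurable.iSup fun k => by fun_prop
      fun_prop
    rw [← mp.lintegral_comp hcont]
    calc ∫⁻ x, ENNReal.ofReal (Real.exp (s * ⨆ k, inner ℝ
            (WithLp.toLp 2 x : EuclideanSpace ℝ (Fin n)) (u k))) ∂(gaussPi (Fin n))
        ≤ ∫⁻ x, ENNReal.ofReal (Real.exp (s * softMax (j + 1 : ℝ) (fun k i => u k i) x))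
            ∂(gaussPi (Fin n)) := by
          refine lintegral_mono fun x => ENNReal.ofReal_le_ofReal (Real.exp_le_exp.2
            (mul_le_mul_of_nonneg_left (ciSup_le fun k => ?_) hs))
          exact (linComb_eq_inner (u k) x).ge.trans
            (linComb_le_softMax hβ (fun k i => u k i) x k)
      _ = ENNReal.ofReal (∫ x, Real.exp (s * softMax (j + 1 : ℝ) (fun k i => u k i) x)
            ∂(gaussPi (Fin n))) :=
          (ofReal_integral_eq_lintegral_ofReal (hL.integrable_exp s)
            (Filter.Eventually.of_forall fun x => (Real.exp_pos _).le)).symm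
      _ ≤ _ := by
          refine ENNReal.ofReal_le_ofReal ((hL.integral_exp_le hs).trans (Real.exp_le_exp.2 ?_))
          gcongr
  refine ge_of_tendsto' (x := Filter.atTop) ?_ step
  refine ENNReal.tendsto_ofReal ((Real.continuous_exp.tendsto _).comp ?_)
  have h1 := tendsto_const_div_atTop_nhds_zero_nat N
  have h2 := (Filter.tendsto_add_atTop_iff_nat 1).2 h1
  have h3 := ((h2.const_add I).const_mul s).add_const (s ^ 2 / 2)
  simpa using h3

/-- Exponential moments of the supremum `W` of a sequence of linear forms `⟨h, u k⟩`. -/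
theorem lintegral_exp_iSup_le {n : ℕ} (u : ℕ → EuclideanSpace ℝ (Fin n)) (hu : ∀ k, ‖u k‖ = 1)
    {s : ℝ} (hs : 0 ≤ s) :
    ∫⁻ h, ENNReal.ofReal (Real.exp (s * ⨆ k, inner ℝ h (u k)))
        ∂(stdGaussian (EuclideanSpace ℝ (Fin n)))
      ≤ ENNReal.ofReal (Real.exp (s * ∫ h, (⨆ k, inner ℝ h (u k))
        ∂(stdGaussian (EuclideanSpace ℝ (Fin n))) + s ^ 2 / 2)) := by
  have hle : ∀ h k, inner ℝ h (u k) ≤ ‖h‖ := fun h k => by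
    have := real_inner_le_norm h (u k)
    rwa [hu, mul_one] at this
  have hbdd : ∀ h, BddAbove (Set.range fun k => inner ℝ h (u k)) := fun h =>
    ⟨‖h‖, by rintro _ ⟨k, rfl⟩; exact hle h k⟩
  have hm : Measurable fun h : EuclideanSpace ℝ (Fin n) => ⨆ k, inner ℝ h (u k) :=
    Measurable.iSup fun k => by fun_prop
  have hWi : Integrable (fun h : EuclideanSpace ℝ (Fin n) => ⨆ k, inner ℝ h (u k))
      (stdGaussian (EuclideanSpace ℝ (Fin n))) := by
    refine (integrable_norm_stdGaussian n).mono' hm.aestronglyMeasurable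
      (Filter.Eventually.of_forall fun h => ?_)
    rw [Real.norm_eq_abs, abs_le]
    refine ⟨le_trans ?_ (le_ciSup (hbdd h) 0), ciSup_le (hle h)⟩
    have := (neg_le_abs _).trans (abs_real_inner_le_norm h (u 0))
    rw [hu, mul_one] at this
    linarith
  have hfin : ∀ h K, BddAbove (Set.range fun k : Fin (K + 1) => inner ℝ h (u k)) := fun h K =>
    Set.Finite.bddAbove (Set.finite_range _)
  have hlim : ∀ h, Filter.Tendsto (fun K : ℕ => ⨆ k : Fin (K + 1), inner ℝ h (u k))
      Filter.atTop (nhds (⨆ k, inner ℝ h (u k))) := by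
    intro h
    have hmono : Monotone fun K : ℕ => ⨆ k : Fin (K + 1), inner ℝ h (u k) := fun K K' hK =>
      ciSup_le fun k => le_ciSup (hfin h K') (Fin.castLE (Nat.succ_le_succ hK) k)
    have hup : ∀ K : ℕ, ⨆ k : Fin (K + 1), inner ℝ h (u k) ≤ ⨆ k, inner ℝ h (u k) := fun K =>
      ciSup_le fun k => le_ciSup (hbdd h) (k : ℕ)
    refine tendsto_order.2 ⟨fun a ha => ?_, fun a ha =>
      Filter.Eventually.of_forall fun K => (hup K).trans_lt ha⟩
    obtain ⟨k, hk⟩ := exists_lt_of_lt_ciSup ha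
    filter_upwards [Filter.eventually_ge_atTop k] with K hK
    exact hk.trans_le (le_ciSup (hfin h K) ⟨k, Nat.lt_succ_of_le hK⟩)
  have hmf : ∀ K : ℕ, Measurable fun h : EuclideanSpace ℝ (Fin n) =>
      ENNReal.ofReal (Real.exp (s * ⨆ k : Fin (K + 1), inner ℝ h (u k))) := fun K => by
    have : Measurable fun h : EuclideanSpace ℝ (Fin n) => ⨆ k : Fin (K + 1), inner ℝ h (u k) :=
      Measurable.iSup fun k => by fun_prop
    fun_prop
  calc _ = ∫⁻ h, Filter.liminf (fun K : ℕ => ENNReal.ofReal (Real.exp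
            (s * ⨆ k : Fin (K + 1), inner ℝ h (u k)))) Filter.atTop
            ∂(stdGaussian (EuclideanSpace ℝ (Fin n))) := by
        refine lintegral_congr fun h => (Filter.Tendsto.liminf_eq ?_).symm
        exact ENNReal.tendsto_ofReal ((Real.continuous_exp.tendsto _).comp ((hlim h).const_mul s))
    _ ≤ Filter.liminf (fun K : ℕ => ∫⁻ h, ENNReal.ofReal (Real.exp
            (s * ⨆ k : Fin (K + 1), inner ℝ h (u k)))
            ∂(stdGaussian (EuclideanSpace ℝ (Fin n)))) Filter.atTop :=
        lintegral_liminf_le hmf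
    _ ≤ _ := by
        refine Filter.liminf_le_of_le (by isBoundedDefault) fun b hb => ?_
        obtain ⟨K, hK⟩ := hb.exists
        exact hK.trans (lintegral_exp_inner_le (fun k : Fin (K + 1) => u k) (fun k => hu k) hWi
          (fun h k => le_ciSup (hbdd h) (k : ℕ)) hs)

/-! ### The norm of a standard Gaussian vector -/

section Chi

variable {m : ℕ}

/-- The Euclidean norm of a family of real numbers. -/
noncomputable def euclNorm (x : Fin m → ℝ) : ℝ := ‖(WithLp.toLp 2 x : EuclideanSpace ℝ (Fin m))‖

/-- The exponential moments `𝔼 ‖g‖ᵏ exp (t ‖g‖)` of a standard normal vector `g` in `ℝᵐ`. -/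
noncomputable def normMoment (m k : ℕ) (t : ℝ) : ℝ :=
  ∫ x, euclNorm x ^ k * Real.exp (t * euclNorm x) ∂(gaussPi (Fin m))

lemma continuous_euclNorm : Continuous (euclNorm (m := m)) := by unfold euclNorm; fun_prop

lemma euclNorm_nonneg (x : Fin m → ℝ) : 0 ≤ euclNorm x := norm_nonneg _

lemma sq_euclNorm (x : Fin m → ℝ) : euclNorm x ^ 2 = ∑ i, x i ^ 2 :=
  EuclideanSpace.real_norm_sq_eq _

lemma abs_le_euclNorm (x : Fin m → ℝ) (i : Fin m) : |x i| ≤ euclNorm x :=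
  abs_le_of_sq_le_sq (by
    rw [sq_euclNorm]
    exact Finset.single_le_sum (f := fun i => x i ^ 2) (fun i _ => sq_nonneg _)
      (Finset.mem_univ i)) (euclNorm_nonneg x)

lemma euclNorm_le_sum (x : Fin m → ℝ) : euclNorm x ≤ ∑ i, |x i| := by
  have h0 : 0 ≤ ∑ i, |x i| := Finset.sum_nonneg fun i _ => abs_nonneg _
  refine le_of_sq_le_sq ?_ h0
  rw [sq_euclNorm, sq (∑ i, |x i|), Finset.sum_mul]
  refine Finset.sum_le_sum fun i _ => ?_
  rw [← sq_abs, sq]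
  exact mul_le_mul_of_nonneg_left (Finset.single_le_sum (f := fun i => |x i|)
    (fun i _ => abs_nonneg _) (Finset.mem_univ i)) (abs_nonneg _)

lemma integrable_exp_euclNorm (t : ℝ) :
    Integrable (fun x => Real.exp (t * euclNorm x)) (gaussPi (Fin m)) := by
  have := continuous_euclNorm (m := m)
  refine integrable_of_growth (K := 1) (c := |t|) (by fun_prop) fun x => ?_
  rw [abs_of_pos (Real.exp_pos _), one_mul]
  refine Real.exp_le_exp.2 ((le_abs_self _).trans ?_)
  rw [abs_mul, abs_of_nonneg (euclNorm_nonneg x)]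
  exact mul_le_mul_of_nonneg_left (euclNorm_le_sum x) (abs_nonneg _)

lemma interior_integrableExpSet_euclNorm :
    interior (integrableExpSet (euclNorm (m := m)) (gaussPi (Fin m))) = Set.univ := by
  have : integrableExpSet (euclNorm (m := m)) (gaussPi (Fin m)) = Set.univ :=
    Set.eq_univ_of_forall fun t => integrable_exp_euclNorm t
  rw [this, interior_univ]

lemma integrable_normMoment (k : ℕ) (t : ℝ) :
    Integrable (fun x => euclNorm x ^ k * Real.exp (t * euclNorm x)) (gaussPi (Fin m)) :=
  integrable_pow_mul_exp_of_mem_interior_integrableExpSet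
    (by rw [interior_integrableExpSet_euclNorm]; trivial) k

lemma hasDerivAt_normMoment (k : ℕ) (t : ℝ) :
    HasDerivAt (normMoment m k) (normMoment m (k + 1) t) t :=
  hasDerivAt_integral_pow_mul_exp_real
    (by rw [interior_integrableExpSet_euclNorm]; trivial) k

/-- No differentiability of `g` is needed at the zero of the other factor; this covers the origin,
where the Euclidean norm has no derivative. -/
lemma hasDerivAt_id_mul {g : ℝ → ℝ} (hg : Continuous g) :
    HasDerivAt (fun r => r * g r) (g 0) 0 := by
  rw [hasDerivAt_iff_tendsto_slope]
  refine (hg.tendsto 0 |>.mono_left nhdsWithin_le_nhds).congr' ?_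
  filter_upwards [self_mem_nhdsWithin] with r hr
  have : r ≠ 0 := hr
  simp [slope_def_field, this]

lemma hasDerivAt_euclNorm {x : Fin m → ℝ} (hx : euclNorm x ≠ 0) (i : Fin m) :
    HasDerivAt (fun r => euclNorm (Function.update x i r)) (x i / euclNorm x) (x i) := by
  have hl : ∀ x : Fin m → ℝ, linComb (fun j => EuclideanSpace.single j (1 : ℝ)) x
      = WithLp.toLp 2 x := fun x => by
    ext j; simp [linComb, Finset.sum_apply, Pi.single_apply]
  have h1 := (hasDerivAt_linComb (fun j => EuclideanSpace.single j (1 : ℝ)) i x).norm_sq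
  simp only [hl, Function.update_eq_self] at h1
  have h2 := h1.sqrt (by simp only [Function.update_eq_self]; exact pow_ne_zero 2 hx)
  simp only [Function.update_eq_self, Real.sqrt_sq (norm_nonneg _)] at h2
  refine h2.congr_deriv ?_
  rw [EuclideanSpace.inner_single_right]
  simp only [euclNorm]
  rw [mul_div_mul_left _ _ two_ne_zero]
  simp

/-- Integration by parts: `𝔼 ‖g‖² exp (t‖g‖) = m 𝔼 exp (t‖g‖) + t 𝔼 ‖g‖ exp (t‖g‖)`. -/
lemma normMoment_two (t : ℝ) :
    normMoment m 2 t = m * normMoment m 0 t + t * normMoment m 1 t := by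
  have hc := continuous_euclNorm (m := m)
  have i0 : ∀ i : Fin m, Integrable (fun x => x i * Real.exp (t * euclNorm x))
      (gaussPi (Fin m)) := fun i => by
    refine (integrable_normMoment (m := m) 1 t).mono' (Continuous.aestronglyMeasurable
      (by fun_prop)) (Filter.Eventually.of_forall fun x => ?_)
    rw [Real.norm_eq_abs, abs_mul, abs_of_pos (Real.exp_pos _), pow_one]
    exact mul_le_mul_of_nonneg_right (abs_le_euclNorm x i) (Real.exp_pos _).le
  have i1 : ∀ i : Fin m, Integrable (fun x => x i * (x i * Real.exp (t * euclNorm x)))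
      (gaussPi (Fin m)) := fun i => by
    refine (integrable_normMoment (m := m) 2 t).mono' (Continuous.aestronglyMeasurable
      (by fun_prop)) (Filter.Eventually.of_forall fun x => ?_)
    rw [Real.norm_eq_abs, ← mul_assoc, ← sq, abs_mul, abs_of_pos (Real.exp_pos _), abs_pow]
    exact mul_le_mul_of_nonneg_right (pow_le_pow_left₀ (abs_nonneg _) (abs_le_euclNorm x i) 2)
      (Real.exp_pos _).le
  have i2 : ∀ i : Fin m, Integrable (fun x => x i ^ 2 / euclNorm x * Real.exp (t * euclNorm x))
      (gaussPi (Fin m)) := fun i => by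
    refine (integrable_normMoment (m := m) 1 t).mono' ?_ (Filter.Eventually.of_forall fun x => ?_)
    · exact (Measurable.mul (Measurable.div (by fun_prop) hc.measurable)
        (Continuous.measurable (by fun_prop))).aestronglyMeasurable
    rw [Real.norm_eq_abs, abs_mul, abs_of_pos (Real.exp_pos _), pow_one]
    refine mul_le_mul_of_nonneg_right ?_ (Real.exp_pos _).le
    rw [abs_of_nonneg (div_nonneg (sq_nonneg _) (euclNorm_nonneg x))]
    refine div_le_of_le_mul₀ (euclNorm_nonneg x) (euclNorm_nonneg x) ?_
    rw [← sq, ← sq_abs]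
    exact pow_le_pow_left₀ (abs_nonneg _) (abs_le_euclNorm x i) 2
  have e0 := integrable_exp_euclNorm (m := m) t
  have stein : ∀ i : Fin m, ∫ x, x i * (x i * Real.exp (t * euclNorm x)) ∂(gaussPi (Fin m))
      = ∫ x, (Real.exp (t * euclNorm x)
        + t * (x i ^ 2 / euclNorm x * Real.exp (t * euclNorm x))) ∂(gaussPi (Fin m)) := fun i => by
    refine integral_mul_gaussPi i (fun x => ?_) (i0 i) (i1 i) (e0.add ((i2 i).const_mul t))
    simp only [Function.update_self]
    rcases eq_or_ne (euclNorm x) 0 with hx | hx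
    · have hxi : x i = 0 := by
        have := abs_le_euclNorm x i
        rw [hx] at this
        exact abs_eq_zero.1 (le_antisymm this (abs_nonneg _))
      have := hasDerivAt_id_mul (g := fun r => Real.exp (t * euclNorm (Function.update x i r)))
        (by fun_prop)
      rw [hxi]
      refine this.congr_deriv ?_
      have hu : Function.update x i 0 = x := by rw [← hxi, Function.update_eq_self]
      simp [hu, hx]
    · have h1 := ((hasDerivAt_euclNorm hx i).const_mul t).exp
      have h2 := (hasDerivAt_id (x i)).mul h1
      simp only [Function.update_eq_self] at h2
      refine h2.congr_deriv ?_
      simp only [id]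
      ring
  have s1 : normMoment m 2 t
      = ∑ i, ∫ x, x i * (x i * Real.exp (t * euclNorm x)) ∂(gaussPi (Fin m)) := by
    rw [← integral_finsetSum _ fun i _ => i1 i]
    refine integral_congr_ae (Filter.Eventually.of_forall fun x => ?_)
    simp only [sq_euclNorm, Finset.sum_mul]
    exact Finset.sum_congr rfl fun i _ => by ring
  rw [s1]
  simp_rw [stein]
  have i3 : ∀ i : Fin m, Integrable (fun x => Real.exp (t * euclNorm x)
      + t * (x i ^ 2 / euclNorm x * Real.exp (t * euclNorm x))) (gaussPi (Fin m)) := fun i =>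
    e0.add ((i2 i).const_mul t)
  rw [← integral_finsetSum _ fun i _ => i3 i, normMoment, normMoment,
    ← integral_const_mul, ← integral_const_mul, ← integral_add ((integrable_normMoment 0 t).const_mul _)
      ((integrable_normMoment 1 t).const_mul _)]
  refine integral_congr_ae (Filter.Eventually.of_forall fun x => ?_)
  simp only [Finset.sum_add_distrib, ← Finset.mul_sum, ← Finset.sum_mul, ← Finset.sum_div,
    ← sq_euclNorm, Finset.sum_const, Finset.card_univ, Fintype.card_fin, nsmul_eq_mul, pow_zero,
    one_mul, pow_one]
  rcases eq_or_ne (euclNorm x) 0 with hx | hx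
  · simp [hx]
  · field_simp

lemma normMoment_zero_zero : normMoment m 0 0 = 1 := by simp [normMoment]

lemma normMoment_neg_le (k : ℕ) {s : ℝ} (hs : 0 ≤ s) : normMoment m k (-s) ≤ normMoment m k 0 := by
  refine integral_mono (integrable_normMoment k _) (integrable_normMoment k _) fun x => ?_
  refine mul_le_mul_of_nonneg_left (Real.exp_le_exp.2 ?_) (pow_nonneg (euclNorm_nonneg x) k)
  have := mul_nonneg hs (euclNorm_nonneg x)
  linarith

lemma normMoment_nonneg (k : ℕ) (t : ℝ) : 0 ≤ normMoment m k t :=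
  integral_nonneg fun x => mul_nonneg (pow_nonneg (euclNorm_nonneg x) k) (Real.exp_pos _).le

/-- The function whose sign compares `s ↦ 𝔼 exp (-s‖g‖)` with `s ↦ exp (-a s + s² / 4)`: up to
positive factors it is the Wronskian of the two functions. -/
noncomputable def chiWronskian (m : ℕ) (a s : ℝ) : ℝ :=
  Real.exp (-(a * s) - s ^ 2 / 4) * ((s / 2 - a) * normMoment m 0 (-s) + normMoment m 1 (-s))

lemma hasDerivAt_normMoment_neg (k : ℕ) (s : ℝ) :
    HasDerivAt (fun s => normMoment m k (-s)) (-normMoment m (k + 1) (-s)) s := by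
  have := (hasDerivAt_normMoment (m := m) k (-s)).comp s (hasDerivAt_neg s)
  exact this.congr_deriv (by ring)

/-- The derivative has a sign exactly because `a² = m - 1/2`: all other terms cancel. -/
lemma hasDerivAt_chiWronskian {a : ℝ} (ha : a ^ 2 = m - 1 / 2) (s : ℝ) :
    HasDerivAt (chiWronskian m a)
      (-(s ^ 2 / 4 * Real.exp (-(a * s) - s ^ 2 / 4) * normMoment m 0 (-s))) s := by
  have h1 : HasDerivAt (fun s => -(a * s) - s ^ 2 / 4) (-a - s / 2) s :=
    ((((hasDerivAt_id s).const_mul a).neg).sub (((hasDerivAt_id s).pow 2).div_const 4)).congr_deriv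
      (by simp; ring)
  have h2 : HasDerivAt (fun s => s / 2 - a) (1 / 2) s :=
    ((hasDerivAt_id s).div_const 2).sub_const a
  have h3 := h1.exp.mul ((h2.mul (hasDerivAt_normMoment_neg (m := m) 0 s)).add
    (hasDerivAt_normMoment_neg (m := m) 1 s))
  refine h3.congr_deriv ?_
  have h4 := normMoment_two (m := m) (-s)
  simp only [zero_add, Nat.reduceAdd, Pi.add_apply, Pi.mul_apply, h4]
  have hm : (m : ℝ) = a ^ 2 + 1 / 2 := by linarith
  rw [hm]
  ring

/-- The Wronskian decreases and is bounded below by a function tending to `0` at infinity. -/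
lemma chiWronskian_nonneg {a : ℝ} (ha0 : 0 ≤ a) (ha : a ^ 2 = m - 1 / 2) (s : ℝ) :
    0 ≤ chiWronskian m a s := by
  have anti : Antitone (chiWronskian m a) :=
    antitone_of_hasDerivAt_nonpos (hasDerivAt_chiWronskian ha) fun s => neg_nonpos.2
      (mul_nonneg (by positivity) (normMoment_nonneg 0 _))
  have hlim : Filter.Tendsto (fun r : ℝ => -(a * Real.exp (-r))) Filter.atTop (nhds (-(a * 0))) :=
    ((Real.tendsto_exp_neg_atTop_nhds_zero).const_mul a).neg
  rw [mul_zero, neg_zero] at hlim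
  refine le_of_tendsto hlim ?_
  filter_upwards [Filter.eventually_ge_atTop (max s 4)] with r hr
  have hr4 : 4 ≤ r := (le_max_right _ _).trans hr
  refine le_trans ?_ (anti ((le_max_left _ _).trans hr))
  have h0 : 0 ≤ normMoment m 0 (-r) := normMoment_nonneg _ _
  have h1 : normMoment m 0 (-r) ≤ 1 := by
    rw [← normMoment_zero_zero (m := m)]; exact normMoment_neg_le 0 (by linarith)
  have h2 : 0 ≤ normMoment m 1 (-r) := normMoment_nonneg _ _
  have h3 : Real.exp (-(a * r) - r ^ 2 / 4) ≤ Real.exp (-r) :=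
    Real.exp_le_exp.2 (by nlinarith [mul_nonneg ha0 (by linarith : 0 ≤ r)])
  have h4 : -a ≤ (r / 2 - a) * normMoment m 0 (-r) + normMoment m 1 (-r) := by
    nlinarith [mul_nonneg (by linarith : 0 ≤ r) h0, mul_le_mul_of_nonneg_left h1 ha0]
  have h5 := mul_le_mul_of_nonneg_left h4 (Real.exp_pos (-(a * r) - r ^ 2 / 4)).le
  have h6 := mul_le_mul_of_nonneg_left h3 ha0
  unfold chiWronskian
  linarith

/-- The mean norm of a standard normal vector in `ℝᵐ` is at least `√(m - 1/2)`. -/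
lemma sqrt_le_normMoment {a : ℝ} (ha0 : 0 ≤ a) (ha : a ^ 2 = m - 1 / 2) :
    a ≤ normMoment m 1 0 := by
  have h := chiWronskian_nonneg ha0 ha 0
  simp only [chiWronskian, mul_zero, neg_zero, normMoment_zero_zero] at h
  norm_num at h
  exact h

/-- The norm of a standard normal vector has sub-Gaussian lower deviations with variance proxy
`1/2` around `√(m - 1/2)`. -/
lemma normMoment_zero_neg_le {a : ℝ} (ha0 : 0 ≤ a) (ha : a ^ 2 = m - 1 / 2) {s : ℝ}
    (hs : 0 ≤ s) : normMoment m 0 (-s) ≤ Real.exp (-(a * s) + s ^ 2 / 4) := by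
  have hd : ∀ s, HasDerivAt (fun s => Real.exp (a * s - s ^ 2 / 4) * normMoment m 0 (-s))
      (-(Real.exp (2 * (a * s)) * chiWronskian m a s)) s := fun s => by
    have h1 : HasDerivAt (fun s => a * s - s ^ 2 / 4) (a - s / 2) s :=
      (((hasDerivAt_id s).const_mul a).sub (((hasDerivAt_id s).pow 2).div_const 4)).congr_deriv
        (by simp; ring)
    refine (h1.exp.mul (hasDerivAt_normMoment_neg (m := m) 0 s)).congr_deriv ?_
    unfold chiWronskian
    rw [← mul_assoc, ← Real.exp_add]
    have : 2 * (a * s) + (-(a * s) - s ^ 2 / 4) = a * s - s ^ 2 / 4 := by ring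
    rw [this, zero_add]
    ring
  have anti : AntitoneOn (fun s => Real.exp (a * s - s ^ 2 / 4) * normMoment m 0 (-s))
      (Set.Ici 0) :=
    antitoneOn_of_hasDerivWithinAt_nonpos (convex_Ici _)
      (fun s _ => (hd s).continuousAt.continuousWithinAt) (fun s _ => (hd s).hasDerivWithinAt)
      fun s _ => neg_nonpos.2 (mul_nonneg (Real.exp_pos _).le (chiWronskian_nonneg ha0 ha s))
  have h := anti (Set.mem_Ici.2 le_rfl) (Set.mem_Ici.2 hs) hs
  simp only [mul_zero, neg_zero, normMoment_zero_zero, mul_one] at h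
  norm_num at h
  have e : -(a * s) + s ^ 2 / 4 = -(a * s - s ^ 2 / 4) := by ring
  rw [e, Real.exp_neg, ← one_div, le_div_iff₀ (Real.exp_pos _), mul_comm]
  exact h

end Chi

/-! ### The Gaussian tail of second order -/

/-- `𝔼 (u - t)₊²` for a standard normal variable `u`. -/
noncomputable def gaussTail (t : ℝ) : ℝ := ∫ u, (max (u - t) 0) ^ 2 ∂(gaussianReal 0 1)

lemma integrable_id_gaussianReal : Integrable (fun u : ℝ => u) (gaussianReal 0 1) :=
  (memLp_id_gaussianReal 1).integrable le_rfl

lemma integrable_sq_gaussianReal : Integrable (fun u : ℝ => u ^ 2) (gaussianReal 0 1) :=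
  (memLp_id_gaussianReal 2).integrable_sq

lemma integral_sq_gaussianReal : ∫ u : ℝ, u ^ 2 ∂(gaussianReal 0 1) = 1 := by
  have h1 := variance_fun_id_gaussianReal (μ := 0) (v := 1)
  rw [variance_of_integral_eq_zero (by fun_prop) integral_id_gaussianReal] at h1
  simpa using h1

lemma integrable_sub_sq_gaussianReal (b : ℝ) :
    Integrable (fun u : ℝ => (u - b) ^ 2) (gaussianReal 0 1) := by
  have : (fun u : ℝ => (u - b) ^ 2) = fun u => u ^ 2 - (2 * b) * u + b ^ 2 := by ext; ring
  rw [this]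
  exact (integrable_sq_gaussianReal.sub (integrable_id_gaussianReal.const_mul _)).add
    (integrable_const _)

lemma integral_sub_sq_gaussianReal (b : ℝ) :
    ∫ u : ℝ, (u - b) ^ 2 ∂(gaussianReal 0 1) = 1 + b ^ 2 := by
  have : (fun u : ℝ => (u - b) ^ 2) = fun u => (u ^ 2 - (2 * b) * u) + b ^ 2 := by ext; ring
  have hi : Integrable (fun u : ℝ => u ^ 2 - (2 * b) * u) (gaussianReal 0 1) :=
    integrable_sq_gaussianReal.sub (integrable_id_gaussianReal.const_mul _)
  rw [this, integral_add hi (integrable_const _), integral_sub integrable_sq_gaussianReal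
      (integrable_id_gaussianReal.const_mul _), integral_const_mul, integral_sq_gaussianReal,
      integral_id_gaussianReal]
  simp

lemma integrable_gaussTail (t : ℝ) :
    Integrable (fun u : ℝ => (max (u - t) 0) ^ 2) (gaussianReal 0 1) := by
  refine (integrable_sub_sq_gaussianReal t).mono' (Continuous.aestronglyMeasurable (by fun_prop))
    (Filter.Eventually.of_forall fun u => ?_)
  rw [Real.norm_eq_abs, abs_of_nonneg (sq_nonneg _)]
  rcases max_cases (u - t) 0 with ⟨h, _⟩ | ⟨h, _⟩ <;> rw [h]
  rw [zero_pow two_ne_zero]; exact sq_nonneg _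

lemma integrable_gaussTail_left (s : ℝ) :
    Integrable (fun u : ℝ => (max (s - u) 0) ^ 2) (gaussianReal 0 1) := by
  refine (integrable_sub_sq_gaussianReal s).mono' (Continuous.aestronglyMeasurable (by fun_prop))
    (Filter.Eventually.of_forall fun u => ?_)
  rw [Real.norm_eq_abs, abs_of_nonneg (sq_nonneg _)]
  rcases max_cases (s - u) 0 with ⟨h, _⟩ | ⟨h, _⟩ <;> rw [h]
  · exact (sub_sq_comm _ _).le
  · rw [zero_pow two_ne_zero]; exact sq_nonneg _

lemma integral_comp_neg_gaussianReal (f : ℝ → ℝ) :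
    ∫ u, f (-u) ∂(gaussianReal 0 1) = ∫ u, f u ∂(gaussianReal 0 1) := by
  have h := gaussianReal_map_neg (μ := 0) (v := 1)
  rw [neg_zero] at h
  conv_rhs => rw [← h]
  exact ((MeasurableEquiv.neg ℝ).measurableEmbedding.integral_map f).symm

lemma integral_gaussTail_left (t : ℝ) :
    ∫ u, (max (-t - u) 0) ^ 2 ∂(gaussianReal 0 1) = gaussTail t := by
  rw [gaussTail, ← integral_comp_neg_gaussianReal]
  congr 1; ext u; congr 2; ring

/-- The elementary tail bound `𝔼 (u - t)₊² ≤ exp (-t² / 2) / (√(2π) t)`. -/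
lemma gaussTail_le {t : ℝ} (ht : 0 < t) :
    gaussTail t ≤ Real.exp (-(t ^ 2 / 2)) / (Real.sqrt (2 * Real.pi) * t) := by
  have hp : 0 < Real.sqrt (2 * Real.pi) := Real.sqrt_pos.2 (by positivity)
  set K := (Real.sqrt (2 * Real.pi))⁻¹ * Real.exp (t ^ 2 / 2) with hK
  have hint : IntegrableOn (fun u => Real.exp (-t * u)) (Set.Ioi t) :=
    integrableOn_exp_mul_Ioi (by linarith) t
  have hval : ∫ u in Set.Ioi t, Real.exp (-t * u) = Real.exp (-t * t) / t := by
    rw [integral_exp_mul_Ioi (by linarith), neg_div_neg_eq]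
  have hle : ∀ u, gaussianPDFReal 0 1 u * (max (u - t) 0) ^ 2
      ≤ (Set.Ioi t).indicator (fun u => K * Real.exp (-t * u)) u := by
    intro u
    by_cases hu : u ∈ Set.Ioi t
    · rw [Set.indicator_of_mem hu, max_eq_left (by linarith [Set.mem_Ioi.1 hu]),
        gaussianPDFReal_def, hK]
      -- bounding the square by half of the Gaussian exponent leaves an exact exponential integral
      have h1 : (u - t) ^ 2 ≤ Real.exp ((u - t) ^ 2 / 2) := by
        have := Real.quadratic_le_exp_of_nonneg (x := (u - t) ^ 2 / 2) (by positivity)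
        nlinarith [sq_nonneg ((u - t) ^ 2 / 2 - 1)]
      have h2 : Real.exp (-(u - 0) ^ 2 / (2 * ((1 : ℝ≥0) : ℝ))) * Real.exp ((u - t) ^ 2 / 2)
          = Real.exp (t ^ 2 / 2) * Real.exp (-t * u) := by
        rw [← Real.exp_add, ← Real.exp_add]
        congr 1
        simp only [NNReal.coe_one]
        ring
      have h3 := mul_le_mul_of_nonneg_left h1
        (Real.exp_pos (-(u - 0) ^ 2 / (2 * ((1 : ℝ≥0) : ℝ)))).le
      rw [h2] at h3
      have h4 := mul_le_mul_of_nonneg_left h3 (inv_nonneg.2 hp.le)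
      simp only [NNReal.coe_one, mul_one] at h4 ⊢
      linarith
    · rw [Set.indicator_of_notMem hu, max_eq_right (by
        have h : ¬t < u := hu; linarith)]
      simp
  have h5 := integral_mono_of_nonneg (f := fun u => gaussianPDFReal 0 1 u * (max (u - t) 0) ^ 2)
    (Filter.Eventually.of_forall fun u => mul_nonneg (gaussianPDFReal_nonneg _ _ _) (sq_nonneg _))
    ((integrable_indicator_iff measurableSet_Ioi).2 (hint.const_mul K))
    (Filter.Eventually.of_forall hle)
  rw [integral_indicator measurableSet_Ioi, integral_const_mul, hval] at h5
  rw [gaussTail, integral_gaussianReal_eq_integral_smul one_ne_zero]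
  simp only [smul_eq_mul]
  refine h5.trans (le_of_eq ?_)
  rw [hK]
  have e : Real.exp (-t * t) = Real.exp (-(t ^ 2 / 2)) * (Real.exp (t ^ 2 / 2))⁻¹ := by
    rw [← Real.exp_neg, ← Real.exp_add]; congr 1; ring
  rw [e]
  have := Real.exp_pos (t ^ 2 / 2)
  field_simp

/-! ### The probability that a Gaussian matrix kills a unit vector of a given set -/

section Escape

variable {m n : ℕ}

lemma integral_norm_stdGaussian :
    ∫ g, ‖g‖ ∂(stdGaussian (EuclideanSpace ℝ (Fin m))) = normMoment m 1 0 := by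
  have mp := measurePreserving_toLp_gaussPi m
  rw [← mp.map_eq, integral_map mp.measurable.aemeasurable
    (Continuous.aestronglyMeasurable (by fun_prop))]
  simp [normMoment, euclNorm]

lemma integrable_sq_norm_stdGaussian :
    Integrable (fun g : EuclideanSpace ℝ (Fin m) => ‖g‖ ^ 2)
      (stdGaussian (EuclideanSpace ℝ (Fin m))) :=
  (IsGaussian.memLp_two_id (μ := stdGaussian (EuclideanSpace ℝ (Fin m)))).integrable_norm_pow
    two_ne_zero

lemma integral_sq_norm_stdGaussian :
    ∫ g, ‖g‖ ^ 2 ∂(stdGaussian (EuclideanSpace ℝ (Fin m))) = m := by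
  have mp := measurePreserving_toLp_gaussPi m
  have h := normMoment_two (m := m) 0
  rw [normMoment_zero_zero] at h
  rw [← mp.map_eq, integral_map mp.measurable.aemeasurable
    (Continuous.aestronglyMeasurable (by fun_prop))]
  simpa [normMoment, euclNorm] using h

lemma lintegral_exp_neg_norm_le {a s : ℝ} (ha0 : 0 ≤ a) (ha : a ^ 2 = m - 1 / 2) (hs : 0 ≤ s) :
    ∫⁻ g, ENNReal.ofReal (Real.exp (-s * ‖g‖)) ∂(stdGaussian (EuclideanSpace ℝ (Fin m)))
      ≤ ENNReal.ofReal (Real.exp (-(a * s) + s ^ 2 / 4)) := by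
  have mp := measurePreserving_toLp_gaussPi m
  rw [← mp.lintegral_comp (by fun_prop)]
  refine le_trans (le_of_eq ?_) (ENNReal.ofReal_le_ofReal (normMoment_zero_neg_le ha0 ha hs))
  rw [normMoment, ofReal_integral_eq_lintegral_ofReal (integrable_normMoment 0 _)
    (Filter.Eventually.of_forall fun x =>
      mul_nonneg (pow_nonneg (euclNorm_nonneg x) _) (Real.exp_pos _).le)]
  simp [euclNorm]

lemma lintegral_exp_neg_gaussianReal (s : ℝ) :
    ∫⁻ t, ENNReal.ofReal (Real.exp (-s * t)) ∂(gaussianReal 0 1)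
      = ENNReal.ofReal (Real.exp (s ^ 2 / 2)) := by
  rw [← ofReal_integral_eq_lintegral_ofReal (integrable_exp_mul_gaussianReal _)
    (Filter.Eventually.of_forall fun x => (Real.exp_pos _).le)]
  have := congrFun (mgf_fun_id_gaussianReal (μ := 0) (v := 1)) (-s)
  rw [mgf] at this
  rw [this]
  simp

lemma le_ofReal_div_of_mul_le {p : ENNReal} {c d : ℝ} (hd : 0 < d)
    (h : p * ENNReal.ofReal d ≤ ENNReal.ofReal c) : p ≤ ENNReal.ofReal (c / d) := by
  rw [ENNReal.ofReal_div_of_pos hd]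
  exact (ENNReal.le_div_iff_mul_le (Or.inl (ENNReal.ofReal_pos.2 hd).ne')
    (Or.inl ENNReal.ofReal_ne_top)).2 h

/-- The exponential bound for the probability that a Gaussian matrix kills one of the `u k`: the
test function is `t ↦ exp (-s t)`, whose mean `exp (s² / 2)` cancels the concentration factor of the
supremum and leaves `s² / 4` from the norm. -/
lemma measure_iInf_eq_zero_le_exp (u : ℕ → EuclideanSpace ℝ (Fin n)) (hu : ∀ k, ‖u k‖ = 1)
    {a s : ℝ} (ha0 : 0 ≤ a) (ha : a ^ 2 = m - 1 / 2) (hs : 0 ≤ s) :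
    gaussPi (Fin m × Fin n) {A | ⨅ k, ‖matVec A (u k)‖ = 0}
      ≤ ENNReal.ofReal (Real.exp (-(s * (a - ∫ h, (⨆ k, inner ℝ h (u k))
        ∂(stdGaussian (EuclideanSpace ℝ (Fin n))))) + s ^ 2 / 4)) := by
  set ω := ∫ h, (⨆ k, inner ℝ h (u k)) ∂(stdGaussian (EuclideanSpace ℝ (Fin n))) with hω
  have hm : Measurable fun h : EuclideanSpace ℝ (Fin n) => ⨆ k, inner ℝ h (u k) :=
    Measurable.iSup fun k => by fun_prop
  have hle : ∀ h k, inner ℝ h (u k) ≤ ⨆ k, inner ℝ h (u k) := fun h k =>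
    le_ciSup (f := fun k => inner ℝ h (u k)) ⟨‖h‖, by
      rintro _ ⟨k, rfl⟩
      have := real_inner_le_norm h (u k)
      rwa [hu, mul_one] at this⟩ k
  have h1 := measure_iInf_eq_zero_mul_le (m := m) u hu hm hle (ψ := fun t => Real.exp (-s * t))
    (fun x y hxy => Real.exp_le_exp.2 (by nlinarith)) (by fun_prop) (fun t => (Real.exp_pos _).le)
  rw [lintegral_exp_neg_gaussianReal] at h1
  have h2 : ∀ q : EuclideanSpace ℝ (Fin m) × EuclideanSpace ℝ (Fin n),
      ENNReal.ofReal (Real.exp (-s * (‖q.1‖ - ⨆ k, inner ℝ q.2 (u k))))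
      = ENNReal.ofReal (Real.exp (-s * ‖q.1‖)) *
        ENNReal.ofReal (Real.exp (s * ⨆ k, inner ℝ q.2 (u k))) := fun q => by
    rw [← ENNReal.ofReal_mul (Real.exp_pos _).le, ← Real.exp_add]
    congr 2; ring
  simp_rw [h2] at h1
  rw [lintegral_prod_mul
    (f := fun g : EuclideanSpace ℝ (Fin m) => ENNReal.ofReal (Real.exp (-s * ‖g‖)))
    (g := fun h : EuclideanSpace ℝ (Fin n) => ENNReal.ofReal (Real.exp (s * ⨆ k, inner ℝ h (u k))))
    (by fun_prop) (by fun_prop)] at h1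
  have h3 := h1.trans (mul_le_mul' (lintegral_exp_neg_norm_le ha0 ha hs)
    (lintegral_exp_iSup_le u hu hs))
  rw [← ENNReal.ofReal_mul (Real.exp_pos _).le, ← Real.exp_add] at h3
  have h4 := le_ofReal_div_of_mul_le (Real.exp_pos _) h3
  rw [← Real.exp_sub] at h4
  refine h4.trans (le_of_eq ?_)
  congr 2
  ring

/-- The second-moment bound for the probability that a Gaussian matrix kills one of the `u k`: the
test function is `t ↦ (√m - t)₊²`. It serves when the Gaussian width is within `O(1 / √m)` of `√m`,
where the exponential bound loses. -/
lemma measure_iInf_eq_zero_le_div (u : ℕ → EuclideanSpace ℝ (Fin n)) (hu : ∀ k, ‖u k‖ = 1)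
    (hm3 : 3 ≤ m) {Z : EuclideanSpace ℝ (Fin n) → ℝ} (hZm : Measurable Z)
    (hZi : Integrable Z (stdGaussian (EuclideanSpace ℝ (Fin n))))
    (hZ2 : Integrable (fun h => Z h ^ 2) (stdGaussian (EuclideanSpace ℝ (Fin n))))
    (hZ : ∀ h k, inner ℝ h (u k) ≤ Z h)
    (hδ : ∫ h, Z h ^ 2 ∂(stdGaussian (EuclideanSpace ℝ (Fin n))) ≤ m - 1)
    {a : ℝ} (ha0 : 0 ≤ a) (ha : a ^ 2 = m - 1 / 2) :
    gaussPi (Fin m × Fin n) {A | ⨅ k, ‖matVec A (u k)‖ = 0}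
      ≤ ENNReal.ofReal (m / (m + 3 / 4)) := by
  have hm3' : (3 : ℝ) ≤ m := by exact_mod_cast hm3
  set b := Real.sqrt m with hb
  have hb2 : b ^ 2 = m := Real.sq_sqrt (by positivity)
  have hb1 : 1 ≤ b := Real.one_le_sqrt.2 (by linarith)
  set μ := stdGaussian (EuclideanSpace ℝ (Fin m)) with hμ
  set ν := stdGaussian (EuclideanSpace ℝ (Fin n)) with hν
  have h1 := measure_iInf_eq_zero_mul_le (m := m) u hu hZm hZ (ψ := fun t => (max (b - t) 0) ^ 2)
    (fun x y hxy => pow_le_pow_left₀ (le_max_right _ _) (max_le_max (by linarith) le_rfl) 2)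
    (by fun_prop) (fun t => sq_nonneg _)
  have hden : (m : ℝ) + 3 / 4 ≤ ∫ t, (max (b - t) 0) ^ 2 ∂(gaussianReal 0 1) := by
    have e1 : ∀ t : ℝ, (max (b - t) 0) ^ 2 = (t - b) ^ 2 - (max (t - b) 0) ^ 2 := fun t => by
      rcases le_total t b with h | h
      · rw [max_eq_left (by linarith), max_eq_right (by linarith)]; ring
      · rw [max_eq_right (by linarith), max_eq_left (by linarith)]; ring
    simp_rw [e1]
    rw [integral_sub (integrable_sub_sq_gaussianReal b) (integrable_gaussTail b),
      integral_sub_sq_gaussianReal, hb2]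
    have t1 := gaussTail_le (t := b) (by linarith)
    have t2 : Real.exp (-(b ^ 2 / 2)) / (Real.sqrt (2 * Real.pi) * b) ≤ 1 / 4 := by
      have p1 : 2 ≤ Real.sqrt (2 * Real.pi) :=
        Real.le_sqrt_of_sq_le (by linarith [Real.pi_gt_three])
      have p2 : Real.exp (-(b ^ 2 / 2)) ≤ 1 / 2 := by
        rw [hb2, Real.exp_neg, inv_eq_one_div]
        exact one_div_le_one_div_of_le (by norm_num) (by
          have := Real.add_one_le_exp ((m : ℝ) / 2); linarith)
      rw [div_le_iff₀ (by positivity)]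
      nlinarith
    unfold gaussTail at t1
    linarith
  have hden2 : ∫⁻ t, ENNReal.ofReal ((max (b - t) 0) ^ 2) ∂(gaussianReal 0 1)
      = ENNReal.ofReal (∫ t, (max (b - t) 0) ^ 2 ∂(gaussianReal 0 1)) :=
    (ofReal_integral_eq_lintegral_ofReal (integrable_gaussTail_left b)
      (Filter.Eventually.of_forall fun _ => sq_nonneg _)).symm
  have hgi : Integrable (fun g : EuclideanSpace ℝ (Fin m) => ‖g‖) μ := integrable_norm_stdGaussian m
  have hg2 : Integrable (fun g : EuclideanSpace ℝ (Fin m) => ‖g‖ ^ 2) μ :=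
    integrable_sq_norm_stdGaussian
  have i1 : Integrable (fun g : EuclideanSpace ℝ (Fin m) => (b - ‖g‖) ^ 2) μ := by
    have : (fun g : EuclideanSpace ℝ (Fin m) => (b - ‖g‖) ^ 2)
        = fun g => (b ^ 2 - 2 * b * ‖g‖) + ‖g‖ ^ 2 := by ext; ring
    rw [this]
    exact ((integrable_const _).sub (hgi.const_mul _)).add hg2
  have v1 : ∫ g, (b - ‖g‖) ^ 2 ∂μ = 2 * m - 2 * b * normMoment m 1 0 := by
    have : (fun g : EuclideanSpace ℝ (Fin m) => (b - ‖g‖) ^ 2)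
        = fun g => (b ^ 2 - 2 * b * ‖g‖) + ‖g‖ ^ 2 := by ext; ring
    have hi : Integrable (fun g : EuclideanSpace ℝ (Fin m) => b ^ 2 - 2 * b * ‖g‖) μ :=
      (integrable_const _).sub (hgi.const_mul _)
    rw [this, integral_add hi hg2, integral_sub (integrable_const _) (hgi.const_mul _),
      integral_const_mul, integral_norm_stdGaussian, integral_sq_norm_stdGaussian, hb2]
    simp
    ring
  have i2 : Integrable (fun g : EuclideanSpace ℝ (Fin m) => b - ‖g‖) μ :=
    (integrable_const _).sub hgi
  have v2 : ∫ g, (b - ‖g‖) ∂μ = b - normMoment m 1 0 := by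
    rw [integral_sub (integrable_const _) hgi, integral_norm_stdGaussian]
    simp
  set τ := ∫ h, Z h ∂ν with hτ
  set δ := ∫ h, Z h ^ 2 ∂ν with hδ'
  have hsplit : ∀ q : EuclideanSpace ℝ (Fin m) × EuclideanSpace ℝ (Fin n),
      (b - ‖q.1‖ + Z q.2) ^ 2 = ((b - ‖q.1‖) ^ 2 * 1 + 2 * ((b - ‖q.1‖) * Z q.2)) + 1 * Z q.2 ^ 2 :=
    fun q => by ring
  have j1 : Integrable (fun q : EuclideanSpace ℝ (Fin m) × EuclideanSpace ℝ (Fin n) =>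
      (b - ‖q.1‖) ^ 2 * (1 : ℝ)) (μ.prod ν) := i1.mul_prod (integrable_const (1 : ℝ))
  have j2 : Integrable (fun q : EuclideanSpace ℝ (Fin m) × EuclideanSpace ℝ (Fin n) =>
      2 * ((b - ‖q.1‖) * Z q.2)) (μ.prod ν) := (i2.mul_prod hZi).const_mul 2
  have j3 : Integrable (fun q : EuclideanSpace ℝ (Fin m) × EuclideanSpace ℝ (Fin n) =>
      1 * Z q.2 ^ 2) (μ.prod ν) := (integrable_const (1 : ℝ)).mul_prod hZ2
  have j12 : Integrable (fun q : EuclideanSpace ℝ (Fin m) × EuclideanSpace ℝ (Fin n) =>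
      (b - ‖q.1‖) ^ 2 * (1 : ℝ) + 2 * ((b - ‖q.1‖) * Z q.2)) (μ.prod ν) := j1.add j2
  have hval : ∫ q, (b - ‖q.1‖ + Z q.2) ^ 2 ∂(μ.prod ν)
      = 2 * m - 2 * b * normMoment m 1 0 + 2 * ((b - normMoment m 1 0) * τ) + δ := by
    simp_rw [hsplit]
    rw [integral_add j12 j3, integral_add j1 j2, integral_const_mul,
      integral_prod_mul (fun g : EuclideanSpace ℝ (Fin m) => (b - ‖g‖) ^ 2)
        (fun _ : EuclideanSpace ℝ (Fin n) => (1 : ℝ)),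
      integral_prod_mul (fun g : EuclideanSpace ℝ (Fin m) => b - ‖g‖) Z,
      integral_prod_mul (fun _ : EuclideanSpace ℝ (Fin m) => (1 : ℝ)) (fun h => Z h ^ 2), v1, v2]
    simp [hτ, hδ']
  have hint : Integrable (fun q : EuclideanSpace ℝ (Fin m) × EuclideanSpace ℝ (Fin n) =>
      (b - ‖q.1‖ + Z q.2) ^ 2) (μ.prod ν) := by
    simp_rw [hsplit]
    exact j12.add j3
  have hnum : ∫⁻ q, ENNReal.ofReal ((max (b - (‖q.1‖ - Z q.2)) 0) ^ 2) ∂(μ.prod ν)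
      ≤ ENNReal.ofReal m := by
    have s1 : ∫⁻ q, ENNReal.ofReal ((max (b - (‖q.1‖ - Z q.2)) 0) ^ 2) ∂(μ.prod ν)
        ≤ ∫⁻ q, ENNReal.ofReal ((b - ‖q.1‖ + Z q.2) ^ 2) ∂(μ.prod ν) := by
      refine lintegral_mono fun q => ENNReal.ofReal_le_ofReal ?_
      rcases max_cases (b - (‖q.1‖ - Z q.2)) 0 with ⟨h, _⟩ | ⟨h, _⟩ <;> rw [h]
      · exact le_of_eq (by ring)
      · rw [zero_pow two_ne_zero]; exact sq_nonneg _
    refine s1.trans ?_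
    rw [← ofReal_integral_eq_lintegral_ofReal hint (Filter.Eventually.of_forall fun _ =>
      sq_nonneg _), hval]
    refine ENNReal.ofReal_le_ofReal ?_
    have hτδ : τ ^ 2 ≤ δ := by
      have := variance_nonneg Z ν
      have hL : MemLp Z 2 ν := (memLp_two_iff_integrable_sq hZm.aestronglyMeasurable).2 hZ2
      rw [variance_eq_sub hL] at this
      simp only [Pi.pow_apply] at this
      linarith
    have hτa : τ ≤ a := abs_le_of_sq_le_sq' (by linarith) ha0 |>.2
    have hlow := sqrt_le_normMoment ha0 ha
    have hupp : normMoment m 1 0 ≤ b := by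
      have := variance_nonneg (fun g : EuclideanSpace ℝ (Fin m) => ‖g‖) μ
      have hL : MemLp (fun g : EuclideanSpace ℝ (Fin m) => ‖g‖) 2 μ :=
        (memLp_two_iff_integrable_sq (Continuous.aestronglyMeasurable (by fun_prop))).2 hg2
      rw [variance_eq_sub hL] at this
      simp only [Pi.pow_apply] at this
      rw [integral_norm_stdGaussian, integral_sq_norm_stdGaussian] at this
      exact abs_le_of_sq_le_sq' (by linarith) (by linarith) |>.2
    -- `(√m - a) (√m + a) = 1/2` turns the first two terms into exactly one
    have k1 : (b - normMoment m 1 0) * τ ≤ (b - a) * a :=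
      (mul_le_mul_of_nonneg_left hτa (by linarith)).trans
        (mul_le_mul_of_nonneg_right (by linarith) ha0)
    have k2 : b * a ≤ b * normMoment m 1 0 := mul_le_mul_of_nonneg_left hlow (by linarith)
    nlinarith
  rw [hden2] at h1
  exact le_ofReal_div_of_mul_le (by positivity)
    ((mul_le_mul_right (ENNReal.ofReal_le_ofReal hden) _).trans (h1.trans hnum))

end Escape

/-! ### Escape through a mesh -/

section UnitSets

variable {m n : ℕ}

lemma inner_le_norm_of_mem_sphere {u : EuclideanSpace ℝ (Fin n)} (hu : u ∈ Metric.sphere 0 1)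
    (h : EuclideanSpace ℝ (Fin n)) : inner ℝ h u ≤ ‖h‖ := by
  have := real_inner_le_norm h u
  rwa [mem_sphere_zero_iff_norm.1 hu, mul_one] at this

lemma bddAbove_inner_image {C : Set (EuclideanSpace ℝ (Fin n))} (hC : C ⊆ Metric.sphere 0 1)
    (h : EuclideanSpace ℝ (Fin n)) : BddAbove ((fun u => inner ℝ h u) '' C) :=
  ⟨‖h‖, by rintro _ ⟨u, hu, rfl⟩; exact inner_le_norm_of_mem_sphere (hC hu) h⟩

/-- The supremum defining the Gaussian width is attained along one sequence, whatever `h`. -/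
lemma exists_seq_sSup_inner_eq {C : Set (EuclideanSpace ℝ (Fin n))} (hne : C.Nonempty)
    (hC : C ⊆ Metric.sphere 0 1) :
    ∃ u : ℕ → EuclideanSpace ℝ (Fin n), (∀ k, u k ∈ C) ∧ C ⊆ closure (Set.range u) ∧
      ∀ h, sSup ((fun u => inner ℝ h u) '' C) = ⨆ k, inner ℝ h (u k) := by
  have : Nonempty C := hne.to_subtype
  have hcl : C ⊆ closure (Set.range fun k => (TopologicalSpace.denseSeq C k : EuclideanSpace ℝ (Fin n))) := by
    intro c hc
    have h1 := TopologicalSpace.denseRange_denseSeq C ⟨c, hc⟩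
    have h2 := image_closure_subset_closure_image continuous_subtype_val ⟨_, h1, rfl⟩
    rwa [← Set.range_comp] at h2
  refine ⟨fun k => TopologicalSpace.denseSeq C k, fun k => Subtype.coe_prop _, hcl, fun h => ?_⟩
  have hb : BddAbove (Set.range fun k => inner ℝ h (TopologicalSpace.denseSeq C k :
      EuclideanSpace ℝ (Fin n))) := by
    refine (bddAbove_inner_image hC h).mono ?_
    rintro _ ⟨k, rfl⟩
    exact ⟨_, Subtype.coe_prop _, rfl⟩
  refine le_antisymm (csSup_le (hne.image _) ?_) (ciSup_le fun k =>
    le_csSup (bddAbove_inner_image hC h) ⟨_, Subtype.coe_prop _, rfl⟩)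
  rintro _ ⟨c, hc, rfl⟩
  have hclosed : IsClosed {v : EuclideanSpace ℝ (Fin n) | inner ℝ h v ≤
      ⨆ k, inner ℝ h (TopologicalSpace.denseSeq C k : EuclideanSpace ℝ (Fin n))} :=
    isClosed_le (by fun_prop) continuous_const
  refine closure_minimal ?_ hclosed (hcl hc)
  rintro _ ⟨k, rfl⟩
  exact le_ciSup hb k

lemma iInf_norm_matVec_eq_zero {C : Set (EuclideanSpace ℝ (Fin n))}
    {u : ℕ → EuclideanSpace ℝ (Fin n)} (hcl : C ⊆ closure (Set.range u))
    {A : Fin m × Fin n → ℝ} {c : EuclideanSpace ℝ (Fin n)} (hc : c ∈ C) (hA : matVec A c = 0) :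
    ⨅ k, ‖matVec A (u k)‖ = 0 := by
  refine le_antisymm ?_ (Real.iInf_nonneg fun k => norm_nonneg _)
  have hclosed : IsClosed {v : EuclideanSpace ℝ (Fin n) | ⨅ k, ‖matVec A (u k)‖ ≤ ‖matVec A v‖} :=
    isClosed_le continuous_const (by unfold matVec; fun_prop)
  have : c ∈ {v : EuclideanSpace ℝ (Fin n) | ⨅ k, ‖matVec A (u k)‖ ≤ ‖matVec A v‖} := by
    refine closure_minimal ?_ hclosed (hcl hc)
    rintro _ ⟨k, rfl⟩
    refine ciInf_le (f := fun k => ‖matVec A (u k)‖) ⟨0, ?_⟩ k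
    rintro _ ⟨k, rfl⟩
    exact norm_nonneg _
  have h2 : ⨅ k, ‖matVec A (u k)‖ ≤ ‖matVec A c‖ := this
  rwa [hA, norm_zero] at h2

lemma measurable_sSup_inner {C : Set (EuclideanSpace ℝ (Fin n))} (hC : C ⊆ Metric.sphere 0 1) :
    Measurable fun h : EuclideanSpace ℝ (Fin n) => sSup ((fun u => inner ℝ h u) '' C) := by
  rcases C.eq_empty_or_nonempty with rfl | hne
  · simp
  obtain ⟨u, -, -, hs⟩ := exists_seq_sSup_inner_eq hne hC
  simp_rw [hs]
  exact Measurable.iSup fun k => by fun_prop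

lemma abs_sSup_inner_le {C : Set (EuclideanSpace ℝ (Fin n))} (hC : C ⊆ Metric.sphere 0 1)
    (h : EuclideanSpace ℝ (Fin n)) : |sSup ((fun u => inner ℝ h u) '' C)| ≤ ‖h‖ := by
  rcases C.eq_empty_or_nonempty with rfl | hne
  · simp
  obtain ⟨c, hc⟩ := hne
  refine abs_le.2 ⟨?_, csSup_le (Set.Nonempty.image _ ⟨c, hc⟩) ?_⟩
  · refine le_trans ?_ (le_csSup (bddAbove_inner_image hC h) ⟨c, hc, rfl⟩)
    have := inner_le_norm_of_mem_sphere (hC hc) (-h)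
    rw [inner_neg_left, norm_neg] at this
    simp only
    linarith
  · rintro _ ⟨u, hu, rfl⟩
    exact inner_le_norm_of_mem_sphere (hC hu) h

lemma integrable_sSup_inner {C : Set (EuclideanSpace ℝ (Fin n))} (hC : C ⊆ Metric.sphere 0 1) :
    Integrable (fun h : EuclideanSpace ℝ (Fin n) => sSup ((fun u => inner ℝ h u) '' C))
      (stdGaussian (EuclideanSpace ℝ (Fin n))) :=
  (integrable_norm_stdGaussian n).mono' (measurable_sSup_inner hC).aestronglyMeasurable
    (Filter.Eventually.of_forall fun h => abs_sSup_inner_le hC h)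

lemma integral_sSup_inner_nonneg {C : Set (EuclideanSpace ℝ (Fin n))}
    (hC : C ⊆ Metric.sphere 0 1) :
    0 ≤ ∫ h, sSup ((fun u => inner ℝ h u) '' C) ∂(stdGaussian (EuclideanSpace ℝ (Fin n))) := by
  rcases C.eq_empty_or_nonempty with rfl | ⟨c, hc⟩
  · simp
  have hi : Integrable (fun h : EuclideanSpace ℝ (Fin n) => inner ℝ h c)
      (stdGaussian (EuclideanSpace ℝ (Fin n))) :=
    (integrable_norm_stdGaussian n).mono' (Continuous.aestronglyMeasurable (by fun_prop))
      (Filter.Eventually.of_forall fun h => by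
        have := abs_real_inner_le_norm h c
        rwa [mem_sphere_zero_iff_norm.1 (hC hc), mul_one] at this)
  have h0 : ∫ h, inner ℝ h c ∂(stdGaussian (EuclideanSpace ℝ (Fin n))) = 0 := by
    simp_rw [real_inner_comm]
    exact integral_strongDual_stdGaussian (innerSL ℝ c)
  rw [← h0]
  exact integral_mono hi (integrable_sSup_inner hC) fun h =>
    le_csSup (bddAbove_inner_image hC h) ⟨c, hc, rfl⟩

lemma sq_integral_le_integral_sq {Z : EuclideanSpace ℝ (Fin n) → ℝ} (hZm : Measurable Z)
    (hZ2 : Integrable (fun h => Z h ^ 2) (stdGaussian (EuclideanSpace ℝ (Fin n)))) :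
    (∫ h, Z h ∂(stdGaussian (EuclideanSpace ℝ (Fin n)))) ^ 2
      ≤ ∫ h, Z h ^ 2 ∂(stdGaussian (EuclideanSpace ℝ (Fin n))) := by
  have := variance_nonneg Z (stdGaussian (EuclideanSpace ℝ (Fin n)))
  rw [variance_eq_sub ((memLp_two_iff_integrable_sq hZm.aestronglyMeasurable).2 hZ2)] at this
  simp only [Pi.pow_apply] at this
  linarith

/-- Escape through a mesh, with the sharp constant: if `Z` dominates every `⟨h, u⟩`, `u ∈ C`, and
`𝔼 Z² ≤ m - 1`, the probability that a standard Gaussian `m × n` matrix kills a vector of `C` is at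
most `exp (-(√m - ω)² / 2)`, with `ω` the Gaussian width of `C`.

The estimate holds with `√m` rather than the smaller mean norm of a Gaussian vector in `ℝᵐ`. It comes
from the exponential bound at `s = √m - ω`, unless `ω` is so close to `√m` that the second-moment
bound suffices. The event itself is only claimed to lie in a measurable set of small measure. -/
theorem measure_exists_matVec_eq_zero_le {C : Set (EuclideanSpace ℝ (Fin n))} (hne : C.Nonempty)
    (hC : C ⊆ Metric.sphere 0 1) (hm3 : 3 ≤ m) {Z : EuclideanSpace ℝ (Fin n) → ℝ}
    (hZm : Measurable Z) (hZi : Integrable Z (stdGaussian (EuclideanSpace ℝ (Fin n))))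
    (hZ2 : Integrable (fun h => Z h ^ 2) (stdGaussian (EuclideanSpace ℝ (Fin n))))
    (hZ : ∀ h, ∀ u ∈ C, inner ℝ h u ≤ Z h)
    (hδ : ∫ h, Z h ^ 2 ∂(stdGaussian (EuclideanSpace ℝ (Fin n))) ≤ m - 1) :
    ∃ S : Set (Fin m × Fin n → ℝ), MeasurableSet S ∧ {A | ∃ u ∈ C, matVec A u = 0} ⊆ S ∧
      gaussPi (Fin m × Fin n) S ≤ ENNReal.ofReal (Real.exp (-(1 / 2) * (Real.sqrt m -
        ∫ h, sSup ((fun u => inner ℝ h u) '' C) ∂(stdGaussian (EuclideanSpace ℝ (Fin n)))) ^ 2)) := by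
  obtain ⟨u, huC, hcl, hs⟩ := exists_seq_sSup_inner_eq hne hC
  have hu1 : ∀ k, ‖u k‖ = 1 := fun k => mem_sphere_zero_iff_norm.1 (hC (huC k))
  have hm3' : (3 : ℝ) ≤ m := by exact_mod_cast hm3
  refine ⟨{A | ⨅ k, ‖matVec A (u k)‖ = 0}, ?_, ?_, ?_⟩
  · exact (Measurable.iInf fun k => (continuous_matVec (u k)).norm.measurable)
      (measurableSet_singleton 0)
  · rintro A ⟨c, hc, hA⟩
    exact iInf_norm_matVec_eq_zero hcl hc hA
  set ω := ∫ h, sSup ((fun u => inner ℝ h u) '' C) ∂(stdGaussian (EuclideanSpace ℝ (Fin n))) with hω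
  have hω' : ω = ∫ h, (⨆ k, inner ℝ h (u k)) ∂(stdGaussian (EuclideanSpace ℝ (Fin n))) := by
    simp_rw [hω, hs]
  set b := Real.sqrt m with hb
  set a := Real.sqrt (m - 1 / 2) with ha
  have hb2 : b ^ 2 = m := Real.sq_sqrt (by positivity)
  have ha2 : a ^ 2 = m - 1 / 2 := Real.sq_sqrt (by linarith)
  have ha0 : 0 ≤ a := Real.sqrt_nonneg _
  have hb0 : 0 ≤ b := Real.sqrt_nonneg _
  have hab : a ≤ b := Real.sqrt_le_sqrt (by linarith)
  have hωa : ω ≤ a := by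
    have h1 : ω ≤ ∫ h, Z h ∂(stdGaussian (EuclideanSpace ℝ (Fin n))) :=
      integral_mono (integrable_sSup_inner hC) hZi fun h => csSup_le (hne.image _) (by
        rintro _ ⟨v, hv, rfl⟩; exact hZ h v hv)
    refine h1.trans (abs_le_of_sq_le_sq' ?_ ha0).2
    linarith [sq_integral_le_integral_sq hZm hZ2]
  -- the exponent `-s (a - ω) + s² / 4` at `s = b - ω` is at most `-s² / 2` iff `a - ω ≥ 3 s / 4`
  by_cases hcase : ω ≤ 4 * a - 3 * b
  · refine (measure_iInf_eq_zero_le_exp u hu1 ha0 ha2 (s := b - ω) (by linarith)).trans ?_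
    rw [← hω']
    refine ENNReal.ofReal_le_ofReal (Real.exp_le_exp.2 ?_)
    nlinarith
  · refine (measure_iInf_eq_zero_le_div u hu1 hm3 hZm hZi hZ2 (fun h k => hZ h _ (huC k)) hδ ha0
      ha2).trans (ENNReal.ofReal_le_ofReal ?_)
    have h1 : (b - ω) ^ 2 ≤ 16 * (b - a) ^ 2 := by
      have : b - ω ≤ 4 * (b - a) := by linarith
      nlinarith
    have h2 : (b - a) ^ 2 * (4 * m - 3 / 2) ≤ 1 / 4 := by
      have e : ((b - a) * (b + a)) ^ 2 = 1 / 4 := by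
        have : (b - a) * (b + a) = 1 / 2 := by linear_combination hb2 - ha2
        rw [this]; norm_num
      rw [mul_pow] at e
      rw [← e]
      exact mul_le_mul_of_nonneg_left (by nlinarith) (sq_nonneg _)
    have h3 : 8 * (b - a) ^ 2 * (m + 3 / 4) ≤ 3 / 4 := by
      nlinarith [sq_nonneg (b - a)]
    have h4 := Real.add_one_le_exp (-(1 / 2) * (b - ω) ^ 2)
    rw [div_le_iff₀ (by positivity)]
    have h5 : 1 - 8 * (b - a) ^ 2 ≤ Real.exp (-(1 / 2) * (b - ω) ^ 2) := by linarith
    nlinarith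

end UnitSets

/-! ### Cones: width, statistical dimension and the subdifferential -/

section Cones

variable {n : ℕ}

lemma zero_mem_polarCone (D : Set (EuclideanSpace ℝ (Fin n))) : 0 ∈ polarCone D := fun y _ => by
  simp

lemma inner_le_infDist_polarCone {D : Set (EuclideanSpace ℝ (Fin n))}
    {u : EuclideanSpace ℝ (Fin n)} (hu : u ∈ D ∩ Metric.sphere 0 1)
    (h : EuclideanSpace ℝ (Fin n)) : inner ℝ h u ≤ Metric.infDist h (polarCone D) := by
  rw [Metric.le_infDist ⟨0, zero_mem_polarCone D⟩]
  intro w hw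
  have h1 := inner_le_norm_of_mem_sphere hu.2 (h - w)
  have h2 := hw u hu.1
  rw [inner_sub_left] at h1
  rw [dist_eq_norm]
  linarith

lemma integrable_infDist_sq {S : Set (EuclideanSpace ℝ (Fin n))} (hS : S.Nonempty) :
    Integrable (fun h => Metric.infDist h S ^ 2) (stdGaussian (EuclideanSpace ℝ (Fin n))) := by
  obtain ⟨w, hw⟩ := hS
  have hi : Integrable (fun h : EuclideanSpace ℝ (Fin n) => 2 * ‖h‖ ^ 2 + 2 * ‖w‖ ^ 2)
      (stdGaussian (EuclideanSpace ℝ (Fin n))) :=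
    (integrable_sq_norm_stdGaussian.const_mul 2).add (integrable_const _)
  refine hi.mono' (Continuous.aestronglyMeasurable
    ((Metric.continuous_infDist_pt S).pow 2)) (Filter.Eventually.of_forall fun h => ?_)
  rw [Real.norm_eq_abs, abs_of_nonneg (sq_nonneg _)]
  have h1 : Metric.infDist h S ≤ ‖h‖ + ‖w‖ :=
    (Metric.infDist_le_dist_of_mem hw).trans (by rw [dist_eq_norm]; exact norm_sub_le _ _)
  have h2 := pow_le_pow_left₀ Metric.infDist_nonneg h1 2
  nlinarith [sq_nonneg (‖h‖ - ‖w‖)]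

lemma integrable_infDist {S : Set (EuclideanSpace ℝ (Fin n))} (hS : S.Nonempty) :
    Integrable (fun h => Metric.infDist h S) (stdGaussian (EuclideanSpace ℝ (Fin n))) :=
  ((memLp_two_iff_integrable_sq (Metric.continuous_infDist_pt S).aestronglyMeasurable).2
    (integrable_infDist_sq hS)).integrable one_le_two

theorem gaussianWidth_sq_le_statDim (D : Set (EuclideanSpace ℝ (Fin n))) :
    gaussianWidth D ^ 2 ≤ statDim D := by
  have hC : D ∩ Metric.sphere (0 : EuclideanSpace ℝ (Fin n)) 1 ⊆ Metric.sphere 0 1 :=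
    Set.inter_subset_right
  have hP : (polarCone D).Nonempty := ⟨0, zero_mem_polarCone D⟩
  refine le_trans (pow_le_pow_left₀ (integral_sSup_inner_nonneg hC)
    (integral_mono (integrable_sSup_inner hC) (integrable_infDist hP) fun h => ?_) 2)
    (sq_integral_le_integral_sq (Metric.continuous_infDist_pt _).measurable
      (integrable_infDist_sq hP))
  refine Real.sSup_le ?_ Metric.infDist_nonneg
  rintro _ ⟨u, hu, rfl⟩
  exact inner_le_infDist_polarCone hu h

lemma smul_subdifferential_subset_polarCone (g : EuclideanSpace ℝ (Fin n) → ℝ)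
    (x : EuclideanSpace ℝ (Fin n)) {τ : ℝ} (hτ : 0 ≤ τ) :
    (fun u => τ • u) '' subdifferential g x ⊆ polarCone (descentCone g x) := by
  rintro _ ⟨u, hu, rfl⟩ y ⟨t, ht, hy⟩
  have h1 := hu (x + t • y)
  rw [add_sub_cancel_left, inner_smul_right] at h1
  have h2 : inner ℝ u y ≤ 0 := by
    by_contra h
    push Not at h
    nlinarith [mul_pos ht h]
  simp only [inner_smul_left]
  exact mul_nonpos_of_nonneg_of_nonpos hτ h2

/-- Nonemptiness matters: the distance to the empty set is `0` by convention. -/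
theorem statDim_le_subdiffBound (g : EuclideanSpace ℝ (Fin n) → ℝ)
    (x : EuclideanSpace ℝ (Fin n)) (hne : (subdifferential g x).Nonempty) :
    statDim (descentCone g x) ≤ subdiffBound g x := by
  refine le_ciInf fun τ => ?_
  refine integral_mono (integrable_infDist_sq ⟨0, zero_mem_polarCone _⟩)
    (integrable_infDist_sq (hne.image _)) fun h => ?_
  exact pow_le_pow_left₀ Metric.infDist_nonneg (Metric.infDist_le_infDist_of_subset
    (smul_subdifferential_subset_polarCone g x τ.2) (hne.image _)) 2

/-- Distances to `τ ∂g(x)` may be estimated with any measurable choice of a point of it. -/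
lemma subdiffBound_le (g : EuclideanSpace ℝ (Fin n) → ℝ) (x : EuclideanSpace ℝ (Fin n))
    {τ : ℝ} (hτ : 0 ≤ τ) {F : EuclideanSpace ℝ (Fin n) → ℝ}
    (hF : Integrable F (stdGaussian (EuclideanSpace ℝ (Fin n))))
    (hle : ∀ h, ∃ u ∈ subdifferential g x, ‖h - τ • u‖ ^ 2 ≤ F h) :
    subdiffBound g x ≤ ∫ h, F h ∂(stdGaussian (EuclideanSpace ℝ (Fin n))) := by
  have hne : (subdifferential g x).Nonempty := let ⟨u, hu, _⟩ := hle 0; ⟨u, hu⟩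
  refine (ciInf_le ⟨0, ?_⟩ (⟨τ, hτ⟩ : Set.Ici (0 : ℝ))).trans ?_
  · rintro _ ⟨t, rfl⟩
    exact integral_nonneg fun h => sq_nonneg _
  refine integral_mono (integrable_infDist_sq (hne.image _)) hF fun h => ?_
  obtain ⟨u, hu, hle⟩ := hle h
  have h1 := Metric.infDist_le_dist_of_mem (x := h)
    (Set.mem_image_of_mem (fun u : EuclideanSpace ℝ (Fin n) => τ • u) hu)
  rw [dist_eq_norm] at h1
  exact (pow_le_pow_left₀ Metric.infDist_nonneg h1 2).trans hle

end Cones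

/-! ### Failure of recovery and the kernel of the measurement matrix -/

section Recovery

variable {m n : ℕ} {Ω : Type*} [MeasurableSpace Ω]

/-- Dividing by the standard deviation makes the entries standard normal; the kernel is unchanged. -/
lemma IsGaussianMatrix.hasLaw_gaussPi {P : Measure Ω} [IsProbabilityMeasure P] {v : ℝ≥0}
    (hv : v ≠ 0) {Φ : Ω → Matrix (Fin m) (Fin n) ℝ} (hΦ : IsGaussianMatrix P v Φ) :
    HasLaw (fun ω (k : Fin m × Fin n) => (Real.sqrt v)⁻¹ * Φ ω k.1 k.2)
      (gaussPi (Fin m × Fin n)) P := by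
  have hm : ∀ k : Fin m × Fin n, AEMeasurable (fun ω => (Real.sqrt v)⁻¹ * Φ ω k.1 k.2) P :=
    fun k => (hΦ.law k.1 k.2).aemeasurable.const_mul _
  have hl : ∀ k : Fin m × Fin n,
      P.map (fun ω => (Real.sqrt v)⁻¹ * Φ ω k.1 k.2) = gaussianReal 0 1 := fun k => by
    rw [(gaussianReal_const_mul (hΦ.law k.1 k.2) (Real.sqrt v)⁻¹).map_eq]
    congr 1
    · simp
    · ext
      have : (v : ℝ) ≠ 0 := by exact_mod_cast hv
      simp [inv_pow, this]
  have hi : iIndepFun (fun (k : Fin m × Fin n) ω => (Real.sqrt v)⁻¹ * Φ ω k.1 k.2) P :=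
    hΦ.indep.comp (fun _ t => (Real.sqrt v)⁻¹ * t) fun _ => by fun_prop
  refine ⟨aemeasurable_pi_lambda _ hm, ?_⟩
  rw [(iIndepFun_iff_map_fun_eq_pi_map hm).1 hi]
  simp_rw [hl]

/-- Failure of unique recovery produces a unit vector of the descent cone in the kernel. -/
lemma exists_matVec_eq_zero_of_not_isUniqueSolution {g : EuclideanSpace ℝ (Fin n) → ℝ}
    {x : EuclideanSpace ℝ (Fin n)} {A : Matrix (Fin m) (Fin n) ℝ}
    (h : ¬ IsUniqueSolution g A (A.mulVec fun i => x i) x) (c : ℝ) :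
    ∃ u ∈ descentCone g x ∩ Metric.sphere 0 1, matVec (fun k => c * A k.1 k.2) u = 0 := by
  simp only [IsUniqueSolution, true_and] at h
  push Not at h
  obtain ⟨w, hw, hne, hle⟩ := h
  have hpos : 0 < ‖w - x‖ := norm_pos_iff.2 (sub_ne_zero.2 hne)
  refine ⟨‖w - x‖⁻¹ • (w - x), ⟨⟨‖w - x‖, hpos, ?_⟩, ?_⟩, ?_⟩
  · rwa [smul_smul, mul_inv_cancel₀ hpos.ne', one_smul, add_sub_cancel]
  · rw [mem_sphere_zero_iff_norm, norm_smul, norm_inv, norm_norm, inv_mul_cancel₀ hpos.ne']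
  · ext j
    have hj := congrFun hw j
    simp only [Matrix.mulVec, dotProduct] at hj
    have : ∑ i, c * A j i * (‖w - x‖⁻¹ * (w i - x i))
        = c * ‖w - x‖⁻¹ * (∑ i, A j i * w i - ∑ i, A j i * x i) := by
      rw [← Finset.sum_sub_distrib, Finset.mul_sum]
      exact Finset.sum_congr rfl fun i _ => by ring
    simp only [matVec, PiLp.smul_apply, PiLp.sub_apply, smul_eq_mul, PiLp.zero_apply]
    rw [this, hj, sub_self, mul_zero]

/-- The failure event need not be measurable; it is contained in the preimage of a measurable set of
matrices. -/
theorem measure_not_isUniqueSolution_le {g : EuclideanSpace ℝ (Fin n) → ℝ}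
    {x : EuclideanSpace ℝ (Fin n)} (hm3 : 3 ≤ m) (hδ : statDim (descentCone g x) ≤ m - 1)
    (P : Measure Ω) [IsProbabilityMeasure P] {v : ℝ≥0} (hv : v ≠ 0)
    {Φ : Ω → Matrix (Fin m) (Fin n) ℝ} (hΦ : IsGaussianMatrix P v Φ) :
    P {ω | ¬ IsUniqueSolution g (Φ ω) ((Φ ω).mulVec (fun i => x i)) x}
      ≤ ENNReal.ofReal (Real.exp
          (-(1 / 2) * (Real.sqrt m - gaussianWidth (descentCone g x)) ^ 2)) := by
  rcases (descentCone g x ∩ Metric.sphere 0 1).eq_empty_or_nonempty with h0 | hne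
  · have : {ω | ¬ IsUniqueSolution g (Φ ω) ((Φ ω).mulVec (fun i => x i)) x} = ∅ := by
      refine Set.eq_empty_of_forall_notMem fun ω hω => ?_
      obtain ⟨u, hu, -⟩ := exists_matVec_eq_zero_of_not_isUniqueSolution hω 1
      rw [h0] at hu
      exact hu
    rw [this, measure_empty]
    exact zero_le
  have hP : (polarCone (descentCone g x)).Nonempty := ⟨0, zero_mem_polarCone _⟩
  obtain ⟨S, hS, hsub, hle⟩ := measure_exists_matVec_eq_zero_le hne Set.inter_subset_right hm3
    (Metric.continuous_infDist_pt (polarCone (descentCone g x))).measurable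
    (integrable_infDist hP) (integrable_infDist_sq hP)
    (fun h u hu => inner_le_infDist_polarCone hu h) hδ
  have hlaw := hΦ.hasLaw_gaussPi hv
  refine le_trans ?_ hle
  rw [← hlaw.map_eq, Measure.map_apply_of_aemeasurable hlaw.aemeasurable hS]
  exact measure_mono fun ω hω =>
    hsub (exists_matVec_eq_zero_of_not_isUniqueSolution hω (Real.sqrt v)⁻¹)

end Recovery

/-! ### Subgradients of weighted sums of absolute values -/

section Subgradients

variable {ι : Type*} [Fintype ι]

/-- The total weight of the kinks of `t ↦ ∑ j, |w j * (t - ζ j)|` that sit at `ξ`. -/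
noncomputable def kinkMass (w ζ : ι → ℝ) (ξ : ℝ) : ℝ := ∑ j, if ξ - ζ j = 0 then w j else 0

/-- The midpoint of the subdifferential of `t ↦ ∑ j, |w j * (t - ζ j)|` at `ξ`. -/
noncomputable def netSlope (w ζ : ι → ℝ) (ξ : ℝ) : ℝ := ∑ j, w j * (SignType.sign (ξ - ζ j) : ℝ)

lemma kinkMass_nonneg {w : ι → ℝ} (hw : ∀ j, 0 ≤ w j) (ζ : ι → ℝ) (ξ : ℝ) :
    0 ≤ kinkMass w ζ ξ :=
  Finset.sum_nonneg fun j _ => by split_ifs <;> simp [hw]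

lemma abs_netSlope_add_kinkMass_le {w : ι → ℝ} (hw : ∀ j, 0 ≤ w j) (ζ : ι → ℝ) (ξ : ℝ) :
    |netSlope w ζ ξ| + kinkMass w ζ ξ ≤ ∑ j, w j := by
  refine (add_le_add_left (Finset.abs_sum_le_sum_abs _ _) _).trans ?_
  rw [kinkMass, ← Finset.sum_add_distrib]
  refine Finset.sum_le_sum fun j _ => ?_
  rcases lt_trichotomy (ξ - ζ j) 0 with h | h | h
  · simp [h, h.ne, abs_of_nonneg (hw j)]
  · simp [h]
  · simp [h, h.ne', abs_of_nonneg (hw j)]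

/-- Every slope within `kinkMass` of `netSlope` is a subgradient. -/
lemma sum_abs_add_le_sum_abs {w : ι → ℝ} (hw : ∀ j, 0 ≤ w j) {ζ : ι → ℝ} {ξ a : ℝ}
    (ha : |a - netSlope w ζ ξ| ≤ kinkMass w ζ ξ) (t : ℝ) :
    ∑ j, |w j * (ξ - ζ j)| + a * (t - ξ) ≤ ∑ j, |w j * (t - ζ j)| := by
  have h1 : ∑ j, |w j * (ξ - ζ j)| + netSlope w ζ ξ * (t - ξ) + kinkMass w ζ ξ * |t - ξ|
      ≤ ∑ j, |w j * (t - ζ j)| := by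
    rw [netSlope, kinkMass, Finset.sum_mul, Finset.sum_mul, ← Finset.sum_add_distrib,
      ← Finset.sum_add_distrib]
    refine Finset.sum_le_sum fun j _ => ?_
    rw [abs_mul, abs_mul, abs_of_nonneg (hw j)]
    rcases lt_trichotomy (ξ - ζ j) 0 with h | h | h
    · simp only [sign_neg h, h.ne, abs_of_neg h, if_false, SignType.coe_neg, SignType.coe_one]
      have := mul_le_mul_of_nonneg_left (neg_abs_le (t - ζ j)) (hw j)
      linarith
    · have h' : ζ j = ξ := by linarith
      simp [h']
    · simp only [sign_pos h, h.ne', abs_of_pos h, if_false, SignType.coe_one]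
      have := mul_le_mul_of_nonneg_left (le_abs_self (t - ζ j)) (hw j)
      linarith
  have h2 : (a - netSlope w ζ ξ) * (t - ξ) ≤ kinkMass w ζ ξ * |t - ξ| := by
    refine (le_abs_self _).trans ?_
    rw [abs_mul]
    exact mul_le_mul_of_nonneg_right ha (abs_nonneg _)
  linarith

variable {n J : ℕ}

lemma mem_subdifferential_nL1 {lam : ℝ} (hlam : 0 ≤ lam) {w : Fin (J + 1) → Fin n → ℝ}
    (hw : ∀ j i, 0 ≤ w j i) (z : Fin (J + 1) → EuclideanSpace ℝ (Fin n))
    (x : EuclideanSpace ℝ (Fin n)) {a : Fin n → ℝ}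
    (ha : ∀ i, |a i - netSlope (w · i) (z · i) (x i)| ≤ kinkMass (w · i) (z · i) (x i)) :
    WithLp.toLp 2 (fun i => lam * a i) ∈ subdifferential (nL1 lam w z) x := by
  intro y
  have h1 : ∀ v, nL1 lam w z v = lam * ∑ i, ∑ j, |w j i * (v i - z j i)| := fun v => by
    rw [nL1, Finset.sum_comm]
  have h2 : inner ℝ (WithLp.toLp 2 (fun i => lam * a i)) (y - x)
      = lam * ∑ i, a i * (y i - x i) := by
    rw [PiLp.inner_apply, Finset.mul_sum]
    refine Finset.sum_congr rfl fun i _ => ?_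
    simp
    ring
  rw [h1, h1, h2, ← mul_add, ← Finset.sum_add_distrib]
  exact mul_le_mul_of_nonneg_left (Finset.sum_le_sum fun i _ =>
    sum_abs_add_le_sum_abs (hw · i) (ha i) (y i)) hlam

end Subgradients

/-! ### The expected squared distance to the scaled subdifferential -/

section Projection

variable {n J : ℕ}

lemma measurePreserving_coord (i : Fin n) :
    MeasurePreserving (fun h : EuclideanSpace ℝ (Fin n) => h i)
      (stdGaussian (EuclideanSpace ℝ (Fin n))) (gaussianReal 0 1) := by
  refine ⟨by fun_prop, ?_⟩
  have mp := measurePreserving_toLp_gaussPi n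
  rw [← mp.map_eq, Measure.map_map (by fun_prop) mp.measurable]
  exact (measurePreserving_eval (fun _ : Fin n => gaussianReal 0 1) i).map_eq

/-- The squared distance from `h` to the interval of centre `c` and half length `k`. -/
lemma exists_sq_dist_interval_eq (h c k : ℝ) (hk : 0 ≤ k) :
    ∃ b, |b - c| ≤ k ∧ (h - b) ^ 2 = (max (h - (k + c)) 0) ^ 2 + (max (-(k - c) - h) 0) ^ 2 := by
  rcases le_total h (c - k) with h1 | h1
  · refine ⟨c - k, by rw [abs_le]; constructor <;> linarith, ?_⟩
    rw [max_eq_right (by linarith), max_eq_left (by linarith)]; ring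
  rcases le_total h (c + k) with h2 | h2
  · refine ⟨h, by rw [abs_le]; constructor <;> linarith, ?_⟩
    rw [max_eq_right (by linarith), max_eq_right (by linarith)]; ring
  · refine ⟨c + k, by rw [abs_le]; constructor <;> linarith, ?_⟩
    rw [max_eq_left (by linarith), max_eq_right (by linarith)]; ring

/-- The scaled subdifferential `(t / lam) ∂g(x)` is a box with centres `t * netSlope` and half
side lengths `t * kinkMass`; the right-hand side is the expected squared distance to it. -/
theorem subdiffBound_nL1_le {lam : ℝ} (hlam : 0 < lam) {w : Fin (J + 1) → Fin n → ℝ}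
    (hw : ∀ j i, 0 ≤ w j i) (z : Fin (J + 1) → EuclideanSpace ℝ (Fin n))
    (x : EuclideanSpace ℝ (Fin n)) {t : ℝ} (ht : 0 < t) :
    subdiffBound (nL1 lam w z) x ≤ ∑ i,
      (gaussTail (t * (kinkMass (w · i) (z · i) (x i) + netSlope (w · i) (z · i) (x i)))
        + gaussTail (t * (kinkMass (w · i) (z · i) (x i) - netSlope (w · i) (z · i) (x i)))) := by
  set k : Fin n → ℝ := fun i => kinkMass (w · i) (z · i) (x i) with hk
  set c : Fin n → ℝ := fun i => netSlope (w · i) (z · i) (x i) with hc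
  have i1 : ∀ i s, Integrable (fun h : EuclideanSpace ℝ (Fin n) => (max (h i - s) 0) ^ 2)
      (stdGaussian (EuclideanSpace ℝ (Fin n))) := fun i s =>
    (measurePreserving_coord i).integrable_comp_of_integrable (integrable_gaussTail s)
  have i2 : ∀ i s, Integrable (fun h : EuclideanSpace ℝ (Fin n) => (max (-s - h i) 0) ^ 2)
      (stdGaussian (EuclideanSpace ℝ (Fin n))) := fun i s =>
    (measurePreserving_coord i).integrable_comp_of_integrable
      (g := fun u => (max (-s - u) 0) ^ 2) (integrable_gaussTail_left (-s))
  have e1 : ∀ i s, ∫ h : EuclideanSpace ℝ (Fin n), (max (h i - s) 0) ^ 2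
      ∂(stdGaussian (EuclideanSpace ℝ (Fin n))) = gaussTail s := fun i s => by
    rw [gaussTail, ← (measurePreserving_coord i).map_eq, integral_map
      (measurePreserving_coord i).measurable.aemeasurable
      (Continuous.aestronglyMeasurable (by fun_prop))]
  have e2 : ∀ i s, ∫ h : EuclideanSpace ℝ (Fin n), (max (-s - h i) 0) ^ 2
      ∂(stdGaussian (EuclideanSpace ℝ (Fin n))) = gaussTail s := fun i s => by
    rw [← integral_gaussTail_left, ← (measurePreserving_coord i).map_eq, integral_map
      (measurePreserving_coord i).measurable.aemeasurable
      (Continuous.aestronglyMeasurable (by fun_prop))]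
  have i12 : ∀ i, Integrable (fun h : EuclideanSpace ℝ (Fin n) =>
      (max (h i - t * (k i + c i)) 0) ^ 2 + (max (-(t * (k i - c i)) - h i) 0) ^ 2)
      (stdGaussian (EuclideanSpace ℝ (Fin n))) := fun i => (i1 i _).add (i2 i _)
  have key := subdiffBound_le (nL1 lam w z) x (τ := t / lam) (by positivity)
    (F := fun h => ∑ i, ((max (h i - t * (k i + c i)) 0) ^ 2
      + (max (-(t * (k i - c i)) - h i) 0) ^ 2))
    (integrable_finsetSum _ fun i _ => i12 i) (fun h => by
      have hb := fun i => exists_sq_dist_interval_eq (h i) (t * c i) (t * k i)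
        (mul_nonneg ht.le (kinkMass_nonneg (hw · i) _ _))
      choose b hb1 hb2 using hb
      refine ⟨WithLp.toLp 2 (fun i => lam * (b i / t)),
        mem_subdifferential_nL1 hlam.le hw z x fun i => ?_, ?_⟩
      · have : b i / t - c i = (b i - t * c i) / t := by field_simp
        change |b i / t - c i| ≤ k i
        rw [this, abs_div, abs_of_pos ht, div_le_iff₀ ht]
        linarith [hb1 i]
      · rw [EuclideanSpace.norm_sq_eq]
        refine (Finset.sum_congr rfl fun i _ => ?_).le
        have : t / lam * (lam * (b i / t)) = b i := by field_simp
        simp only [PiLp.sub_apply, PiLp.smul_apply, smul_eq_mul, Real.norm_eq_abs, sq_abs, this]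
        rw [hb2 i, mul_add, mul_sub])
  refine key.trans (le_of_eq ?_)
  rw [integral_finsetSum _ fun i _ => i12 i]
  refine Finset.sum_congr rfl fun i _ => ?_
  rw [integral_add (i1 i _) (i2 i _), e1, e2]

lemma gaussTail_add_gaussTail_neg (s : ℝ) : gaussTail s + gaussTail (-s) = 1 + s ^ 2 := by
  rw [← integral_sub_sq_gaussianReal, ← integral_gaussTail_left (-s), gaussTail]
  rw [← integral_add (integrable_gaussTail s) (integrable_gaussTail_left (- -s))]
  congr 1
  ext u
  rcases le_total u s with h | h
  · rw [max_eq_right (by linarith), max_eq_left (by linarith)]; ring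
  · rw [max_eq_left (by linarith), max_eq_right (by linarith)]; ring

lemma convexOn_gaussTail : ConvexOn ℝ Set.univ gaussTail := by
  refine ⟨convex_univ, fun s _ t _ a b ha hb hab => ?_⟩
  simp only [smul_eq_mul, gaussTail]
  rw [← integral_const_mul, ← integral_const_mul,
    ← integral_add ((integrable_gaussTail s).const_mul a) ((integrable_gaussTail t).const_mul b)]
  refine integral_mono (integrable_gaussTail _)
    (((integrable_gaussTail s).const_mul a).add ((integrable_gaussTail t).const_mul b)) fun u => ?_
  have h1 : max (u - (a * s + b * t)) 0 ≤ a * max (u - s) 0 + b * max (u - t) 0 := by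
    refine max_le ?_ (by positivity)
    have e : u - (a * s + b * t) = a * (u - s) + b * (u - t) := by
      linear_combination (-u) * hab
    rw [e]
    exact add_le_add (mul_le_mul_of_nonneg_left (le_max_left _ _) ha)
      (mul_le_mul_of_nonneg_left (le_max_left _ _) hb)
  have h2 := pow_le_pow_left₀ (le_max_right _ _) h1 2
  refine h2.trans ?_
  have hb' : b = 1 - a := by linarith
  subst hb'
  have : 0 ≤ a * (1 - a) := mul_nonneg ha hb
  nlinarith [mul_nonneg this (sq_nonneg (max (u - s) 0 - max (u - t) 0))]

/-- Two-sided tails are largest for the most asymmetric interval. -/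
lemma gaussTail_add_gaussTail_le {t c s : ℝ} (hs : |s| ≤ 1 - c) :
    gaussTail (t * (c + s)) + gaussTail (t * (c - s))
      ≤ gaussTail t + gaussTail ((2 * c - 1) * t) := by
  rcases (abs_nonneg s |>.trans hs).eq_or_lt with h0 | h0
  · have hc : c = 1 := by linarith
    have hs0 : s = 0 := by rw [← abs_nonpos_iff]; linarith
    subst hc hs0
    refine le_of_eq ?_
    congr 2 <;> ring
  obtain ⟨h1, h2⟩ := abs_le.1 hs
  set θ := (1 + s / (1 - c)) / 2 with hθ
  have e1 : s = (2 * θ - 1) * (1 - c) := by rw [hθ]; field_simp; ring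
  have t0 : 0 ≤ θ := by
    by_contra hn; push Not at hn; nlinarith
  have t1 : 0 ≤ 1 - θ := by
    by_contra hn; push Not at hn; nlinarith
  have k1 := convexOn_gaussTail.2 (Set.mem_univ t) (Set.mem_univ ((2 * c - 1) * t)) t0 t1
    (by ring)
  have k2 := convexOn_gaussTail.2 (Set.mem_univ t) (Set.mem_univ ((2 * c - 1) * t)) t1 t0
    (by ring)
  simp only [smul_eq_mul] at k1 k2
  have f1 : t * (c + s) = θ * t + (1 - θ) * ((2 * c - 1) * t) := by rw [e1]; ring
  have f2 : t * (c - s) = (1 - θ) * t + θ * ((2 * c - 1) * t) := by rw [e1]; ring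
  rw [f1, f2]
  linarith

end Projection

/-! ### The adaptive weights -/

section Weights

variable {n J : ℕ}

lemma weight_eq {ε : ℝ} (hε : 0 < ε) (x : EuclideanSpace ℝ (Fin n))
    (z : Fin (J + 1) → EuclideanSpace ℝ (Fin n)) (j : Fin (J + 1)) (i : Fin n) :
    weight ε x z j i = (|x i - z j i| + ε)⁻¹ / ∑ l, (|x i - z l i| + ε)⁻¹ := by
  have hb : 0 < |x i - z j i| + ε := by positivity
  have hS : 0 < ∑ l, (|x i - z l i| + ε)⁻¹ :=
    Finset.sum_pos (fun l _ => by positivity) Finset.univ_nonempty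
  rw [weight, ← Finset.add_sum_erase _ (fun l => (|x i - z l i| + ε)⁻¹) (Finset.mem_univ j)] at *
  rw [div_eq_div_iff (by
    have : 0 ≤ ∑ l ∈ Finset.univ.erase j, (|x i - z l i| + ε)⁻¹ :=
      Finset.sum_nonneg fun l _ => by positivity
    positivity) hS.ne']
  field_simp

lemma weight_nonneg {ε : ℝ} (hε : 0 < ε) (x : EuclideanSpace ℝ (Fin n))
    (z : Fin (J + 1) → EuclideanSpace ℝ (Fin n)) (j : Fin (J + 1)) (i : Fin n) :
    0 ≤ weight ε x z j i := by
  rw [weight_eq hε]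
  exact div_nonneg (by positivity) (Finset.sum_nonneg fun l _ => by positivity)

lemma sum_weight {ε : ℝ} (hε : 0 < ε) (x : EuclideanSpace ℝ (Fin n))
    (z : Fin (J + 1) → EuclideanSpace ℝ (Fin n)) (i : Fin n) :
    ∑ j, weight ε x z j i = 1 := by
  have hS : 0 < ∑ l, (|x i - z l i| + ε)⁻¹ :=
    Finset.sum_pos (fun l _ => by positivity) Finset.univ_nonempty
  simp_rw [weight_eq hε]
  rw [← Finset.sum_div, div_self hS.ne']

lemma kinkMass_eq_zero {ε : ℝ} {x : EuclideanSpace ℝ (Fin n)}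
    {z : Fin (J + 1) → EuclideanSpace ℝ (Fin n)} {i : Fin n} (h : ∀ j, x i - z j i ≠ 0) :
    kinkMass (weight ε x z · i) (z · i) (x i) = 0 :=
  Finset.sum_eq_zero fun j _ => by simp [h j]

lemma kinkMass_eq_one {ε : ℝ} (hε : 0 < ε) {x : EuclideanSpace ℝ (Fin n)}
    {z : Fin (J + 1) → EuclideanSpace ℝ (Fin n)} {i : Fin n} (h : ∀ j, x i - z j i = 0) :
    kinkMass (weight ε x z · i) (z · i) (x i) = 1 := by
  rw [← sum_weight hε x z i]
  exact Finset.sum_congr rfl fun j _ => by simp [h j]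

lemma netSlope_eq_zero {ε : ℝ} {x : EuclideanSpace ℝ (Fin n)}
    {z : Fin (J + 1) → EuclideanSpace ℝ (Fin n)} {i : Fin n} (h : ∀ j, x i - z j i = 0) :
    netSlope (weight ε x z · i) (z · i) (x i) = 0 :=
  Finset.sum_eq_zero fun j _ => by simp [h j]

lemma netSlope_eq_aCoef {ε : ℝ} {x : EuclideanSpace ℝ (Fin n)}
    {z : Fin (J + 1) → EuclideanSpace ℝ (Fin n)} {σ : Fin n → Equiv.Perm (Fin (J + 1))}
    {l : Fin n → ℤ} (hsort : SortedBy z σ) (hloc : Located x z σ l) {i : Fin n}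
    (h : ∀ j, x i - z j i ≠ 0) :
    netSlope (weight ε x z · i) (z · i) (x i) = aCoef ε x z σ l i := by
  rw [netSlope, aCoef, ← Equiv.sum_comp (σ i)]
  refine Finset.sum_congr rfl fun j _ => ?_
  congr 1
  obtain ⟨h1, h2, h3, h4⟩ := hloc i
  rcases lt_or_ge (l i) ((j : ℕ) : ℤ) with hj | hj
  · have hj' := j.2
    obtain ⟨k, hk⟩ : ∃ k : Fin (J + 1), ((k : ℕ) : ℤ) = l i + 1 :=
      ⟨⟨(l i + 1).toNat, by omega⟩, by simp only; omega⟩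
    have h5 : z (σ i k) i ≤ z (σ i j) i := hsort i (Fin.le_def.2 (by omega))
    have h6 : x i - z (σ i j) i < 0 := lt_of_le_of_ne (by linarith [h4 k hk]) (h _)
    simp [bInd, hj, sign_neg h6]
  · obtain ⟨k, hk⟩ : ∃ k : Fin (J + 1), ((k : ℕ) : ℤ) = l i :=
      ⟨⟨(l i).toNat, by omega⟩, by simp only; omega⟩
    have h5 : z (σ i j) i ≤ z (σ i k) i := hsort i (Fin.le_def.2 (by omega))
    have h6 : 0 < x i - z (σ i j) i := by linarith [h3 k hk]
    simp [bInd, not_lt.2 hj, sign_pos h6]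

lemma sum_ite_Ico_eq {N k e : ℕ} (h : k + e ≤ N) :
    ∑ j : Fin N, (if k ≤ (j : ℕ) ∧ (j : ℕ) < k + e then (1 : ℝ) else 0) = e := by
  rw [Fin.sum_univ_eq_sum_range (fun j => if k ≤ j ∧ j < k + e then (1 : ℝ) else 0) N,
    ← Finset.sum_filter]
  have : (Finset.range N).filter (fun j => k ≤ j ∧ j < k + e) = Finset.Ico k (k + e) := by
    ext j; simp; omega
  rw [this]
  simp

/-- At a mixed position the zero differences share the weight `1 / (ε ∑ l, (|x_i - z_{li}| + ε)⁻¹)`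
each, and there are `d i` of them. -/
lemma kinkMass_eq_cCoef {ε : ℝ} (hε : 0 < ε) {x : EuclideanSpace ℝ (Fin n)}
    {z : Fin (J + 1) → EuclideanSpace ℝ (Fin n)} {p q : ℕ}
    {σ : Fin n → Equiv.Perm (Fin (J + 1))} {d : Fin n → ℕ} (hzeros : ConsecutiveZeros x z p q σ d)
    {i : Fin n} (hp : p ≤ (i : ℕ)) (hq : (i : ℕ) < q) :
    kinkMass (weight ε x z · i) (z · i) (x i) = cCoef ε x z d i := by
  obtain ⟨-, -, k, hk, hz⟩ := hzeros i hp hq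
  have hS : 0 < ∑ l, (|x i - z l i| + ε)⁻¹ :=
    Finset.sum_pos (fun l _ => by positivity) Finset.univ_nonempty
  have h1 : ∀ j, (if x i - z j i = 0 then weight ε x z j i else 0)
      = (ε * ∑ l, (|x i - z l i| + ε)⁻¹)⁻¹ * (if x i - z j i = 0 then (1 : ℝ) else 0) := fun j => by
    split_ifs with h
    · rw [weight_eq hε, h]; field_simp; simp
    · simp
  rw [kinkMass, Finset.sum_congr rfl fun j _ => h1 j, ← Finset.mul_sum,
    ← Equiv.sum_comp (σ i) fun j => if x i - z j i = 0 then (1 : ℝ) else 0]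
  simp_rw [hz]
  rw [sum_ite_Ico_eq hk, cCoef, mul_comm, Finset.mul_sum]
  simp_rw [div_eq_mul_inv]

end Weights

/-! ### Estimates at the scale `t = √(2 log (n / s̄))` -/

section Numeric

lemma sq_one_sub_exp_neg_le {L : ℝ} (hL : 0 ≤ L) : (1 - Real.exp (-L)) ^ 2 ≤ L / 2 := by
  set ρ := Real.sqrt (L / 2) with hρ
  have hρ0 : 0 ≤ ρ := Real.sqrt_nonneg _
  have hρ2 : ρ ^ 2 = L / 2 := Real.sq_sqrt (by positivity)
  have h0 : 0 ≤ 1 - Real.exp (-L) := by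
    have := Real.exp_le_one_iff.2 (neg_nonpos.2 hL); linarith
  rw [← hρ2]
  refine pow_le_pow_left₀ h0 ?_ 2
  have hpos := Real.exp_pos (-L)
  -- with `L = 2 ρ²` the claim is `1 - ρ ≤ exp (-2 ρ²)`
  rcases le_total ρ (1 / 2) with h | h
  · have := Real.add_one_le_exp (-L)
    nlinarith
  rcases le_total 1 ρ with h1 | h1
  · linarith
  -- the tangent of `exp` at `-1`
  have h2 := Real.add_one_le_exp (1 - L)
  have h3 : Real.exp (1 - L) = Real.exp 1 * Real.exp (-L) := by rw [← Real.exp_add]; ring_nf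
  have h4 : Real.exp 1 ≤ 3 := by linarith [Real.exp_one_lt_d9]
  have h5 : 2 - L = 2 * (1 - ρ) * (1 + ρ) := by linear_combination 2 * hρ2
  have h6 : 3 * (1 - ρ) ≤ 3 * Real.exp (-L) := by nlinarith
  linarith

lemma two_mul_gaussTail_le {L : ℝ} (hL : 0 < L) :
    2 * gaussTail (Real.sqrt (2 * L)) ≤ Real.exp (-L) / Real.sqrt (Real.pi * L) := by
  have h := gaussTail_le (t := Real.sqrt (2 * L)) (Real.sqrt_pos.2 (by positivity))
  have e : Real.sqrt (2 * Real.pi) * Real.sqrt (2 * L) = 2 * Real.sqrt (Real.pi * L) := by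
    rw [← Real.sqrt_mul (by positivity), show 2 * Real.pi * (2 * L) = 2 ^ 2 * (Real.pi * L) by ring,
      Real.sqrt_mul (by positivity), Real.sqrt_sq (by norm_num)]
  rw [e, Real.sq_sqrt (by positivity), mul_div_cancel_left₀ _ (two_ne_zero)] at h
  have hs : 0 < Real.sqrt (Real.pi * L) := Real.sqrt_pos.2 (by positivity)
  calc _ ≤ 2 * (Real.exp (-L) / (2 * Real.sqrt (Real.pi * L))) := by linarith
    _ = _ := by field_simp

/-- The tail cost of a position at which a fraction `c` of the weight sits at a kink. Convexity of
`exp` bounds `e^{L (1 - r²)}`, `r = 2c - 1`, by `r² + (1 - r²) e^L`. -/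
lemma gaussTail_add_gaussTail_mul_le {L c : ℝ} (hL : 0 < L) (hc : 1 / 2 < c) (hc1 : c ≤ 1) :
    gaussTail (Real.sqrt (2 * L)) + gaussTail ((2 * c - 1) * Real.sqrt (2 * L))
      ≤ Real.exp (-L) / Real.sqrt (Real.pi * L) * c
        + 2 * c / (Real.sqrt (Real.pi * L) * (2 * c - 1)) * (1 - c) := by
  have hs : 0 < Real.sqrt (Real.pi * L) := Real.sqrt_pos.2 (by positivity)
  set r := 2 * c - 1 with hr
  have hr0 : 0 < r := by linarith
  have hr1 : r ≤ 1 := by linarith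
  have h1 := two_mul_gaussTail_le hL
  have h2 := gaussTail_le (t := r * Real.sqrt (2 * L)) (by positivity)
  have e : Real.sqrt (2 * Real.pi) * (r * Real.sqrt (2 * L)) = 2 * r * Real.sqrt (Real.pi * L) := by
    rw [mul_left_comm, ← Real.sqrt_mul (by positivity),
      show 2 * Real.pi * (2 * L) = 2 ^ 2 * (Real.pi * L) by ring,
      Real.sqrt_mul (by positivity), Real.sqrt_sq (by norm_num)]
    ring
  rw [e, mul_pow, Real.sq_sqrt (by positivity)] at h2
  have h3 : Real.exp (-(r ^ 2 * (2 * L) / 2)) ≤ r ^ 2 * Real.exp (-L) + (1 - r ^ 2) := by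
    have h := convexOn_exp.2 (Set.mem_univ (-L)) (Set.mem_univ 0) (sq_nonneg r)
      (show 0 ≤ 1 - r ^ 2 by nlinarith) (by ring)
    simp only [smul_eq_mul, mul_zero, add_zero, Real.exp_zero, mul_one] at h
    refine le_trans (le_of_eq ?_) h
    congr 1; ring
  have h4 : gaussTail (r * Real.sqrt (2 * L))
      ≤ (r ^ 2 * Real.exp (-L) + (1 - r ^ 2)) / (2 * r * Real.sqrt (Real.pi * L)) :=
    h2.trans (div_le_div_of_nonneg_right h3 (by positivity))
  have h5 : gaussTail (Real.sqrt (2 * L)) ≤ Real.exp (-L) / Real.sqrt (Real.pi * L) / 2 := by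
    linarith
  refine (add_le_add h5 h4).trans (le_of_eq ?_)
  have hcr : c = (1 + r) / 2 := by rw [hr]; ring
  rw [hcr]
  field_simp
  ring

end Numeric

/-! ### The measurement bound -/

section Main

variable {n J : ℕ}

/-- The share of the tails that does not come with a factor `1 - c i`: it is where the constant `2/5`
comes from, through `4 π / 25 ≥ 1/2`. -/
lemma exp_div_sqrt_mul_sub_le {L : ℝ} (hL : 0 < L) {s N : ℝ} (hs : 0 < s) (hN : N = s * Real.exp L) :
    Real.exp (-L) / Real.sqrt (Real.pi * L) * (N - s) ≤ 2 / 5 * s := by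
  have hr : 0 < Real.sqrt (Real.pi * L) := Real.sqrt_pos.2 (by positivity)
  have h1 : 1 - Real.exp (-L) ≤ 2 / 5 * Real.sqrt (Real.pi * L) := by
    refine abs_le_of_sq_le_sq' ((sq_one_sub_exp_neg_le hL.le).trans ?_) (by positivity) |>.2
    rw [mul_pow, Real.sq_sqrt (by positivity)]
    nlinarith [Real.pi_gt_d2]
  have h2 : Real.exp (-L) * (N - s) = s * (1 - Real.exp (-L)) := by
    have : Real.exp (-L) * Real.exp L = 1 := by rw [← Real.exp_add]; simp
    rw [hN]
    linear_combination s * this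
  rw [div_mul_eq_mul_div, h2, div_le_iff₀ hr]
  nlinarith

lemma sum_indicator_ranges {p q : ℕ} (hpq : p ≤ q) (hqn : q ≤ n) :
    (∑ i : Fin n, (if (i : ℕ) < p then (1 : ℝ) else 0) = p) ∧
    (∑ i : Fin n, (if p ≤ (i : ℕ) ∧ (i : ℕ) < q then (1 : ℝ) else 0) = q - p) ∧
    (∑ i : Fin n, (if q ≤ (i : ℕ) then (1 : ℝ) else 0) = n - q) := by
  refine ⟨?_, ?_, ?_⟩
  · rw [← sum_ite_Ico_eq (N := n) (k := 0) (e := p) (by omega)]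
    simp
  · rw [← Nat.cast_sub hpq, ← sum_ite_Ico_eq (N := n) (k := p) (e := q - p) (by omega)]
    simp [hpq]
  · rw [← Nat.cast_sub hqn, ← sum_ite_Ico_eq (N := n) (k := q) (e := n - q) (by omega)]
    simp [hqn]

/-- `c ↦ 2 c / (2 c - 1)` decreases, so `κ`, which uses the least `c i`, dominates at every
position. -/
lemma le_kappa {ε : ℝ} {x : EuclideanSpace ℝ (Fin n)}
    {z : Fin (J + 1) → EuclideanSpace ℝ (Fin n)} {p q : ℕ} {d : Fin n → ℕ}
    (hc : ∀ i : Fin n, p ≤ (i : ℕ) → (i : ℕ) < q → 1 / 2 < cCoef ε x z d i)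
    {i : Fin n} (hp : p ≤ (i : ℕ)) (hq : (i : ℕ) < q) {L : ℝ} (hL : 0 < L)
    (hL' : Real.log (n / sBar ε x z p q d) = L) :
    2 * cCoef ε x z d i / (Real.sqrt (Real.pi * L) * (2 * cCoef ε x z d i - 1))
      ≤ kappa ε x z p q d := by
  have hr : 0 < Real.sqrt (Real.pi * L) := Real.sqrt_pos.2 (by positivity)
  have : Nonempty {i : Fin n // p ≤ (i : ℕ) ∧ (i : ℕ) < q} := ⟨⟨i, hp, hq⟩⟩
  have h1 : cMin ε x z p q d ≤ cCoef ε x z d i :=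
    ciInf_le (f := fun i : {i : Fin n // p ≤ (i : ℕ) ∧ (i : ℕ) < q} => cCoef ε x z d i)
      (Set.finite_range _).bddBelow ⟨i, hp, hq⟩
  obtain ⟨k, hk⟩ := exists_eq_ciInf_of_finite
    (f := fun i : {i : Fin n // p ≤ (i : ℕ) ∧ (i : ℕ) < q} => cCoef ε x z d i)
  have h2 : 1 / 2 < cMin ε x z p q d := by
    rw [cMin, ← hk]
    exact hc k.1 k.2.1 k.2.2
  have h4 : Real.sqrt 4 = 2 := by
    rw [show (4 : ℝ) = 2 ^ 2 by norm_num, Real.sqrt_sq (by norm_num)]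
  rw [kappa, hL', h4, div_le_div_iff₀ (mul_pos hr (by linarith [hc i hp hq]))
    (mul_pos hr (by linarith))]
  nlinarith

variable {lam ε : ℝ} {x : EuclideanSpace ℝ (Fin n)} {z : Fin (J + 1) → EuclideanSpace ℝ (Fin n)}
  {p q : ℕ} {σ : Fin n → Equiv.Perm (Fin (J + 1))} {l : Fin n → ℤ} {d : Fin n → ℕ}

lemma abs_netSlope_le_and_cCoef_le_one (hε : 0 < ε) (hzeros : ConsecutiveZeros x z p q σ d) {i : Fin n}
    (hp : p ≤ (i : ℕ)) (hq : (i : ℕ) < q) :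
    |netSlope (weight ε x z · i) (z · i) (x i)| ≤ 1 - cCoef ε x z d i ∧ cCoef ε x z d i ≤ 1 := by
  have h := abs_netSlope_add_kinkMass_le (fun j => weight_nonneg hε x z j i) (z · i) (x i)
  rw [sum_weight hε, kinkMass_eq_cCoef hε hzeros hp hq] at h
  exact ⟨by linarith, by linarith [abs_nonneg (netSlope (weight ε x z · i) (z · i) (x i))]⟩

lemma sBar_bounds (hε : 0 < ε) (hsupp : SupportPattern x z p q)
    (hzeros : ConsecutiveZeros x z p q σ d)
    (hc : ∀ i : Fin n, p ≤ (i : ℕ) → (i : ℕ) < q → 1 / 2 < cCoef ε x z d i) :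
    (p : ℝ) ≤ sBar ε x z p q d ∧ sBar ε x z p q d < n := by
  have hq : (q : ℝ) < n := by exact_mod_cast hsupp.q_lt_n
  have h0 := (sum_indicator_ranges hsupp.p_le_q hsupp.q_lt_n.le).2.1
  rw [← Finset.sum_filter] at h0
  constructor
  · rw [sBar]
    refine le_add_of_nonneg_right (Finset.sum_nonneg fun i hi => ?_)
    obtain ⟨h1, h2⟩ := (Finset.mem_filter.1 hi).2
    linarith [(abs_netSlope_le_and_cCoef_le_one hε hzeros h1 h2).2]
  · have : ∑ i ∈ Finset.univ.filter (fun i : Fin n => p ≤ (i : ℕ) ∧ (i : ℕ) < q),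
        (1 - cCoef ε x z d i) ≤ q - p := by
      rw [← h0]
      refine Finset.sum_le_sum fun i hi => ?_
      obtain ⟨h1, h2⟩ := (Finset.mem_filter.1 hi).2
      linarith [hc i h1 h2]
    rw [sBar]
    linarith

/-- The scale is `τ = √(2L) / lam` with `L = log (n / s̄)`. Positions before `p` cost
`1 + 2 L a_i²`, those from `q` on at most `B = e^{-L} / √(π L)`, and those in between at most
`B c_i + κ (1 - c_i)`; in total the multiples of `B` are `n - s̄`. -/
theorem subdiffBound_add_one_le (hlam : 0 < lam) (hε : 0 < ε)
    (hsupp : SupportPattern x z p q) (hsort : SortedBy z σ)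
    (hzeros : ConsecutiveZeros x z p q σ d) (hloc : Located x z σ l)
    (hc : ∀ i : Fin n, p ≤ (i : ℕ) → (i : ℕ) < q → 1 / 2 < cCoef ε x z d i) :
    subdiffBound (nL1 lam (weight ε x z) z) x + 1 ≤ measurementBound ε x z p q σ l d := by
  obtain ⟨hs1, hs2⟩ := sBar_bounds hε hsupp hzeros hc
  have hp1 : (1 : ℝ) ≤ p := by exact_mod_cast hsupp.p_pos
  have hs0 : 0 < sBar ε x z p q d := by linarith
  set L := Real.log (n / sBar ε x z p q d) with hL'
  have hL : 0 < L := Real.log_pos ((one_lt_div hs0).2 hs2)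
  have hn : (n : ℝ) = sBar ε x z p q d * Real.exp L := by
    rw [hL', Real.exp_log (div_pos (by linarith) hs0), mul_div_cancel₀ _ hs0.ne']
  set B := Real.exp (-L) / Real.sqrt (Real.pi * L) with hB
  have hB0 : B * (n - sBar ε x z p q d) ≤ 2 / 5 * sBar ε x z p q d := exp_div_sqrt_mul_sub_le hL hs0 hn
  have ht : 0 < Real.sqrt (2 * L) := Real.sqrt_pos.2 (by positivity)
  have key := subdiffBound_nL1_le hlam (weight_nonneg hε x z) z x ht
  have hpt : ∀ i : Fin n,
      gaussTail (Real.sqrt (2 * L) * (kinkMass (weight ε x z · i) (z · i) (x i)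
          + netSlope (weight ε x z · i) (z · i) (x i)))
        + gaussTail (Real.sqrt (2 * L) * (kinkMass (weight ε x z · i) (z · i) (x i)
          - netSlope (weight ε x z · i) (z · i) (x i)))
      ≤ (if (i : ℕ) < p then 1 else 0) + 2 * L * (if (i : ℕ) < p then aCoef ε x z σ l i ^ 2 else 0)
        + (B * (if p ≤ (i : ℕ) ∧ (i : ℕ) < q then 1 else 0) + (kappa ε x z p q d - B) *
          (if p ≤ (i : ℕ) ∧ (i : ℕ) < q then 1 - cCoef ε x z d i else 0))
        + B * (if q ≤ (i : ℕ) then 1 else 0) := by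
    intro i
    rcases lt_or_ge (i : ℕ) p with h1 | h1
    · have h2 : (i : ℕ) < q := h1.trans_le hsupp.p_le_q
      have h3 := hsupp.nonzero i h1
      rw [kinkMass_eq_zero h3, netSlope_eq_aCoef hsort hloc h3, zero_add, zero_sub, mul_neg,
        gaussTail_add_gaussTail_neg, mul_pow, Real.sq_sqrt (by positivity)]
      simp [h1, not_le.2 h1, not_le.2 h2]
    rcases lt_or_ge (i : ℕ) q with h2 | h2
    · obtain ⟨h3, h4⟩ := abs_netSlope_le_and_cCoef_le_one hε hzeros h1 h2
      have h5 := gaussTail_add_gaussTail_le (t := Real.sqrt (2 * L)) h3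
      have h6 := gaussTail_add_gaussTail_mul_le hL (hc i h1 h2) h4
      have h7 := mul_le_mul_of_nonneg_right (le_kappa hc h1 h2 hL hL'.symm) (sub_nonneg.2 h4)
      rw [kinkMass_eq_cCoef hε hzeros h1 h2]
      simp only [not_lt.2 h1, h1, h2, not_le.2 h2, and_self, if_true, if_false]
      linarith
    · have h3 := hsupp.zero i h2
      rw [kinkMass_eq_one hε h3, netSlope_eq_zero h3, add_zero, sub_zero, mul_one]
      have h4 := two_mul_gaussTail_le hL
      simp only [not_lt.2 h1, h1, h2, not_lt.2 h2, and_false, if_true, if_false]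
      linarith
  have hsum := key.trans (Finset.sum_le_sum fun i _ => hpt i)
  obtain ⟨c1, c2, c3⟩ := sum_indicator_ranges (n := n) hsupp.p_le_q hsupp.q_lt_n.le
  rw [Finset.sum_add_distrib, Finset.sum_add_distrib, Finset.sum_add_distrib,
    Finset.sum_add_distrib, ← Finset.mul_sum, ← Finset.mul_sum, ← Finset.mul_sum,
    ← Finset.mul_sum, c1, c2, c3, ← Finset.sum_filter, ← Finset.sum_filter, ← aBar] at hsum
  have hmid : ∑ i ∈ Finset.univ.filter (fun i : Fin n => p ≤ (i : ℕ) ∧ (i : ℕ) < q),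
      (1 - cCoef ε x z d i) = sBar ε x z p q d - p := by rw [sBar]; ring
  rw [hmid] at hsum
  rw [measurementBound, deltaTerm, ← hL']
  linarith

/-- The probability estimate needs `m ≥ 3`, which any number of measurements above the bound
satisfies. -/
lemma lt_measurementBound (hε : 0 < ε) (hsupp : SupportPattern x z p q)
    (hzeros : ConsecutiveZeros x z p q σ d)
    (hc : ∀ i : Fin n, p ≤ (i : ℕ) → (i : ℕ) < q → 1 / 2 < cCoef ε x z d i) :
    2 < measurementBound ε x z p q σ l d := by
  obtain ⟨hs1, hs2⟩ := sBar_bounds hε hsupp hzeros hc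
  have hp1 : (1 : ℝ) ≤ p := by exact_mod_cast hsupp.p_pos
  have hs0 : 0 < sBar ε x z p q d := by linarith
  have hL : 0 < Real.log (n / sBar ε x z p q d) := Real.log_pos ((one_lt_div hs0).2 hs2)
  have ha : 0 ≤ aBar ε x z p σ l := Finset.sum_nonneg fun i _ => sq_nonneg _
  have hk : 0 ≤ kappa ε x z p q d * (sBar ε x z p q d - p) := by
    rw [sBar, add_sub_cancel_left, Finset.mul_sum]
    refine Finset.sum_nonneg fun i hi => ?_
    obtain ⟨h1, h2⟩ := (Finset.mem_filter.1 hi).2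
    have h3 := le_kappa hc h1 h2 hL rfl
    have h4 := hc i h1 h2
    exact mul_nonneg (le_trans (div_nonneg (by linarith) (mul_nonneg (Real.sqrt_nonneg _)
      (by linarith))) h3) (by linarith [(abs_netSlope_le_and_cCoef_le_one hε hzeros h1 h2).2])
  have := mul_nonneg ha hL.le
  rw [measurementBound, deltaTerm]
  linarith

lemma subdifferential_nL1_nonempty (hlam : 0 < lam) (hε : 0 < ε) :
    (subdifferential (nL1 lam (weight ε x z) z) x).Nonempty :=
  ⟨_, mem_subdifferential_nL1 hlam.le (weight_nonneg hε x z) z x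
    (a := fun i => netSlope (weight ε x z · i) (z · i) (x i)) fun i => by
      rw [sub_self, abs_zero]
      exact kinkMass_nonneg (weight_nonneg hε x z · i) _ _⟩

end Main
end CSSideInfo

theorem theorem1 {n J : ℕ} (lam ε : ℝ) (hlam : 0 < lam) (hε : 0 < ε)
    (x : EuclideanSpace ℝ (Fin n)) (z : Fin (J + 1) → EuclideanSpace ℝ (Fin n)) (hz : z 0 = 0)
    (p q : ℕ) (σ : Fin n → Equiv.Perm (Fin (J + 1))) (l : Fin n → ℤ) (d : Fin n → ℕ)
    (hsupp : CSSideInfo.SupportPattern x z p q)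
    (hsort : CSSideInfo.SortedBy z σ)
    (hzeros : CSSideInfo.ConsecutiveZeros x z p q σ d)
    (hloc : CSSideInfo.Located x z σ l)
    (hc : ∀ i : Fin n, p ≤ (i : ℕ) → (i : ℕ) < q → 1 / 2 < CSSideInfo.cCoef ε x z d i)
    (g : EuclideanSpace ℝ (Fin n) → ℝ)
    (hg : g = CSSideInfo.nL1 lam (CSSideInfo.weight ε x z) z) :
    CSSideInfo.gaussianWidth (CSSideInfo.descentCone g x) ^ 2
        ≤ CSSideInfo.statDim (CSSideInfo.descentCone g x) ∧
    CSSideInfo.statDim (CSSideInfo.descentCone g x) ≤ CSSideInfo.subdiffBound g x ∧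
    CSSideInfo.subdiffBound g x + 1 ≤ CSSideInfo.measurementBound ε x z p q σ l d ∧
    ∀ m : ℕ, CSSideInfo.measurementBound ε x z p q σ l d ≤ (m : ℝ) →
      ∀ {Ω : Type*} [MeasurableSpace Ω] (P : Measure Ω) [IsProbabilityMeasure P]
        (v : ℝ≥0) (Φ : Ω → Matrix (Fin m) (Fin n) ℝ),
        v ≠ 0 → CSSideInfo.IsGaussianMatrix P v Φ →
        P {ω | ¬ CSSideInfo.IsUniqueSolution g (Φ ω) ((Φ ω).mulVec (fun i => x i)) x}
          ≤ ENNReal.ofReal (Real.exp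
              (-(1 / 2) * (Real.sqrt m
                - CSSideInfo.gaussianWidth (CSSideInfo.descentCone g x)) ^ 2)) := by
  have h2 : CSSideInfo.statDim (CSSideInfo.descentCone g x) ≤ CSSideInfo.subdiffBound g x := by
    rw [hg]
    exact CSSideInfo.statDim_le_subdiffBound _ x (CSSideInfo.subdifferential_nL1_nonempty hlam hε)
  have h3 : CSSideInfo.subdiffBound g x + 1 ≤ CSSideInfo.measurementBound ε x z p q σ l d := by
    rw [hg]
    exact CSSideInfo.subdiffBound_add_one_le hlam hε hsupp hsort hzeros hloc hc
  refine ⟨CSSideInfo.gaussianWidth_sq_le_statDim _, h2, h3, ?_⟩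
  intro m hm Ω _ P _ v Φ hv hΦ
  refine CSSideInfo.measure_not_isUniqueSolution_le ?_ (by linarith) P hv hΦ
  have h4 : (2 : ℝ) < m :=
    (CSSideInfo.lt_measurementBound (σ := σ) (l := l) hε hsupp hzeros hc).trans_le hm
  exact_mod_cast h4
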